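/- **Setting.** A *transition system* over a finite set $\mathrm{AP}$ of atomic propositions is a tuple $\mathcal T=(V,E,v_I,\lambda)$ with a set $V$ of vertices, $v_I\in V$, $\lambda\colon V\to 2^{\mathrm{AP}}$ and $E\subseteq V\times V$ such that every vertex has a successor. It is *finitely-branching* if every vertex has finitely many successors, and *bounded-branching* if there is $k\in\mathbb N$ such that every vertex has at most $k$ successors. Paths are infinite sequences of vertices along edges; the trace of a path $\rho$ is $\lambda(\rho(0))\lambda(\rho(1))\cdots$. HyperCTL$^*$ formulas over $\mathrm{AP}$ are $\varphi::=a_\pi\mid\neg\varphi\mid\varphi\vee\varphi\mid\mathbf X\varphi\mid\varphi\,\mathbf U\,\varphi\mid\exists\pi.\varphi\mid\forall\pi.\varphi$, where every temporal operator is in the scope of a path quantifier; path quantifiers range over the paths of $\mathcal T$ that start at the current vertex of the most recently quantified path (at $v_I$ if there is none), and $\mathbf X,\mathbf U$ advance all assigned paths synchronously. Sentences are formulas without free variables. HyperCTL$^*$ *countable* (respectively *finitely-branching*, *bounded-branching*) *satisfiability* is the problem whether a given HyperCTL$^*$ sentence has a model that is a countable (respectively finitely-branching, bounded-branching) transition system.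 *Truth in second-order arithmetic* is the problem whether a given sentence of second-order arithmetic (with quantification over numbers and over sets of numbers) holds in $(\mathbb N,0,1,+,\cdot,<,\in)$. Problems are *effectively interreducible* if each is many-one reducible to each other one by a computable function on (codes of) instances; numbers that are not codes of sentences are negative instances. **Theorem.** 1. The following four problems are effectively interreducible: (a) HyperCTL$^*$ countable satisfiability; (b) HyperCTL$^*$ finitely-branching satisfiability; (c) HyperCTL$^*$ bounded-branching satisfiability; (d) truth in second-order arithmetic. This holds when the number of atomic propositions is part of the input of (a)–(c), i.e. an instance is a pair of some $n\in\mathbb N$ and a sentence over $\mathrm{AP}=\{0,\dots,n-1\}$, and also when $\mathrm{AP}=\{0,\dots,n-1\}$ is fixed, for every $n\ge 8$. 2. Let $T_{op}$ be the set of all traces $t\in(2^{\mathrm{AP}})^\omega$ over $\mathrm{AP}=\{\mathtt{arg1},\mathtt{arg2},\mathtt{res},\mathtt{add},\mathtt{mult}\}$ such that there are unique $n_1,n_2,n_3$ with $\mathtt{arg1}\in t(n_1)$, $\mathtt{arg2}\in t(n_2)$, $\mathtt{res}\in t(n_3)$, and either $\mathtt{add}\in t(n)$ and $\mathtt{mult}\notin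 t(n)$ for all $n$ and $n_1+n_2=n_3$, or $\mathtt{mult}\in t(n)$ and $\mathtt{add}\notin t(n)$ for all $n$ and $n_1\cdot n_2=n_3$. Let $\mathrm{cl}(T_{op})$ be the set of all traces each of whose finite prefixes is a prefix of some trace in $T_{op}$. There is a HyperLTL sentence (a prefix of quantifiers over traces, followed by a quantifier-free formula built from $a_\pi,\neg,\vee,\mathbf X,\mathbf U$) such that a set $T$ of traces is a model of it if and only if $T=\mathrm{cl}(T_{op})$. 3. Let $\mathcal T(\mathrm{cl}(T_{op}))$ be the transition system whose vertices are the finite prefixes of traces in $\mathrm{cl}(T_{op})$, whose initial vertex is the empty word $\varepsilon$, whose edges are the pairs $(w,wv)$ with $v\in 2^{\mathrm{AP}}$, and whose labelling is $\lambda(\varepsilon)=\emptyset$, $\lambda(wv)=v$. It is countable and finitely-branching, and the set of traces of its paths that start at successors of the initial vertex is exactly $\mathrm{cl}(T_{op})$. -/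

import Mathlib

/-! ### Traces, prefixes and closure -/

/-- Trace and path variables: a fixed countable set. -/
abbrev PathVar : Type := ℕ

/-- A trace over `AP`: an infinite word over the powerset of `AP`. -/
abbrev Trace (AP : Type) : Type := ℕ → Set AP

namespace Trace

variable {AP : Type}

/-- The prefix `t(0) ⋯ t(n-1)`. -/
def take (t : Trace AP) (n : ℕ) : List (Set AP) := (List.range n).map t

/-- The suffix `t(j) t(j+1) ⋯`. -/
def drop (t : Trace AP) (j : ℕ) : Trace AP := fun n => t (j + n)

/-- The set of finite prefixes of a trace. -/
def prefs (t : Trace AP) : Set (List (Set AP)) := {w | ∃ n, w = t.take n}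

/-- The set of finite prefixes of a set of traces. -/
def prefsOf (T : Set (Trace AP)) : Set (List (Set AP)) := ⋃ t ∈ T, t.prefs

/-- The closure of a set of traces. -/
def closure (T : Set (Trace AP)) : Set (Trace AP) := {t | t.prefs ⊆ prefsOf T}

theorem subset_closure (T : Set (Trace AP)) : T ⊆ closure T :=
  fun _ ht _ hw => Set.mem_biUnion ht hw

end Trace

/-! ### Transition systems -/

/-- A transition system with vertex set `V`, labelled by subsets of `AP`, in which every vertex has
an outgoing edge. The vertex set is non-empty because of the initial vertex. -/
structure TransitionSystem (AP V : Type) where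
  edge : V → V → Prop
  init : V
  label : V → Set AP
  total : ∀ v, ∃ w, edge v w

namespace TransitionSystem

variable {AP V : Type}

/-- Paths: infinite sequences of vertices along edges. -/
def Path (S : TransitionSystem AP V) : Type := {ρ : ℕ → V // ∀ n, S.edge (ρ n) (ρ (n + 1))}

/-- The vertex `ρ(n)`. -/
def Path.at {S : TransitionSystem AP V} (ρ : S.Path) (n : ℕ) : V := ρ.1 n

/-- The suffix `ρ(j) ρ(j+1) ⋯`. -/
def Path.drop {S : TransitionSystem AP V} (ρ : S.Path) (j : ℕ) : S.Path :=
  ⟨fun n => ρ.1 (j + n), fun n => ρ.2 (j + n)⟩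

/-- The trace `λ(ρ(0)) λ(ρ(1)) ⋯`. -/
def Path.trace {S : TransitionSystem AP V} (ρ : S.Path) : Trace AP := fun n => S.label (ρ.at n)

/-- Every vertex has only finitely many successors. -/
def FinitelyBranching (S : TransitionSystem AP V) : Prop := ∀ v, {w | S.edge v w}.Finite

/-- Every vertex has at most `k` successors, for some uniform `k`. -/
def BoundedBranching (S : TransitionSystem AP V) : Prop :=
  ∃ k : ℕ, ∀ v, {w | S.edge v w}.encard ≤ k

/-- The traces of the paths starting at successors of the initial vertex. -/
def tracesFromSuccessors (S : TransitionSystem AP V) : Set (Trace AP) :=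
  {t | ∃ ρ : S.Path, S.edge S.init (ρ.at 0) ∧ ρ.trace = t}

end TransitionSystem

namespace Trace

variable {AP : Type}

theorem nil_mem_prefsOf {T : Set (Trace AP)} (hT : T.Nonempty) : [] ∈ prefsOf T := by
  obtain ⟨t, ht⟩ := hT
  exact Set.mem_biUnion ht ⟨0, rfl⟩

theorem exists_append_mem_prefsOf {T : Set (Trace AP)} {w : List (Set AP)} (hw : w ∈ prefsOf T) :
    ∃ a, w ++ [a] ∈ prefsOf T := by
  obtain ⟨t, ht, n, rfl⟩ := Set.mem_iUnion₂.1 hw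
  exact ⟨t n, Set.mem_biUnion ht ⟨n + 1, by simp [take, List.range_succ]⟩⟩

/-- The prefix tree of a non-empty set `T` of traces: its vertices are the finite prefixes of `T`,
its initial vertex is the empty word, its edges lead from `w` to `w a`, the empty word has the empty
label and `w a` has the label `a`. -/
def prefixTree (T : Set (Trace AP)) (hT : T.Nonempty) : TransitionSystem AP (prefsOf T) where
  edge w w' := ∃ a, w'.1 = w.1 ++ [a]
  init := ⟨[], nil_mem_prefsOf hT⟩
  label w := w.1.getLastD ∅
  total w := by
    obtain ⟨a, ha⟩ := exists_append_mem_prefsOf w.2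
    exact ⟨⟨_, ha⟩, a, rfl⟩

end Trace

/-! ### HyperLTL -/

/-- Quantifier-free HyperLTL formulas. -/
inductive HyperLTLBody (AP : Type) : Type
  | atom (a : AP) (v : PathVar)
  | neg (ψ : HyperLTLBody AP)
  | or (ψ₁ ψ₂ : HyperLTLBody AP)
  | next (ψ : HyperLTLBody AP)
  | until (ψ₁ ψ₂ : HyperLTLBody AP)

/-- HyperLTL formulas: a quantifier prefix followed by a quantifier-free formula. -/
inductive HyperLTL (AP : Type) : Type
  | body (ψ : HyperLTLBody AP)
  | ex (v : PathVar) (φ : HyperLTL AP)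
  | all (v : PathVar) (φ : HyperLTL AP)

/-- Trace assignments: partial maps from variables to traces. -/
abbrev TraceAssignment (AP : Type) : Type := PathVar → Option (Trace AP)

/-- The assignment `Γ[j,∞)`. -/
def TraceAssignment.drop {AP : Type} (Γ : TraceAssignment AP) (j : ℕ) : TraceAssignment AP :=
  fun v => (Γ v).map fun t => Trace.drop t j

/-- The assignment `Γ[v → t]`. -/
def TraceAssignment.set {AP : Type} (Γ : TraceAssignment AP) (v : PathVar) (t : Trace AP) :
    TraceAssignment AP :=
  Function.update Γ v (some t)

namespace HyperLTLBody

variable {AP : Type}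

def freeVars : HyperLTLBody AP → Set PathVar
  | atom _ v => {v}
  | neg ψ => ψ.freeVars
  | or ψ₁ ψ₂ => ψ₁.freeVars ∪ ψ₂.freeVars
  | next ψ => ψ.freeVars
  | .until ψ₁ ψ₂ => ψ₁.freeVars ∪ ψ₂.freeVars

def Holds : HyperLTLBody AP → TraceAssignment AP → Prop
  | atom a v, Γ => ∃ t, Γ v = some t ∧ a ∈ t 0
  | neg ψ, Γ => ¬ ψ.Holds Γ
  | or ψ₁ ψ₂, Γ => ψ₁.Holds Γ ∨ ψ₂.Holds Γ
  | next ψ, Γ => ψ.Holds (Γ.drop 1)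
  | .until ψ₁ ψ₂, Γ => ∃ j, ψ₂.Holds (Γ.drop j) ∧ ∀ i < j, ψ₁.Holds (Γ.drop i)

end HyperLTLBody

namespace HyperLTL

variable {AP : Type}

def freeVars : HyperLTL AP → Set PathVar
  | body ψ => ψ.freeVars
  | ex v φ => φ.freeVars \ {v}
  | all v φ => φ.freeVars \ {v}

def IsSentence (φ : HyperLTL AP) : Prop := φ.freeVars = ∅

def Holds (T : Set (Trace AP)) : HyperLTL AP → TraceAssignment AP → Prop
  | body ψ, Γ => ψ.Holds Γ
  | ex v φ, Γ => ∃ t ∈ T, Holds T φ (Γ.set v t)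
  | all v φ, Γ => ∀ t ∈ T, Holds T φ (Γ.set v t)

/-- `T` is a model of `φ`. -/
def IsModel (T : Set (Trace AP)) (φ : HyperLTL AP) : Prop := φ.Holds T fun _ => none

end HyperLTL

/-! ### The set of traces encoding addition and multiplication -/

inductive ArithProp : Type
  | arg₁ | arg₂ | res | add | mult

/-- The traces in which each of `arg₁`, `arg₂`, `res` holds at exactly one position, these positions
being `n₁`, `n₂`, `n₃`, and either `add` holds always, `mult` never and `n₁ + n₂ = n₃`, or `mult`
holds always, `add` never and `n₁ * n₂ = n₃`. -/
def opTraces : Set (Trace ArithProp) :=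
  {t | ∃ n₁ n₂ n₃ : ℕ,
    (∀ n, .arg₁ ∈ t n ↔ n = n₁) ∧ (∀ n, .arg₂ ∈ t n ↔ n = n₂) ∧ (∀ n, .res ∈ t n ↔ n = n₃) ∧
    ((∀ n, .add ∈ t n ∧ .mult ∉ t n) ∧ n₁ + n₂ = n₃ ∨
     (∀ n, .mult ∈ t n ∧ .add ∉ t n) ∧ n₁ * n₂ = n₃)}

theorem opTraces_nonempty : opTraces.Nonempty :=
  ⟨fun n => {a | a = .add ∨ (n = 0 ∧ a ≠ .mult)}, 0, 0, 0, by simp, by simp, by simp,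
    Or.inl ⟨by simp, rfl⟩⟩

theorem closure_opTraces_nonempty : (Trace.closure opTraces).Nonempty :=
  opTraces_nonempty.mono (Trace.subset_closure _)

/-! ### HyperCTL* -/

/-- HyperCTL* formulas. -/
inductive HyperCTL (AP : Type) : Type
  | atom (a : AP) (v : PathVar)
  | neg (φ : HyperCTL AP)
  | or (φ₁ φ₂ : HyperCTL AP)
  | next (φ : HyperCTL AP)
  | until (φ₁ φ₂ : HyperCTL AP)
  | ex (v : PathVar) (φ : HyperCTL AP)
  | all (v : PathVar) (φ : HyperCTL AP)

/-- Path assignments: partial maps from variables to paths, together with the variable most recently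
added or changed (if there is one). -/
structure PathAssignment {AP V : Type} (S : TransitionSystem AP V) where
  map : PathVar → Option S.Path
  recent : Option PathVar

namespace PathAssignment

variable {AP V : Type} {S : TransitionSystem AP V}

/-- The assignment with empty domain. -/
def empty (S : TransitionSystem AP V) : PathAssignment S := ⟨fun _ => none, none⟩

/-- The assignment `Γ[j,∞)`. -/
def drop (Γ : PathAssignment S) (j : ℕ) : PathAssignment S :=
  ⟨fun v => (Γ.map v).map fun ρ => ρ.drop j, Γ.recent⟩

/-- The assignment `Γ[v → ρ]`. -/
def set (Γ : PathAssignment S) (v : PathVar) (ρ : S.Path) : PathAssignment S :=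
  ⟨Function.update Γ.map v (some ρ), some v⟩

/-- The first vertex of the path assigned to the most recently added or changed variable; the initial
vertex of the system if the assignment is empty. -/
def rcnt (Γ : PathAssignment S) : V :=
  match Γ.recent.bind Γ.map with
  | some ρ => ρ.at 0
  | none => S.init

end PathAssignment

namespace HyperCTL

variable {AP : Type}

def freeVars : HyperCTL AP → Set PathVar
  | atom _ v => {v}
  | neg φ => φ.freeVars
  | or φ₁ φ₂ => φ₁.freeVars ∪ φ₂.freeVars
  | next φ => φ.freeVars
  | .until φ₁ φ₂ => φ₁.freeVars ∪ φ₂.freeVars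
  | ex v φ => φ.freeVars \ {v}
  | all v φ => φ.freeVars \ {v}

/-- Every temporal operator of the formula is in the scope of a path quantifier. -/
def TemporalGuarded : HyperCTL AP → Prop
  | atom _ _ => True
  | neg φ => φ.TemporalGuarded
  | or φ₁ φ₂ => φ₁.TemporalGuarded ∧ φ₂.TemporalGuarded
  | next _ => False
  | .until _ _ => False
  | ex _ _ => True
  | all _ _ => True

def IsSentence (φ : HyperCTL AP) : Prop := φ.TemporalGuarded ∧ φ.freeVars = ∅

def Holds {V : Type} (S : TransitionSystem AP V) : HyperCTL AP → PathAssignment S → Prop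
  | atom a v, Γ => ∃ ρ, Γ.map v = some ρ ∧ a ∈ S.label (ρ.at 0)
  | neg φ, Γ => ¬ Holds S φ Γ
  | or φ₁ φ₂, Γ => Holds S φ₁ Γ ∨ Holds S φ₂ Γ
  | next φ, Γ => Holds S φ (Γ.drop 1)
  | .until φ₁ φ₂, Γ => ∃ j, Holds S φ₂ (Γ.drop j) ∧ ∀ i < j, Holds S φ₁ (Γ.drop i)
  | ex v φ, Γ => ∃ ρ : S.Path, ρ.at 0 = Γ.rcnt ∧ Holds S φ (Γ.set v ρ)
  | all v φ, Γ => ∀ ρ : S.Path, ρ.at 0 = Γ.rcnt → Holds S φ (Γ.set v ρ)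

/-- `S` is a model of `φ`. -/
def IsModel {V : Type} (S : TransitionSystem AP V) (φ : HyperCTL AP) : Prop :=
  φ.Holds S (PathAssignment.empty S)

/-- Gödel numbers of formulas. -/
def code [Encodable AP] : HyperCTL AP → ℕ
  | atom a v => Nat.pair 0 (Nat.pair (Encodable.encode a) v)
  | neg φ => Nat.pair 1 φ.code
  | or φ₁ φ₂ => Nat.pair 2 (Nat.pair φ₁.code φ₂.code)
  | next φ => Nat.pair 3 φ.code
  | .until φ₁ φ₂ => Nat.pair 4 (Nat.pair φ₁.code φ₂.code)
  | ex v φ => Nat.pair 5 (Nat.pair v φ.code)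
  | all v φ => Nat.pair 6 (Nat.pair v φ.code)

theorem code_injective [Encodable AP] : Function.Injective (code (AP := AP)) := by
  intro φ
  induction φ <;> intro χ h <;> cases χ <;> simp only [code, Nat.pair_eq_pair] at h <;> simp_all
  all_goals grind

end HyperCTL

/-! ### Second-order arithmetic -/

/-- First-order terms over the signature `0, 1, +, ·`. -/
inductive ArithTerm : Type
  | var (x : ℕ)
  | zero
  | one
  | add (s t : ArithTerm)
  | mul (s t : ArithTerm)

namespace ArithTerm

def freeVars : ArithTerm → Set ℕ
  | var x => {x}
  | zero => ∅
  | one => ∅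
  | add s t => s.freeVars ∪ t.freeVars
  | mul s t => s.freeVars ∪ t.freeVars

/-- The value of a term in the natural numbers. -/
def val (e : ℕ → ℕ) : ArithTerm → ℕ
  | var x => e x
  | zero => 0
  | one => 1
  | add s t => s.val e + t.val e
  | mul s t => s.val e * t.val e

/-- Gödel numbers of terms. -/
def code : ArithTerm → ℕ
  | var x => Nat.pair 0 x
  | zero => Nat.pair 1 0
  | one => Nat.pair 2 0
  | add s t => Nat.pair 3 (Nat.pair s.code t.code)
  | mul s t => Nat.pair 4 (Nat.pair s.code t.code)

theorem code_injective : Function.Injective code := by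
  intro s
  induction s <;> intro t h <;> cases t <;> simp only [code, Nat.pair_eq_pair] at h <;> simp_all
  all_goals grind

end ArithTerm

/-- Formulas of second-order arithmetic: number variables `x` and set variables `X` are two
separate sorts, both indexed by `ℕ`. -/
inductive SOArith : Type
  | eq (s t : ArithTerm)
  | lt (s t : ArithTerm)
  | mem (s : ArithTerm) (X : ℕ)
  | neg (φ : SOArith)
  | or (φ₁ φ₂ : SOArith)
  | exNum (x : ℕ) (φ : SOArith)
  | allNum (x : ℕ) (φ : SOArith)
  | exSet (X : ℕ) (φ : SOArith)
  | allSet (X : ℕ) (φ : SOArith)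

namespace SOArith

def freeNumVars : SOArith → Set ℕ
  | eq s t => s.freeVars ∪ t.freeVars
  | lt s t => s.freeVars ∪ t.freeVars
  | mem s _ => s.freeVars
  | neg φ => φ.freeNumVars
  | or φ₁ φ₂ => φ₁.freeNumVars ∪ φ₂.freeNumVars
  | exNum x φ => φ.freeNumVars \ {x}
  | allNum x φ => φ.freeNumVars \ {x}
  | exSet _ φ => φ.freeNumVars
  | allSet _ φ => φ.freeNumVars

def freeSetVars : SOArith → Set ℕ
  | eq _ _ => ∅
  | lt _ _ => ∅
  | mem _ X => {X}
  | neg φ => φ.freeSetVars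
  | or φ₁ φ₂ => φ₁.freeSetVars ∪ φ₂.freeSetVars
  | exNum _ φ => φ.freeSetVars
  | allNum _ φ => φ.freeSetVars
  | exSet X φ => φ.freeSetVars \ {X}
  | allSet X φ => φ.freeSetVars \ {X}

def IsSentence (φ : SOArith) : Prop := φ.freeNumVars = ∅ ∧ φ.freeSetVars = ∅

/-- Satisfaction in the standard model, under a valuation `e` of the number variables and a valuation
`E` of the set variables. -/
def Holds : SOArith → (ℕ → ℕ) → (ℕ → Set ℕ) → Prop
  | eq s t, e, _ => s.val e = t.val e
  | lt s t, e, _ => s.val e < t.val e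
  | mem s X, e, E => s.val e ∈ E X
  | neg φ, e, E => ¬ φ.Holds e E
  | or φ₁ φ₂, e, E => φ₁.Holds e E ∨ φ₂.Holds e E
  | exNum x φ, e, E => ∃ n : ℕ, φ.Holds (Function.update e x n) E
  | allNum x φ, e, E => ∀ n : ℕ, φ.Holds (Function.update e x n) E
  | exSet X φ, e, E => ∃ A : Set ℕ, φ.Holds e (Function.update E X A)
  | allSet X φ, e, E => ∀ A : Set ℕ, φ.Holds e (Function.update E X A)

/-- Gödel numbers of formulas. -/
def code : SOArith → ℕ
  | eq s t => Nat.pair 0 (Nat.pair s.code t.code)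
  | lt s t => Nat.pair 1 (Nat.pair s.code t.code)
  | mem s X => Nat.pair 2 (Nat.pair s.code X)
  | neg φ => Nat.pair 3 φ.code
  | or φ₁ φ₂ => Nat.pair 4 (Nat.pair φ₁.code φ₂.code)
  | exNum x φ => Nat.pair 5 (Nat.pair x φ.code)
  | allNum x φ => Nat.pair 6 (Nat.pair x φ.code)
  | exSet X φ => Nat.pair 7 (Nat.pair X φ.code)
  | allSet X φ => Nat.pair 8 (Nat.pair X φ.code)

theorem code_injective : Function.Injective code := by
  intro φ
  induction φ <;> intro χ h <;> cases χ <;> simp only [code, Nat.pair_eq_pair] at h <;> simp_all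
  all_goals grind [ArithTerm.code_injective, Function.Injective]

end SOArith

/-! ### The decision problems, as sets of Gödel numbers -/

/-- Truth in second-order arithmetic. -/
def SOTruth (c : ℕ) : Prop :=
  ∃ φ : SOArith, φ.code = c ∧ φ.IsSentence ∧ ∀ e E, φ.Holds e E

/-- HyperCTL* countable satisfiability over `n` atomic propositions. -/
def CountableSat (n c : ℕ) : Prop :=
  ∃ φ : HyperCTL (Fin n), φ.code = c ∧ φ.IsSentence ∧
    ∃ (V : Type) (S : TransitionSystem (Fin n) V), Countable V ∧ φ.IsModel S

/-- HyperCTL* finitely-branching satisfiability over `n` atomic propositions. -/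
def FinitelyBranchingSat (n c : ℕ) : Prop :=
  ∃ φ : HyperCTL (Fin n), φ.code = c ∧ φ.IsSentence ∧
    ∃ (V : Type) (S : TransitionSystem (Fin n) V), S.FinitelyBranching ∧ φ.IsModel S

/-- HyperCTL* bounded-branching satisfiability over `n` atomic propositions. -/
def BoundedBranchingSat (n c : ℕ) : Prop :=
  ∃ φ : HyperCTL (Fin n), φ.code = c ∧ φ.IsSentence ∧
    ∃ (V : Type) (S : TransitionSystem (Fin n) V), S.BoundedBranching ∧ φ.IsModel S

/-- The version of a problem `P` in which the number of atomic propositions is part of the input. -/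
def Uniform (P : ℕ → ℕ → Prop) (m : ℕ) : Prop := P m.unpair.1 m.unpair.2

/-- All problems in `Ps` are effectively reducible to each other (by many-one reductions given by
total computable functions). -/
def EffectivelyInterreducible (Ps : Set (ℕ → Prop)) : Prop := ∀ P ∈ Ps, ∀ Q ∈ Ps, P ≤₀ Q

/-! Hardness. A HyperCTL* sentence can force each of its models to contain standard arithmetic. A
number is a path on which the proposition `ι (.inr false)` holds at exactly one position, and a set
of numbers is a path with arbitrary values of that proposition. That all sets occur is a branching
condition (`allSets`): after any unmarked start, every vertex reached has a successor with the bit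
and one without it. A path through such a part of the model can then realise any set bit by bit, so
countably many vertices suffice for uncountably many sets (`exists_encodes_of_allSets`). Addition
and multiplication are supplied by paths marked with `ι (.inr true)`, whose traces must be exactly
the closure of `opTraces`. Quantifiers over numbers and sets become path quantifiers, and one
bounded-branching countable system, `arithSystem`, serves all three classes of models.

The unique model. Topologically, the closure of `opTraces` allows each mark to move to infinity.
With the position `⊤` for a missing mark, addition and multiplication extend to continuous
operations on `ℕ∞`, where `0 * ⊤ = 0`; hence the closure consists of the graphs of the extended
operations (`OpCode.mem_closure_opTraces_iff`). A HyperLTL sentence can compare positions and shift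
them by one, so it can state the recursion equations of the operations, their values at `⊤`, and
single-valuedness. The recursion puts every correct trace into a model, and single-valuedness then
excludes every incorrect one (`OpFormula.isModel_iff`). The closure, unlike `opTraces`, is the trace
set of a finitely-branching tree.

Membership. Satisfaction is invariant under bounded morphisms, and only reachable vertices matter.
In each class the reachable part is countable, so a satisfiable sentence has a model on `ℕ` in the
same class (`TransitionSystem.exists_nat_system`). Second-order arithmetic can quantify over the
edge relation and the labelling of such a system and over its paths, each path being a set of pairs
of a time and a vertex. The semantics is transcribed clause by clause (`HyperCTL.holds_toSO`), and
the branching conditions are expressible as well.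

Both translations must be computable on Gödel numbers. They are folds over codes whose handlers are
assembled from the formula templates by `UniformCode`; recognizers for codes send all other numbers
to a fixed number that codes nothing. -/

/-! ### Primitive recursion on codes -/

/-- Recursion on Gödel numbers `Nat.pair tag body`: the handler receives the tag, the body, and the
recursive values at the body and at its two components (where these are smaller than the number). -/
def codeFold {α σ : Type} [Inhabited σ] (H : α → ℕ × ℕ × σ × σ × σ → σ) (a : α) (c : ℕ) : σ :=
  H a (c.unpair.1, c.unpair.2,
    if _ : c.unpair.2 < c then codeFold H a c.unpair.2 else default,
    if _ : c.unpair.2.unpair.1 < c then codeFold H a c.unpair.2.unpair.1 else default,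
    if _ : c.unpair.2.unpair.2 < c then codeFold H a c.unpair.2.unpair.2 else default)
termination_by c

/-- Fails for tag `0`, since `Nat.pair 0 0 = 0` and `Nat.pair 0 1 = 1`. In all codings the tag `0`
therefore belongs to a constructor without recursive arguments. -/
theorem Nat.lt_pair_of_pos {t b : ℕ} (ht : 0 < t) : b < Nat.pair t b :=
  calc b = 0 + b := (Nat.zero_add b).symm
    _ < t + b := by omega
    _ ≤ Nat.pair t b := Nat.add_le_pair t b

section

variable {α σ : Type} [Inhabited σ] (H : α → ℕ × ℕ × σ × σ × σ → σ) (a : α)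

theorem codeFold_pair {t : ℕ} (ht : 0 < t) (b : ℕ) :
    codeFold H a (Nat.pair t b) = H a (t, b, codeFold H a b, codeFold H a b.unpair.1,
      codeFold H a b.unpair.2) := by
  have h := Nat.lt_pair_of_pos (b := b) ht
  rw [codeFold]
  simp [h, (Nat.unpair_left_le b).trans_lt h, (Nat.unpair_right_le b).trans_lt h]

theorem codeFold_pair_zero (h : ∀ b x y z x' y' z', H a (0, b, x, y, z) = H a (0, b, x', y', z'))
    (b : ℕ) : codeFold H a (Nat.pair 0 b) = H a (0, b, default, default, default) := by
  rw [codeFold]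
  simp only [Nat.unpair_pair]
  exact h ..

/-- Course-of-values recursion: the handler looks up earlier values in the list of all values below
the current number. Looking up beyond the end yields `default`, exactly as in the definition of the
fold. -/
theorem Primrec.codeFold [Primcodable α] [Primcodable σ] (hH : Primrec₂ H) :
    Primrec₂ (codeFold H) := by
  let g : α → List σ → Option σ := fun a l =>
    let c := l.length
    some (H a (c.unpair.1, c.unpair.2, l.getD c.unpair.2 default,
      l.getD c.unpair.2.unpair.1 default, l.getD c.unpair.2.unpair.2 default))
  have hl : Primrec fun p : α × List σ => p.2.length := Primrec.list_length.comp Primrec.snd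
  have h1 := Primrec.fst.comp (Primrec.unpair.comp hl)
  have h2 := Primrec.snd.comp (Primrec.unpair.comp hl)
  have h21 := Primrec.fst.comp (Primrec.unpair.comp h2)
  have h22 := Primrec.snd.comp (Primrec.unpair.comp h2)
  have hd := Primrec.list_getD (default : σ)
  have hg : Primrec₂ g := Primrec.option_some.comp <| hH.comp Primrec.fst <|
    h1.pair <| h2.pair <| (hd.comp Primrec.snd h2).pair <|
      (hd.comp Primrec.snd h21).pair (hd.comp Primrec.snd h22)
  refine Primrec.nat_strong_rec _ hg fun a n => ?_
  have key : ∀ i, ((List.range n).map (_root_.codeFold H a)).getD i default =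
      if _ : i < n then _root_.codeFold H a i else default := by
    intro i
    by_cases h : i < n <;> simp [h, List.getD_eq_getElem?_getD]
  simp only [g, key, List.length_map, List.length_range]
  exact congrArg some (by conv_rhs => rw [_root_.codeFold])

/-- Hides the well-founded definition: only primitive recursiveness and the two recursion equations
are used afterwards. A handler that ignores recursive values at tag `0` makes the first equation
unconditional. -/
theorem exists_codeFold [Primcodable α] [Primcodable σ] (hH : Primrec₂ H)
    (h : ∀ a b x y z x' y' z', H a (0, b, x, y, z) = H a (0, b, x', y', z')) :
    ∃ F : α → ℕ → σ, Primrec₂ F ∧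
      (∀ a b, F a (Nat.pair 0 b) = H a (0, b, default, default, default)) ∧
      ∀ a t b, 0 < t →
        F a (Nat.pair t b) = H a (t, b, F a b, F a b.unpair.1, F a b.unpair.2) :=
  ⟨codeFold H, Primrec.codeFold H hH, fun a => codeFold_pair_zero H a (h a),
    fun a _ b ht => codeFold_pair H a ht b⟩

end

/-! ### The closure of the set of operation traces -/

theorem Trace.mem_closure_iff {AP : Type} {T : Set (Trace AP)} {t : Trace AP} :
    t ∈ Trace.closure T ↔ ∀ N, ∃ t' ∈ T, ∀ n < N, t n = t' n := by
  have key : ∀ (t t' : Trace AP) N, t.take N = t'.take N ↔ ∀ n < N, t n = t' n := by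
    intro t t' N
    simp [Trace.take, List.map_inj_left]
  constructor
  · intro h N
    obtain ⟨t', ht', M, hM⟩ := Set.mem_iUnion₂.1 (h ⟨N, rfl⟩)
    have : N = M := by simpa [Trace.take] using congrArg List.length hM
    exact ⟨t', ht', (key ..).1 (this ▸ hM)⟩
  · rintro h _ ⟨N, rfl⟩
    obtain ⟨t', ht', h⟩ := h N
    exact Set.mem_biUnion ht' ⟨N, (key ..).2 h⟩

/-- The position of a mark in an operation trace, `⊤` if it does not occur, and the operation. -/
structure OpCode where
  mul : Bool
  fst : ℕ∞
  snd : ℕ∞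
  out : ℕ∞

namespace OpCode

/-- The value `⊤` for `add` and `mult` is a dummy: no natural number equals it, so in `trace` these
two propositions are governed by `mul` alone. -/
def pos (q : OpCode) : ArithProp → ℕ∞
  | .arg₁ => q.fst
  | .arg₂ => q.snd
  | .res => q.out
  | _ => ⊤

def trace (q : OpCode) : Trace ArithProp := fun n =>
  {p | (n : ℕ∞) = q.pos p ∨ (p = .add ∧ q.mul = false) ∨ (p = .mult ∧ q.mul = true)}

/-- The value of the operation, in the extended natural numbers. -/
def value (mul : Bool) (a b : ℕ∞) : ℕ∞ := if mul then a * b else a + b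

def Valid (q : OpCode) : Prop := q.out = value q.mul q.fst q.snd

theorem mem_trace_of_mark {q : OpCode} {p : ArithProp} (h : p ≠ .add ∧ p ≠ .mult) {n : ℕ} :
    p ∈ q.trace n ↔ (n : ℕ∞) = q.pos p := by
  simp [trace, h]

@[simp] theorem add_mem_trace {q : OpCode} {n : ℕ} : .add ∈ q.trace n ↔ q.mul = false := by
  simp [trace, pos]

@[simp] theorem mult_mem_trace {q : OpCode} {n : ℕ} : .mult ∈ q.trace n ↔ q.mul = true := by
  simp [trace, pos]

theorem exists_pos {P : ℕ → Prop} (h : ∀ m n, P m → P n → m = n) :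
    ∃ a : ℕ∞, ∀ n : ℕ, P n ↔ (n : ℕ∞) = a := by
  by_cases hP : ∃ n, P n
  · obtain ⟨n, hn⟩ := hP
    refine ⟨n, fun m => ⟨fun hm => by rw [h m n hm hn], fun hm => ?_⟩⟩
    rwa [show m = n by exact_mod_cast hm]
  · exact ⟨⊤, fun n => by simpa using fun hn => hP ⟨n, hn⟩⟩

/-- Traces which look like operation traces, possibly with missing marks and a wrong result. -/
def Shaped (t : Trace ArithProp) : Prop :=
  ((∀ n, .add ∈ t n ∧ .mult ∉ t n) ∨ (∀ n, .mult ∈ t n ∧ .add ∉ t n)) ∧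
    ∀ p, p ≠ .add ∧ p ≠ .mult → ∀ m n, p ∈ t m → p ∈ t n → m = n

theorem shaped_iff {t : Trace ArithProp} : Shaped t ↔ ∃ q : OpCode, t = q.trace := by
  constructor
  · rintro ⟨hop, hm⟩
    obtain ⟨a, ha⟩ := exists_pos (hm .arg₁ (by simp))
    obtain ⟨b, hb⟩ := exists_pos (hm .arg₂ (by simp))
    obtain ⟨c, hc⟩ := exists_pos (hm .res (by simp))
    rcases hop with h | h
    · refine ⟨⟨false, a, b, c⟩, funext fun n => Set.ext fun p => ?_⟩
      cases p <;> simp [trace, pos, ha, hb, hc, h]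
    · refine ⟨⟨true, a, b, c⟩, funext fun n => Set.ext fun p => ?_⟩
      cases p <;> simp [trace, pos, ha, hb, hc, h]
  · rintro ⟨q, rfl⟩
    refine ⟨by cases h : q.mul <;> simp [h], fun p hp m n h h' => ?_⟩
    rw [mem_trace_of_mark hp] at h h'
    exact_mod_cast h.trans h'.symm

theorem mem_opTraces_iff {t : Trace ArithProp} :
    t ∈ opTraces ↔ ∃ (m : Bool) (a b : ℕ), t = trace ⟨m, a, b, value m a b⟩ := by
  constructor
  · rintro ⟨a, b, c, h1, h2, h3, ⟨h, rfl⟩ | ⟨h, rfl⟩⟩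
    · refine ⟨false, a, b, funext fun n => Set.ext fun p => ?_⟩
      cases p <;> simp [trace, pos, value, h1, h2, h3, h]
      norm_cast
    · refine ⟨true, a, b, funext fun n => Set.ext fun p => ?_⟩
      cases p <;> simp [trace, pos, value, h1, h2, h3, h]
      norm_cast
  · rintro ⟨m, a, b, rfl⟩
    cases m
    · refine ⟨a, b, a + b, ?_, ?_, ?_, Or.inl (by simp)⟩ <;> intro n <;>
        simp [trace, pos, value]
      norm_cast
    · refine ⟨a, b, a * b, ?_, ?_, ?_, Or.inr (by simp)⟩ <;> intro n <;>
        simp [trace, pos, value]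
      norm_cast

/-- `a` and `k` agree below `N`. -/
def Agree (N : ℕ) (a : ℕ∞) (k : ℕ) : Prop := ∀ n < N, (n : ℕ∞) = a ↔ n = k

theorem agree_top {N k : ℕ} : Agree N ⊤ k ↔ N ≤ k := by
  constructor
  · intro h
    by_contra hk
    simpa using h k (by omega)
  · intro h n hn
    simpa using by omega

theorem agree_coe {N i k : ℕ} : Agree N i k ↔ i = k ∨ (N ≤ i ∧ N ≤ k) := by
  constructor
  · intro h
    by_contra! hk
    rcases lt_or_ge i N with hi | hi
    · exact hk.1 (by simpa using h i hi)
    · exact hk.1 (by simpa [eq_comm] using h k (hk.2 hi))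
  · rintro (rfl | h) n hn
    · norm_cast
    · constructor
      · intro h'
        have : n = i := by exact_mod_cast h'
        omega
      · omega

theorem agree_zero {N : ℕ} : Agree N 0 0 := fun n _ => by simp

def natValue (m : Bool) (a b : ℕ) : ℕ := if m then a * b else a + b

theorem coe_natValue (m : Bool) (a b : ℕ) : (natValue m a b : ℕ∞) = value m a b := by
  cases m <;> simp [natValue, value]

theorem value_coe (m : Bool) (a b : ℕ) : value m a b = (natValue m a b : ℕ) :=
  (coe_natValue m a b).symm

/-- The convention `0 * ⊤ = 0` is what the closure requires: a factor mark at position `0` keeps the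
result at `0`, however far away the other mark is. -/
theorem value_true_top_coe (b : ℕ) : value true ⊤ b = if b = 0 then 0 else ⊤ := by
  split_ifs with h
  · simp [value, h]
  · simp [value, ENat.top_mul, h]

theorem value_true_coe_top (b : ℕ) : value true b ⊤ = if b = 0 then 0 else ⊤ := by
  split_ifs with h
  · simp [value, h]
  · simp [value, ENat.mul_top, h]

theorem value_false_top_left (b : ℕ∞) : value false ⊤ b = ⊤ := by simp [value]

theorem value_false_top_right (b : ℕ∞) : value false b ⊤ = ⊤ := by simp [value]

theorem value_true_top_top : value true ⊤ ⊤ = ⊤ := by simp [value]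

/-- Extended natural numbers are determined by their agreement with natural numbers. -/
theorem eq_of_agree {a b : ℕ∞} (h : ∀ N, ∃ i, Agree N a i ∧ Agree N b i) : a = b := by
  -- Below `n`, an extended number and a natural number in agreement are either equal or both at
  -- least `n`, so they lie on the same side of `n`.
  refine ENat.eq_of_forall_natCast_le_iff fun n => ?_
  obtain ⟨i, h1, h2⟩ := h n
  have key : ∀ a : ℕ∞, Agree n a i → ((n : ℕ∞) ≤ a ↔ n ≤ i) := by
    intro a h
    cases a using ENat.recTopCoe with
    | top => simpa using agree_top.1 h
    | coe a =>
      rcases agree_coe.1 h with rfl | h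
      · norm_cast
      · simp [h]
  rw [key a h1, key b h2]

theorem Agree.mono {N M : ℕ} {a : ℕ∞} {i : ℕ} (h : Agree M a i) (hN : N ≤ M) : Agree N a i :=
  fun n hn => h n (hn.trans_le hN)

/-- The operations respect agreement, in the following sense. -/
theorem natValue_agree (m : Bool) (a b : ℕ∞) (N : ℕ) : ∃ M, ∀ i j : ℕ, Agree M a i → Agree M b j →
    Agree N (value m a b) (natValue m i j) := by
  -- A window that includes position `a` identifies `a` exactly.
  have coe : ∀ {a i : ℕ}, Agree (a + 1) a i → a = i := fun h => by
    rcases agree_coe.1 h with h | h <;> omega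
  cases a using ENat.recTopCoe with
  | top =>
    cases b using ENat.recTopCoe with
    | top =>
      refine ⟨N, fun i j hi hj => ?_⟩
      rw [agree_top] at hi hj
      cases m <;> simp only [value_false_top_left, value_true_top_top, agree_top, natValue]
      · simp; omega
      · exact (Nat.le_mul_self N).trans (Nat.mul_le_mul hi hj)
    | coe b =>
      -- The part `b + 1` forces `j = b`; the part `N` sends `i` beyond the window, and with it the
      -- result, unless a zero factor makes the product vanish.
      refine ⟨N + b + 1, fun i j hi hj => ?_⟩
      rw [agree_top] at hi
      obtain rfl := coe (hj.mono (by omega))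
      cases m
      · simp [value_false_top_left, agree_top, natValue]; omega
      · rw [value_true_top_coe]
        split_ifs with h
        · simp [natValue, h, agree_zero]
        · simpa [agree_top, natValue] using by nlinarith [show 1 ≤ b by omega]
  | coe a =>
    cases b using ENat.recTopCoe with
    | top =>
      refine ⟨N + a + 1, fun i j hi hj => ?_⟩
      rw [agree_top] at hj
      obtain rfl := coe (hi.mono (by omega))
      cases m
      · simp [value_false_top_right, agree_top, natValue]; omega
      · rw [value_true_coe_top]
        split_ifs with h
        · simp [natValue, h, agree_zero]
        · simpa [agree_top, natValue] using by nlinarith [show 1 ≤ a by omega]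
    | coe b =>
      refine ⟨a + b + 1, fun i j hi hj => ?_⟩
      obtain rfl := coe (hi.mono (by omega))
      obtain rfl := coe (hj.mono (by omega))
      rw [value_coe]
      exact agree_coe.2 (Or.inl rfl)

/-- A continuous operation has a closed graph: limits of correct triples of natural numbers are
correct in `ℕ∞`. -/
theorem valid_of_agree {m : Bool} {a b c : ℕ∞}
    (h : ∀ N, ∃ i j : ℕ, Agree N a i ∧ Agree N b j ∧ Agree N c (natValue m i j)) :
    c = value m a b := by
  refine eq_of_agree fun N => ?_
  obtain ⟨M, hM⟩ := natValue_agree m a b N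
  obtain ⟨i, j, h1, h2, h3⟩ := h (max N M)
  exact ⟨_, h3.mono (le_max_left ..), hM i j (h1.mono (le_max_right ..)) (h2.mono (le_max_right ..))⟩

theorem exists_agree_coe (a : ℕ∞) (N : ℕ) : ∃ i, Agree N a i := by
  cases a using ENat.recTopCoe with
  | top => exact ⟨N, agree_top.2 le_rfl⟩
  | coe a => exact ⟨a, agree_coe.2 (Or.inl rfl)⟩

/-- The converse approximation: natural numbers are dense in `ℕ∞`, and by continuity the result is
approximated along with the arguments. -/
theorem exists_agree (m : Bool) (a b : ℕ∞) (N : ℕ) :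
    ∃ i j : ℕ, Agree N a i ∧ Agree N b j ∧ Agree N (value m a b) (natValue m i j) := by
  obtain ⟨M, hM⟩ := natValue_agree m a b N
  obtain ⟨i, hi⟩ := exists_agree_coe a (max N M)
  obtain ⟨j, hj⟩ := exists_agree_coe b (max N M)
  exact ⟨i, j, hi.mono (le_max_left ..), hj.mono (le_max_left ..),
    hM i j (hi.mono (le_max_right ..)) (hj.mono (le_max_right ..))⟩

theorem trace_eq_below {N : ℕ} {m : Bool} {a b c : ℕ∞} {i j k : ℕ} :
    (∀ n < N, trace ⟨m, a, b, c⟩ n = trace ⟨m, i, j, k⟩ n) ↔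
      Agree N a i ∧ Agree N b j ∧ Agree N c k := by
  have h : ∀ n, trace ⟨m, a, b, c⟩ n = trace ⟨m, i, j, k⟩ n ↔
      ((n : ℕ∞) = a ↔ n = i) ∧ ((n : ℕ∞) = b ↔ n = j) ∧ ((n : ℕ∞) = c ↔ n = k) := by
    intro n
    constructor
    · intro h
      have h1 := Set.ext_iff.1 h .arg₁
      have h2 := Set.ext_iff.1 h .arg₂
      have h3 := Set.ext_iff.1 h .res
      simpa [trace, pos] using And.intro h1 (And.intro h2 h3)
    · rintro ⟨h1, h2, h3⟩
      ext p
      cases p <;> simp [trace, pos, h1, h2, h3]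
  simp only [h, Agree]
  grind

/-- A limit of operation traces has the right shape because a violation would involve only two
positions and thus show in a finite prefix; its result is right because the graphs of the extended
operations are closed. Density of finite arguments gives the converse. -/
theorem mem_closure_opTraces_iff {t : Trace ArithProp} :
    t ∈ Trace.closure opTraces ↔ ∃ q : OpCode, q.Valid ∧ t = q.trace := by
  rw [Trace.mem_closure_iff]
  constructor
  · intro h
    have hs : Shaped t := by
      have hs' : ∀ N, ∃ t', Shaped t' ∧ ∀ n < N, t n = t' n := fun N => by
        obtain ⟨t', ht', hN⟩ := h N
        obtain ⟨m, a, b, rfl⟩ := mem_opTraces_iff.1 ht'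
        exact ⟨_, shaped_iff.2 ⟨_, rfl⟩, hN⟩
      refine ⟨?_, fun p hp m n hm hn => ?_⟩
      · by_contra hc
        push Not at hc
        obtain ⟨⟨m, hm⟩, n, hn⟩ := hc
        -- This prefix contains both offending positions.
        obtain ⟨t', ⟨h', -⟩, hN⟩ := hs' (m + n + 1)
        have e1 := hN m (by omega)
        have e2 := hN n (by omega)
        rw [e1] at hm
        rw [e2] at hn
        grind
      · obtain ⟨t', ⟨-, h'⟩, hN⟩ := hs' (m + n + 1)
        rw [hN m (by omega)] at hm
        rw [hN n (by omega)] at hn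
        exact h' p hp m n hm hn
    obtain ⟨⟨m, a, b, c⟩, rfl⟩ := shaped_iff.1 hs
    refine ⟨_, valid_of_agree fun N => ?_, rfl⟩
    -- The extra position makes the prefix non-empty, so that the operation can be read off at
    -- position `0`.
    obtain ⟨t', ht', hN⟩ := h (N + 1)
    obtain ⟨m', i, j, rfl⟩ := mem_opTraces_iff.1 ht'
    have hm : m = m' := by
      have := Set.ext_iff.1 (hN 0 (by omega)) .mult
      simp only [mult_mem_trace] at this
      exact Bool.eq_iff_iff.2 this
    subst hm
    rw [← coe_natValue] at hN
    exact ⟨i, j, trace_eq_below.1 fun n hn => hN n (by omega)⟩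
  · rintro ⟨⟨m, a, b, c⟩, hq, rfl⟩ N
    obtain rfl : c = value m a b := hq
    obtain ⟨i, j, h⟩ := exists_agree m a b N
    exact ⟨_, mem_opTraces_iff.2 ⟨m, i, j, rfl⟩, by rw [← coe_natValue]; exact trace_eq_below.2 h⟩

end OpCode

/-! ### HyperLTL -/

namespace HyperLTLBody

variable {AP : Type}

def and (ψ₁ ψ₂ : HyperLTLBody AP) : HyperLTLBody AP := neg (or (neg ψ₁) (neg ψ₂))

def imp (ψ₁ ψ₂ : HyperLTLBody AP) : HyperLTLBody AP := or (neg ψ₁) ψ₂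

def iff (ψ₁ ψ₂ : HyperLTLBody AP) : HyperLTLBody AP := and (imp ψ₁ ψ₂) (imp ψ₂ ψ₁)

def globally (ψ : HyperLTLBody AP) : HyperLTLBody AP := neg (.until (or ψ (neg ψ)) (neg ψ))

variable {Γ : TraceAssignment AP} {ψ ψ₁ ψ₂ : HyperLTLBody AP}

@[simp] theorem holds_neg : (neg ψ).Holds Γ ↔ ¬ ψ.Holds Γ := Iff.rfl

@[simp] theorem holds_or : (or ψ₁ ψ₂).Holds Γ ↔ ψ₁.Holds Γ ∨ ψ₂.Holds Γ := Iff.rfl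

@[simp] theorem holds_next : (next ψ).Holds Γ ↔ ψ.Holds (Γ.drop 1) := Iff.rfl

@[simp] theorem holds_and : (and ψ₁ ψ₂).Holds Γ ↔ ψ₁.Holds Γ ∧ ψ₂.Holds Γ := by
  simp [and]

@[simp] theorem holds_imp : (imp ψ₁ ψ₂).Holds Γ ↔ (ψ₁.Holds Γ → ψ₂.Holds Γ) := by
  simp [imp, imp_iff_not_or]

@[simp] theorem holds_iff : (iff ψ₁ ψ₂).Holds Γ ↔ (ψ₁.Holds Γ ↔ ψ₂.Holds Γ) := by
  simp [iff, iff_def]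

@[simp] theorem holds_globally : (globally ψ).Holds Γ ↔ ∀ j, ψ.Holds (Γ.drop j) := by
  simp [globally, Holds, Classical.em]

@[simp] theorem freeVars_and : (and ψ₁ ψ₂).freeVars = ψ₁.freeVars ∪ ψ₂.freeVars := rfl

@[simp] theorem freeVars_imp : (imp ψ₁ ψ₂).freeVars = ψ₁.freeVars ∪ ψ₂.freeVars := rfl

@[simp] theorem freeVars_iff : (iff ψ₁ ψ₂).freeVars = ψ₁.freeVars ∪ ψ₂.freeVars := by
  simp [iff, Set.union_comm]

@[simp] theorem freeVars_globally : (globally ψ).freeVars = ψ.freeVars := by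
  simp [globally, freeVars]

theorem holds_atom {v : PathVar} {t : Trace AP} (h : Γ v = some t) {p : AP} :
    (atom p v).Holds Γ ↔ p ∈ t 0 := by
  simp [Holds, h]

end HyperLTLBody

theorem TraceAssignment.drop_eq {AP : Type} {Γ : TraceAssignment AP} {v : PathVar} {t : Trace AP}
    (h : Γ v = some t) (j : ℕ) : Γ.drop j v = some (t.drop j) := by
  simp [TraceAssignment.drop, h]

/-! ### A HyperLTL sentence with a unique model -/

namespace OpFormula

open HyperLTLBody

/-- The marks `p` of `v` and `p'` of `w` occur at the same position. -/
def same (p : ArithProp) (v : PathVar) (p' : ArithProp) (w : PathVar) : HyperLTLBody ArithProp :=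
  globally (iff (atom p v) (atom p' w))

/-- The mark `p'` of `w` occurs one position after the mark `p` of `v`. -/
def succ (p : ArithProp) (v : PathVar) (p' : ArithProp) (w : PathVar) : HyperLTLBody ArithProp :=
  -- The first conjunct deals with position `0` of `w`, which the shifted comparison never inspects.
  and (neg (atom p' w)) (globally (iff (atom p v) (next (atom p' w))))

/-- The mark `p` does not occur in `v`. -/
def never (p : ArithProp) (v : PathVar) : HyperLTLBody ArithProp := globally (neg (atom p v))

/-- The mark `p` occurs at most once in `v`. -/
def atMostOnce (p : ArithProp) (v : PathVar) : HyperLTLBody ArithProp :=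
  globally (imp (atom p v) (next (never p v)))

/-- The trace `v` looks like an operation trace, up to missing marks and a wrong result. -/
def shaped (v : PathVar) : HyperLTLBody ArithProp :=
  and (or (globally (and (atom .add v) (neg (atom .mult v))))
      (globally (and (atom .mult v) (neg (atom .add v)))))
    (and (atMostOnce .arg₁ v) (and (atMostOnce .arg₂ v) (atMostOnce .res v)))

/-- The operations of `2` and `3` are single-valued. -/
def functional : HyperLTLBody ArithProp :=
  imp (and (iff (atom .mult 2) (atom .mult 3))
    (and (same .arg₁ 2 .arg₁ 3) (same .arg₂ 2 .arg₂ 3))) (same .res 2 .res 3)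

/-- `0` is `0 + 0 = 0` and `1` is `⊤ + 0 = ⊤`. -/
def base : HyperLTLBody ArithProp :=
  and (and (and (atom .add 0) (atom .arg₁ 0)) (and (atom .arg₂ 0) (atom .res 0)))
    (and (and (atom .add 1) (never .arg₁ 1)) (and (atom .arg₂ 1) (never .res 1)))

/-- Closure of the sums under successors of the arguments and under passing to `⊤`. -/
def sums : HyperLTLBody ArithProp :=
  imp (atom .add 2) (and
    (and (and (atom .add 4) (succ .arg₁ 2 .arg₁ 4)) (and (same .arg₂ 2 .arg₂ 4)
      (succ .res 2 .res 4))) (and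
    (and (and (atom .add 5) (same .arg₁ 2 .arg₁ 5)) (and (succ .arg₂ 2 .arg₂ 5)
      (succ .res 2 .res 5)))
    (and (and (atom .add 6) (same .arg₁ 2 .arg₁ 6)) (and (never .arg₂ 6) (never .res 6)))))

/-- Products with `0` and with `⊤`. -/
def extremeProducts : HyperLTLBody ArithProp :=
  imp (atom .add 2) (and
    (and (and (atom .mult 7) (same .arg₁ 2 .arg₁ 7)) (and (atom .arg₂ 7) (atom .res 7)))
    (and (and (atom .mult 9) (same .arg₁ 2 .arg₁ 9)) (and (never .arg₂ 9)
      (and (imp (atom .arg₁ 2) (atom .res 9)) (imp (neg (atom .arg₁ 2)) (never .res 9))))))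

/-- The recursion for products. -/
def products : HyperLTLBody ArithProp :=
  imp (and (and (atom .mult 2) (atom .add 3)) (and (same .res 2 .arg₁ 3) (same .arg₁ 2 .arg₂ 3)))
    (and (and (atom .mult 8) (same .arg₁ 2 .arg₁ 8)) (and (succ .arg₂ 2 .arg₂ 8)
      (same .res 3 .res 8)))

def matrix : HyperLTLBody ArithProp :=
  and (shaped 2) (and functional (and base (and sums (and extremeProducts products))))

/-- Variables `0` and `1` are the base traces, `2` and `3` range over the model, and `4` to `9` are
the traces that must accompany them: `4`, `5`, `6` for sums, `7` and `9` for products with `0` and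
`⊤`, and `8` for the recursion step of products. -/
def sentence : HyperLTL ArithProp :=
  .ex 0 <| .ex 1 <| .all 2 <| .all 3 <| .ex 4 <| .ex 5 <| .ex 6 <| .ex 7 <| .ex 8 <| .ex 9 <|
    .body matrix

theorem isSentence_sentence : sentence.IsSentence := by
  ext v
  simp [sentence, HyperLTL.freeVars, matrix, shaped, functional, base, sums, extremeProducts,
    products, atMostOnce, never, succ, same, HyperLTLBody.freeVars]
  grind

variable {Γ : TraceAssignment ArithProp} {v w : PathVar} {q r : OpCode} {p p' : ArithProp}

theorem natCast_eq_iff {a b : ℕ∞} : (∀ n : ℕ, (n : ℕ∞) = a ↔ (n : ℕ∞) = b) ↔ a = b := by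
  refine ⟨fun h => ?_, fun h => by simp [h]⟩
  cases a using ENat.recTopCoe with
  | top =>
    cases b using ENat.recTopCoe with
    | top => rfl
    | coe b => simpa using h b
  | coe a => simpa using h a

/-- With `⊤ + 1 = ⊤`, the shift also says the right thing about absent marks: one mark is missing
exactly if the other is. -/
theorem natCast_succ_iff {a b : ℕ∞} :
    (b ≠ 0 ∧ ∀ n : ℕ, (n : ℕ∞) = a ↔ ((n + 1 : ℕ) : ℕ∞) = b) ↔ b = a + 1 := by
  constructor
  · rintro ⟨h0, h⟩
    cases a using ENat.recTopCoe with
    | top =>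
      cases b using ENat.recTopCoe with
      | top => rfl
      | coe b =>
        obtain ⟨b, rfl⟩ := Nat.exists_eq_succ_of_ne_zero (show b ≠ 0 by simpa using h0)
        simpa using h b
    | coe a => exact (((h a).1 rfl).symm).trans (by simp)
  · rintro rfl
    refine ⟨by simp, fun n => ?_⟩
    cases a using ENat.recTopCoe with
    | top => simp
    | coe a => norm_cast; omega

theorem holds_atom_trace (h : Γ v = some q.trace) (j : ℕ) (hp : p ≠ .add ∧ p ≠ .mult) :
    (atom p v).Holds (Γ.drop j) ↔ (j : ℕ∞) = q.pos p := by
  rw [holds_atom (TraceAssignment.drop_eq h j), ← OpCode.mem_trace_of_mark hp]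
  rfl

theorem holds_mark (h : Γ v = some q.trace) (hp : p ≠ .add ∧ p ≠ .mult) :
    (atom p v).Holds Γ ↔ q.pos p = 0 := by
  rw [holds_atom h, OpCode.mem_trace_of_mark hp, eq_comm]
  rfl

theorem holds_add (h : Γ v = some q.trace) : (atom .add v).Holds Γ ↔ q.mul = false := by
  rw [holds_atom h, OpCode.add_mem_trace]

theorem holds_mult (h : Γ v = some q.trace) : (atom .mult v).Holds Γ ↔ q.mul = true := by
  rw [holds_atom h, OpCode.mult_mem_trace]

theorem holds_same (hv : Γ v = some q.trace) (hw : Γ w = some r.trace)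
    (hp : p ≠ .add ∧ p ≠ .mult) (hp' : p' ≠ .add ∧ p' ≠ .mult) :
    (same p v p' w).Holds Γ ↔ q.pos p = r.pos p' := by
  simp only [same, holds_globally, holds_iff, holds_atom_trace hv _ hp, holds_atom_trace hw _ hp']
  exact natCast_eq_iff

theorem holds_succ (hv : Γ v = some q.trace) (hw : Γ w = some r.trace)
    (hp : p ≠ .add ∧ p ≠ .mult) (hp' : p' ≠ .add ∧ p' ≠ .mult) :
    (succ p v p' w).Holds Γ ↔ r.pos p' = q.pos p + 1 := by
  have h1 : ∀ j, (atom p' w).Holds ((Γ.drop j).drop 1) ↔ ((j + 1 : ℕ) : ℕ∞) = r.pos p' := by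
    intro j
    rw [holds_atom (TraceAssignment.drop_eq (TraceAssignment.drop_eq hw j) 1),
      ← OpCode.mem_trace_of_mark hp']
    rfl
  simp only [succ, holds_and, holds_neg, holds_mark hw hp', holds_globally, holds_iff, holds_next,
    holds_atom_trace hv _ hp, h1]
  exact natCast_succ_iff

theorem holds_never (h : Γ v = some q.trace) (hp : p ≠ .add ∧ p ≠ .mult) :
    (never p v).Holds Γ ↔ q.pos p = ⊤ := by
  simp only [never, holds_globally, holds_neg, holds_atom_trace h _ hp]
  refine ⟨fun h => ?_, fun h => by simp [h]⟩
  cases hq : q.pos p using ENat.recTopCoe with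
  | top => rfl
  | coe a => exact absurd hq.symm (h a)

theorem holds_atMostOnce {t : Trace ArithProp} (h : Γ v = some t) :
    (atMostOnce p v).Holds Γ ↔ ∀ m n, p ∈ t m → p ∈ t n → m = n := by
  have h1 : ∀ j, (atom p v).Holds (Γ.drop j) ↔ p ∈ t j := fun j =>
    holds_atom (TraceAssignment.drop_eq h j)
  have h2 : ∀ i j, (atom p v).Holds (((Γ.drop i).drop 1).drop j) ↔ p ∈ t (i + (1 + j)) :=
    fun i j => holds_atom (TraceAssignment.drop_eq
      (TraceAssignment.drop_eq (TraceAssignment.drop_eq h i) 1) j)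
  simp only [atMostOnce, never, holds_globally, holds_imp, holds_next, holds_neg, h1, h2]
  constructor
  · intro H m n hm hn
    rcases lt_trichotomy m n with h | h | h
    · exact absurd (by convert hn using 2; omega) (H m hm (n - m - 1))
    · exact h
    · exact absurd (by convert hm using 2; omega) (H n hn (m - n - 1))
  · intro H m hm j hj
    have := H m _ hm hj
    omega

theorem holds_shaped {t : Trace ArithProp} (h : Γ v = some t) :
    (shaped v).Holds Γ ↔ ∃ q : OpCode, t = q.trace := by
  rw [← OpCode.shaped_iff]
  have h1 : ∀ p j, (atom p v).Holds (Γ.drop j) ↔ p ∈ t j := fun p j =>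
    holds_atom (TraceAssignment.drop_eq h j)
  simp only [shaped, holds_and, holds_or, holds_globally, holds_neg, h1, holds_atMostOnce h,
    OpCode.Shaped]
  refine and_congr_right fun _ => ⟨?_, fun H => ⟨H _ (by simp), H _ (by simp), H _ (by simp)⟩⟩
  rintro ⟨h1, h2, h3⟩ p hp
  cases p
  exacts [h1, h2, h3, absurd rfl hp.1, absurd rfl hp.2]

end OpFormula

/-! ### Semantics of the sentence and uniqueness of its model -/

namespace OpFormula

open HyperLTLBody

/-- The meaning of the matrix, apart from shapes. -/
def Rules (q : ℕ → OpCode) : Prop :=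
  ((q 2).mul = (q 3).mul → (q 2).fst = (q 3).fst → (q 2).snd = (q 3).snd →
    (q 2).out = (q 3).out) ∧
  (q 0 = ⟨false, 0, 0, 0⟩ ∧ q 1 = ⟨false, ⊤, 0, ⊤⟩) ∧
  ((q 2).mul = false →
    q 4 = ⟨false, (q 2).fst + 1, (q 2).snd, (q 2).out + 1⟩ ∧
    q 5 = ⟨false, (q 2).fst, (q 2).snd + 1, (q 2).out + 1⟩ ∧
    q 6 = ⟨false, (q 2).fst, ⊤, ⊤⟩) ∧
  ((q 2).mul = false →
    q 7 = ⟨true, (q 2).fst, 0, 0⟩ ∧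
    q 9 = ⟨true, (q 2).fst, ⊤, if (q 2).fst = 0 then 0 else ⊤⟩) ∧
  ((q 2).mul = true → (q 3).mul = false → (q 3).fst = (q 2).out → (q 3).snd = (q 2).fst →
    q 8 = ⟨true, (q 2).fst, (q 2).snd + 1, (q 3).out⟩)

theorem eq_mk_iff {q : OpCode} {m : Bool} {a b c : ℕ∞} :
    q = ⟨m, a, b, c⟩ ↔ q.mul = m ∧ q.fst = a ∧ q.snd = b ∧ q.out = c := by
  cases q
  simp

theorem holds_matrix {Γ : TraceAssignment ArithProp} {q : ℕ → OpCode}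
    (h : ∀ v < 10, Γ v = some (q v).trace) : matrix.Holds Γ ↔ Rules q := by
  have hsame : ∀ p v p' w, v < 10 → w < 10 → (p ≠ .add ∧ p ≠ .mult) →
      (p' ≠ .add ∧ p' ≠ .mult) → ((same p v p' w).Holds Γ ↔ (q v).pos p = (q w).pos p') :=
    fun p v p' w hv hw => holds_same (h v hv) (h w hw)
  have hsucc : ∀ p v p' w, v < 10 → w < 10 → (p ≠ .add ∧ p ≠ .mult) →
      (p' ≠ .add ∧ p' ≠ .mult) → ((succ p v p' w).Holds Γ ↔ (q w).pos p' = (q v).pos p + 1) :=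
    fun p v p' w hv hw => holds_succ (h v hv) (h w hw)
  have hnever : ∀ p v, v < 10 → (p ≠ .add ∧ p ≠ .mult) →
      ((never p v).Holds Γ ↔ (q v).pos p = ⊤) := fun p v hv => holds_never (h v hv)
  have hmark : ∀ p v, v < 10 → (p ≠ .add ∧ p ≠ .mult) →
      ((atom p v).Holds Γ ↔ (q v).pos p = 0) := fun p v hv => holds_mark (h v hv)
  have hadd : ∀ v < 10, (atom .add v).Holds Γ ↔ (q v).mul = false := fun v hv => holds_add (h v hv)
  have hmult : ∀ v < 10, (atom .mult v).Holds Γ ↔ (q v).mul = true :=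
    fun v hv => holds_mult (h v hv)
  have hshaped : (shaped 2).Holds Γ := (holds_shaped (h 2 (by norm_num))).2 ⟨_, rfl⟩
  simp only [matrix, holds_and, hshaped, true_and, functional, base, sums, extremeProducts,
    products, holds_imp, holds_iff, holds_neg]
  have e2 : (2 : ℕ) < 10 := by norm_num
  have e3 : (3 : ℕ) < 10 := by norm_num
  simp only [hadd, hmult, e2, e3, Nat.reduceLT]
  simp [hsame, hsucc, hnever, hmark, OpCode.pos]
  simp only [Rules, eq_mk_iff]
  refine and_congr Iff.rfl (and_congr ?_ (and_congr ?_ (and_congr ?_ ?_)))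
  · tauto
  · simp only [and_assoc, eq_comm (a := (q 2).fst), eq_comm (a := (q 2).snd)]
  · by_cases h0 : (q 2).fst = 0 <;> simp [h0, and_assoc, eq_comm (a := (q 2).fst),
      eq_comm (a := (0 : ℕ∞))]
  · grind

theorem isModel_iff_rules {T : Set (Trace ArithProp)} : sentence.IsModel T ↔
    ∃ t₀ ∈ T, ∃ t₁ ∈ T, ∀ t₂ ∈ T, ∀ t₃ ∈ T, ∃ t₄ ∈ T, ∃ t₅ ∈ T, ∃ t₆ ∈ T, ∃ t₇ ∈ T, ∃ t₈ ∈ T,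
      ∃ t₉ ∈ T, matrix.Holds ((((((((((TraceAssignment.set (fun _ => none) 0 t₀).set 1 t₁).set
        2 t₂).set 3 t₃).set 4 t₄).set 5 t₅).set 6 t₆).set 7 t₇).set 8 t₈).set 9 t₉) := Iff.rfl

/-- The family with the given first ten members. -/
def codes (q₀ q₁ q₂ q₃ q₄ q₅ q₆ q₇ q₈ q₉ : OpCode) : ℕ → OpCode
  | 0 => q₀ | 1 => q₁ | 2 => q₂ | 3 => q₃ | 4 => q₄ | 5 => q₅ | 6 => q₆ | 7 => q₇ | 8 => q₈
  | _ => q₉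

theorem holds_matrix_codes {q₀ q₁ q₂ q₃ q₄ q₅ q₆ q₇ q₈ q₉ : OpCode} :
    matrix.Holds ((((((((((TraceAssignment.set (fun _ => none) 0 q₀.trace).set 1 q₁.trace).set
        2 q₂.trace).set 3 q₃.trace).set 4 q₄.trace).set 5 q₅.trace).set 6 q₆.trace).set
        7 q₇.trace).set 8 q₈.trace).set 9 q₉.trace) ↔
      Rules (codes q₀ q₁ q₂ q₃ q₄ q₅ q₆ q₇ q₈ q₉) := by
  refine holds_matrix fun v hv => ?_
  interval_cases v <;> rfl

theorem isModel_closure : sentence.IsModel (Trace.closure opTraces) := by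
  have mem : ∀ q : OpCode, q.Valid → q.trace ∈ Trace.closure opTraces := fun q hq =>
    OpCode.mem_closure_opTraces_iff.2 ⟨q, hq, rfl⟩
  rw [isModel_iff_rules]
  refine ⟨_, mem ⟨false, 0, 0, 0⟩ (by simp [OpCode.Valid, OpCode.value]),
    _, mem ⟨false, ⊤, 0, ⊤⟩ (by simp [OpCode.Valid, OpCode.value]), ?_⟩
  intro t₂ h₂ t₃ h₃
  obtain ⟨⟨m, a, b, c⟩, hc, rfl⟩ := OpCode.mem_closure_opTraces_iff.1 h₂
  obtain ⟨⟨m', a', b', c'⟩, hc', rfl⟩ := OpCode.mem_closure_opTraces_iff.1 h₃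
  -- All witnesses depend on `a` and `b` only. The rules for sums are vacuous if `t₂` is a product,
  -- and the premise of the product rule forces `t₃` to be the sum of `a * b` and `a`, so that the
  -- eighth trace fits.
  refine ⟨_, mem ⟨false, a + 1, b, a + b + 1⟩ ?_, _, mem ⟨false, a, b + 1, a + b + 1⟩ ?_,
    _, mem ⟨false, a, ⊤, ⊤⟩ ?_, _, mem ⟨true, a, 0, 0⟩ ?_, _, mem ⟨true, a, b + 1, a * b + a⟩ ?_,
    _, mem ⟨true, a, ⊤, if a = 0 then 0 else ⊤⟩ ?_, holds_matrix_codes.2 ?_⟩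
  · simp [OpCode.Valid, OpCode.value, add_right_comm]
  · simp [OpCode.Valid, OpCode.value, add_assoc]
  · simp [OpCode.Valid, OpCode.value]
  · simp [OpCode.Valid, OpCode.value]
  · simp [OpCode.Valid, OpCode.value, mul_add]
  · split_ifs with h <;> simp [OpCode.Valid, OpCode.value, h]
  · simp only [OpCode.Valid, OpCode.value] at hc hc'
    subst hc hc'
    simp only [Rules, codes, true_and, and_true, OpCode.mk.injEq]
    refine ⟨by rintro rfl rfl rfl; rfl, ?_, ?_, ?_⟩
    · rintro rfl
      simp
    · simp
    · rintro rfl rfl rfl rfl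
      simp

/-- The recursion rules generate all correct traces inside `T`. A possibly incorrect trace of `T` is
then compared with the correct one that has the same operation and arguments, and single-valuedness
identifies their results. -/
theorem isModel_iff {T : Set (Trace ArithProp)} :
    sentence.IsModel T ↔ T = Trace.closure opTraces := by
  refine ⟨fun h => ?_, fun h => h ▸ isModel_closure⟩
  rw [isModel_iff_rules] at h
  obtain ⟨t₀, h₀, t₁, h₁, h⟩ := h
  -- Each trace of `T` may be taken for variable `2`, which the matrix requires to be well-shaped.
  have code : ∀ t ∈ T, ∃ q : OpCode, t = q.trace := by
    intro t ht
    obtain ⟨t₄, -, t₅, -, t₆, -, t₇, -, t₈, -, t₉, -, H⟩ := h t ht t ht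
    exact (holds_shaped (Γ := _) (v := 2) rfl).1 (holds_and.1 H).1
  obtain ⟨q₀, rfl⟩ := code _ h₀
  obtain ⟨q₁, rfl⟩ := code _ h₁
  replace h : ∀ q₂ q₃ : OpCode, q₂.trace ∈ T → q₃.trace ∈ T → ∃ q₄ q₅ q₆ q₇ q₈ q₉ : OpCode,
      (q₄.trace ∈ T ∧ q₅.trace ∈ T ∧ q₆.trace ∈ T ∧ q₇.trace ∈ T ∧ q₈.trace ∈ T ∧ q₉.trace ∈ T) ∧
      Rules (codes q₀ q₁ q₂ q₃ q₄ q₅ q₆ q₇ q₈ q₉) := by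
    intro q₂ q₃ h₂ h₃
    obtain ⟨t₄, h₄, t₅, h₅, t₆, h₆, t₇, h₇, t₈, h₈, t₉, h₉, H⟩ := h _ h₂ _ h₃
    obtain ⟨q₄, rfl⟩ := code _ h₄
    obtain ⟨q₅, rfl⟩ := code _ h₅
    obtain ⟨q₆, rfl⟩ := code _ h₆
    obtain ⟨q₇, rfl⟩ := code _ h₇
    obtain ⟨q₈, rfl⟩ := code _ h₈
    obtain ⟨q₉, rfl⟩ := code _ h₉
    exact ⟨q₄, q₅, q₆, q₇, q₈, q₉, ⟨h₄, h₅, h₆, h₇, h₈, h₉⟩, holds_matrix_codes.1 H⟩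
  simp only [Rules, codes] at h
  obtain ⟨rfl, rfl⟩ : q₀ = ⟨false, 0, 0, 0⟩ ∧ q₁ = ⟨false, ⊤, 0, ⊤⟩ := by
    obtain ⟨_, _, _, _, _, _, -, -, H, -⟩ := h _ _ h₀ h₀
    exact H
  have hadd : ∀ a b c, OpCode.trace ⟨false, a, b, c⟩ ∈ T →
      OpCode.trace ⟨false, a + 1, b, c + 1⟩ ∈ T ∧ OpCode.trace ⟨false, a, b + 1, c + 1⟩ ∈ T ∧
      OpCode.trace ⟨false, a, ⊤, ⊤⟩ ∈ T ∧ OpCode.trace ⟨true, a, 0, 0⟩ ∈ T ∧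
      OpCode.trace ⟨true, a, ⊤, if a = 0 then 0 else ⊤⟩ ∈ T := by
    intro a b c hT
    obtain ⟨q₄, q₅, q₆, q₇, q₈, q₉, ⟨h₄, h₅, h₆, h₇, -, h₉⟩, -, -, H1, H2, -⟩ := h _ _ hT hT
    obtain ⟨rfl, rfl, rfl⟩ := H1 rfl
    obtain ⟨rfl, rfl⟩ := H2 rfl
    exact ⟨h₄, h₅, h₆, h₇, h₉⟩
  -- Finite arguments are reached by induction, `⊤` is not: as a first argument it comes from the
  -- second base trace, as a second one from its own rule. Products have a separate rule for a
  -- second argument `⊤` likewise.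
  have hsum : ∀ a b, OpCode.trace ⟨false, a, b, a + b⟩ ∈ T := by
    have h0 : ∀ a, OpCode.trace ⟨false, a, 0, a⟩ ∈ T := by
      intro a
      cases a using ENat.recTopCoe with
      | top => exact h₁
      | coe a =>
        induction a with
        | zero => exact h₀
        | succ a ih => exact_mod_cast (hadd _ _ _ ih).1
    intro a b
    cases b using ENat.recTopCoe with
    | top => simpa using (hadd _ _ _ (h0 a)).2.2.1
    | coe b =>
      induction b with
      | zero => simpa using h0 a
      | succ b ih => simpa [add_assoc] using (hadd _ _ _ ih).2.1
  have hprod : ∀ a b, OpCode.trace ⟨true, a, b, a * b⟩ ∈ T := by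
    intro a b
    obtain ⟨-, -, -, hz, ht⟩ := hadd _ _ _ (hsum a 0)
    cases b using ENat.recTopCoe with
    | top =>
      convert ht using 2
      split_ifs with h <;> simp [h]
    | coe b =>
      induction b with
      | zero => simpa using hz
      | succ b ih =>
        -- The product rule is fed with the sum of `a * b` and `a`, already known to lie in `T`.
        obtain ⟨q₄, q₅, q₆, q₇, q₈, q₉, ⟨-, -, -, -, h₈, -⟩, -, -, -, -, H⟩ :=
          h _ _ ih (hsum (a * b) a)
        obtain rfl := H rfl rfl rfl rfl
        simpa [mul_add] using h₈
  have hvalid : ∀ q : OpCode, q.Valid → q.trace ∈ T := by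
    rintro ⟨m, a, b, c⟩ hq
    obtain rfl : c = OpCode.value m a b := hq
    cases m
    exacts [hsum a b, hprod a b]
  ext t
  rw [OpCode.mem_closure_opTraces_iff]
  constructor
  · intro ht
    obtain ⟨q, rfl⟩ := code t ht
    refine ⟨q, ?_, rfl⟩
    obtain ⟨_, _, _, _, _, _, -, H, -⟩ :=
      h q ⟨q.mul, q.fst, q.snd, OpCode.value q.mul q.fst q.snd⟩ ht (hvalid _ rfl)
    exact H rfl rfl rfl
  · rintro ⟨q, hq, rfl⟩
    exact hvalid q hq

end OpFormula

/-! ### The prefix tree -/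

namespace Trace

variable {AP : Type} {T : Set (Trace AP)}

/-- A successor is determined by the appended letter. The bound does not depend on the vertex, so it
also yields the bounded branching of `arithSystem`. -/
theorem prefixTree_succ_encard_le [Finite AP] (hT : T.Nonempty) (w : prefsOf T) :
    {w' | (prefixTree T hT).edge w w'}.encard ≤ ENat.card (Set AP) := by
  refine (Set.encard_le_encard (t := ⋃ a : Set AP, {w' : prefsOf T | w'.1 = w.1 ++ [a]})
    fun w' hw' => Set.mem_iUnion.2 hw').trans ?_
  have hsub : (⋃ a : Set AP, {w' : prefsOf T | w'.1 = w.1 ++ [a]}) =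
      {w' : prefsOf T | w'.1 ∈ Set.range fun a : Set AP => w.1 ++ [a]} := by
    ext w'
    simp [eq_comm]
  rw [hsub, ← Subtype.val_injective.encard_image]
  refine (Set.encard_le_encard (t := Set.range fun a : Set AP => w.1 ++ [a]) ?_).trans ?_
  · rintro _ ⟨w', h, rfl⟩
    exact h
  · rw [← Set.image_univ, ← Set.encard_univ]
    exact Set.encard_image_le _ _

theorem prefixTree_finitelyBranching [Finite AP] (hT : T.Nonempty) :
    (prefixTree T hT).FinitelyBranching := fun w =>
  Set.encard_lt_top_iff.1 <| (prefixTree_succ_encard_le hT w).trans_lt <| by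
    rw [ENat.card_eq_coe_natCard]
    exact ENat.natCast_lt_top _

theorem take_succ (t : Trace AP) (n : ℕ) : t.take (n + 1) = t.take n ++ [t n] := by
  simp [take, List.range_succ]

theorem closure_closure (T : Set (Trace AP)) : closure (closure T) = closure T := by
  refine Set.Subset.antisymm (fun t ht w hw => ?_) (subset_closure _)
  obtain ⟨t', ht', h⟩ := Set.mem_iUnion₂.1 (ht hw)
  exact ht' h

/-- The `n`-th vertex of a path that starts below the root is the prefix of length `n + 1` of its
trace; the shift skips the root and its empty label. Since a path only guarantees that each prefix
is a prefix of some trace of `T`, the closure of `T` appears. -/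
theorem prefixTree_tracesFromSuccessors (hT : T.Nonempty) :
    (prefixTree T hT).tracesFromSuccessors = closure T := by
  ext t
  constructor
  · rintro ⟨ρ, ⟨a, h0⟩, rfl⟩ _ ⟨n, rfl⟩
    have hl : ∀ n, ρ.trace n = (ρ.at n).1.getLastD ∅ := fun _ => rfl
    have key : ∀ n, (ρ.at n).1 = take ρ.trace (n + 1) := by
      intro n
      induction n with
      | zero =>
        have h0 : (ρ.at 0).1 = [a] := h0
        rw [take_succ, hl, h0]
        rfl
      | succ n ih =>
        obtain ⟨b, hb⟩ := ρ.2 n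
        have hb' : (ρ.at (n + 1)).1 = (ρ.at n).1 ++ [b] := hb
        rw [take_succ, ← ih, hl, hb']
        simp
    cases n with
    | zero => exact nil_mem_prefsOf hT
    | succ n => exact key n ▸ (ρ.at n).2
  · intro ht
    refine ⟨⟨fun n => ⟨t.take (n + 1), ht ⟨_, rfl⟩⟩, fun n => ⟨t (n + 1), take_succ t (n + 1)⟩⟩,
      ⟨t 0, rfl⟩, funext fun n => ?_⟩
    simp [TransitionSystem.Path.trace, TransitionSystem.Path.at, prefixTree, take_succ]

end Trace

instance : Finite ArithProp :=
  Finite.of_injective (β := Fin 5)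
    (fun | .arg₁ => 0 | .arg₂ => 1 | .res => 2 | .add => 3 | .mult => 4)
    (by intro p q; cases p <;> cases q <;> simp)

instance (T : Set (Trace ArithProp)) : Countable (Trace.prefsOf T) := by
  have : Countable (Set ArithProp) := Finite.to_countable
  infer_instance

/-! ### Paths and path assignments -/

namespace TransitionSystem

variable {AP V : Type} {S : TransitionSystem AP V}

@[simp] theorem Path.at_drop (ρ : S.Path) (i j : ℕ) : (ρ.drop i).at j = ρ.at (i + j) := rfl

theorem Path.edge_at (ρ : S.Path) (n : ℕ) : S.edge (ρ.at n) (ρ.at (n + 1)) := ρ.2 n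

@[simp] theorem Path.drop_drop (ρ : S.Path) (i j : ℕ) : (ρ.drop i).drop j = ρ.drop (i + j) :=
  Subtype.ext <| funext fun n => congrArg ρ.1 (Nat.add_assoc i j n).symm

@[simp] theorem Path.drop_zero (ρ : S.Path) : ρ.drop 0 = ρ :=
  Subtype.ext <| funext fun n => congrArg ρ.1 (Nat.zero_add n)

/-- The path `v ρ(0) ρ(1) ⋯`. -/
def Path.cons (v : V) (ρ : S.Path) (h : S.edge v (ρ.at 0)) : S.Path :=
  ⟨fun n => Nat.casesOn n v ρ.at, fun n => by cases n with
    | zero => exact h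
    | succ n => exact ρ.edge_at n⟩

@[simp] theorem Path.cons_at_succ (v : V) (ρ : S.Path) (h : S.edge v (ρ.at 0)) (n : ℕ) :
    (Path.cons v ρ h).at (n + 1) = ρ.at n := rfl

/-- Paths can be built step by step, following choices that keep an invariant. -/
theorem exists_path_of_step {P : V → Prop} {Q : ℕ → V → Prop}
    (step : ∀ n v, P v → ∃ w, S.edge v w ∧ P w ∧ Q n w) {v : V} (hv : P v) :
    ∃ ρ : S.Path, ρ.at 0 = v ∧ (∀ n, P (ρ.at n)) ∧ ∀ n, Q n (ρ.at (n + 1)) := by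
  choose f hf hP hQ using step
  let g : ℕ → {v // P v} := fun n => Nat.rec ⟨v, hv⟩ (fun n u => ⟨f n u.1 u.2, hP n u.1 u.2⟩) n
  exact ⟨⟨fun n => (g n).1, fun n => hf n _ _⟩, rfl, fun n => (g n).2, fun n => hQ n _ _⟩

theorem exists_path (S : TransitionSystem AP V) (v : V) : ∃ ρ : S.Path, ρ.at 0 = v := by
  obtain ⟨ρ, h, -⟩ := S.exists_path_of_step (P := fun _ => True) (Q := fun _ _ => True)
    (fun _ v _ => by simpa using S.total v) (v := v) trivial
  exact ⟨ρ, h⟩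

theorem exists_path_edge {v w : V} (h : S.edge v w) :
    ∃ ρ : S.Path, ρ.at 0 = v ∧ ρ.at 1 = w := by
  obtain ⟨ρ, hρ⟩ := S.exists_path w
  exact ⟨.cons v ρ (hρ ▸ h), rfl, by simp [← hρ]⟩

end TransitionSystem

namespace PathAssignment

variable {AP V : Type} {S : TransitionSystem AP V} {Γ : PathAssignment S} {v w : PathVar}
  {ρ σ : S.Path}

theorem drop_map (h : Γ.map v = some ρ) (j : ℕ) : (Γ.drop j).map v = some (ρ.drop j) := by
  simp [drop, h]

@[simp] theorem set_map_self : (Γ.set v ρ).map v = some ρ := by simp [set]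

theorem set_map_of_ne (h : w ≠ v) : (Γ.set v ρ).map w = Γ.map w := by simp [set, h]

@[simp] theorem rcnt_set : (Γ.set v ρ).rcnt = ρ.at 0 := by simp [rcnt, set]

@[simp] theorem rcnt_empty : (empty S).rcnt = S.init := rfl

end PathAssignment

/-! ### HyperCTL* connectives -/

namespace HyperCTL

variable {AP : Type}

def and (φ₁ φ₂ : HyperCTL AP) : HyperCTL AP := neg (or (neg φ₁) (neg φ₂))

def imp (φ₁ φ₂ : HyperCTL AP) : HyperCTL AP := or (neg φ₁) φ₂

def eventually (φ : HyperCTL AP) : HyperCTL AP := .until (or φ (neg φ)) φ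

def globally (φ : HyperCTL AP) : HyperCTL AP := neg (eventually (neg φ))

variable {V : Type} {S : TransitionSystem AP V} {Γ : PathAssignment S} {φ φ₁ φ₂ : HyperCTL AP}
  {v : PathVar}

@[simp] theorem holds_neg : (neg φ).Holds S Γ ↔ ¬ φ.Holds S Γ := Iff.rfl

@[simp] theorem holds_or : (or φ₁ φ₂).Holds S Γ ↔ φ₁.Holds S Γ ∨ φ₂.Holds S Γ := Iff.rfl

@[simp] theorem holds_next : (next φ).Holds S Γ ↔ φ.Holds S (Γ.drop 1) := Iff.rfl

@[simp] theorem holds_until : (HyperCTL.until φ₁ φ₂).Holds S Γ ↔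
    ∃ j, φ₂.Holds S (Γ.drop j) ∧ ∀ i < j, φ₁.Holds S (Γ.drop i) := Iff.rfl

@[simp] theorem holds_ex : (ex v φ).Holds S Γ ↔
    ∃ ρ : S.Path, ρ.at 0 = Γ.rcnt ∧ φ.Holds S (Γ.set v ρ) := Iff.rfl

@[simp] theorem holds_all : (all v φ).Holds S Γ ↔
    ∀ ρ : S.Path, ρ.at 0 = Γ.rcnt → φ.Holds S (Γ.set v ρ) := Iff.rfl

@[simp] theorem holds_and : (and φ₁ φ₂).Holds S Γ ↔ φ₁.Holds S Γ ∧ φ₂.Holds S Γ := by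
  simp [and]

@[simp] theorem holds_imp : (imp φ₁ φ₂).Holds S Γ ↔ (φ₁.Holds S Γ → φ₂.Holds S Γ) := by
  simp [imp, imp_iff_not_or]

@[simp] theorem holds_eventually : (eventually φ).Holds S Γ ↔ ∃ j, φ.Holds S (Γ.drop j) := by
  simp [eventually, Classical.em]

@[simp] theorem holds_globally : (globally φ).Holds S Γ ↔ ∀ j, φ.Holds S (Γ.drop j) := by
  simp [globally]

theorem holds_atom {ρ : S.Path} (h : Γ.map v = some ρ) {a : AP} :
    (atom a v).Holds S Γ ↔ a ∈ S.label (ρ.at 0) := by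
  simp [Holds, h]

@[simp] theorem freeVars_and : (and φ₁ φ₂).freeVars = φ₁.freeVars ∪ φ₂.freeVars := rfl

@[simp] theorem freeVars_imp : (imp φ₁ φ₂).freeVars = φ₁.freeVars ∪ φ₂.freeVars := rfl

@[simp] theorem freeVars_eventually : (eventually φ).freeVars = φ.freeVars := by
  simp [eventually, freeVars]

@[simp] theorem freeVars_globally : (globally φ).freeVars = φ.freeVars := by
  simp [globally, freeVars]

end HyperCTL

/-! ### HyperLTL in HyperCTL* -/

section

variable {AP V : Type} (ι : ArithProp ⊕ Bool → AP) (S : TransitionSystem AP V)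

/-- The map `ι` places seven propositions: `inl` the five arithmetical ones, `inr true` the marker
of operation traces, `inr false` the bit that encodes membership in a set. -/
def HyperLTLBody.toCTL : HyperLTLBody ArithProp → HyperCTL AP
  | atom a v => .atom (ι (.inl a)) v
  | neg ψ => .neg ψ.toCTL
  | or ψ₁ ψ₂ => .or ψ₁.toCTL ψ₂.toCTL
  | next ψ => .next ψ.toCTL
  | .until ψ₁ ψ₂ => .until ψ₁.toCTL ψ₂.toCTL

/-- Relativization to the paths whose second vertex carries the marker `ι (inr true)`; traces are
read from the second vertex on. -/
def HyperLTL.toCTL : HyperLTL ArithProp → HyperCTL AP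
  | body ψ => .next (ψ.toCTL ι)
  | ex v φ => .ex v (.and (.next (.atom (ι (.inr true)) v)) φ.toCTL)
  | all v φ => .all v (.imp (.next (.atom (ι (.inr true)) v)) φ.toCTL)

variable {S}

def TransitionSystem.Path.arithTrace (ρ : S.Path) : Trace ArithProp :=
  fun n => {a | ι (.inl a) ∈ S.label (ρ.at n)}

def PathAssignment.arithTraces (Γ : PathAssignment S) : TraceAssignment ArithProp :=
  fun v => (Γ.map v).map fun ρ => ρ.arithTrace ι

variable (S) in
/-- The traces of the marked paths. -/
def TransitionSystem.markedTraces : Set (Trace ArithProp) :=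
  {t | ∃ ρ : S.Path, ρ.at 0 = S.init ∧ ι (.inr true) ∈ S.label (ρ.at 1) ∧
    (ρ.drop 1).arithTrace ι = t}

theorem PathAssignment.arithTraces_drop (Γ : PathAssignment S) (j : ℕ) :
    (Γ.drop j).arithTraces ι = (Γ.arithTraces ι).drop j := by
  funext v
  simp only [arithTraces, drop, TraceAssignment.drop, Option.map_map]
  rfl

theorem PathAssignment.arithTraces_set (Γ : PathAssignment S) (v : PathVar) (ρ : S.Path) :
    (Γ.set v ρ).arithTraces ι = (Γ.arithTraces ι).set v (ρ.arithTrace ι) := by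
  funext w
  by_cases h : w = v
  · subst h
    simp [arithTraces, TraceAssignment.set]
  · simp [arithTraces, TraceAssignment.set, set_map_of_ne h, h]

theorem PathAssignment.drop_set (Γ : PathAssignment S) (v : PathVar) (ρ : S.Path) (j : ℕ) :
    (Γ.set v ρ).drop j = (Γ.drop j).set v (ρ.drop j) := by
  simp only [drop, set, mk.injEq, and_true]
  funext w
  by_cases h : w = v
  · subst h; simp
  · simp [h]

theorem HyperLTLBody.holds_toCTL (ψ : HyperLTLBody ArithProp) (Γ : PathAssignment S) :
    (ψ.toCTL ι).Holds S Γ ↔ ψ.Holds (Γ.arithTraces ι) := by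
  induction ψ generalizing Γ with
  | atom a v => simp [toCTL, HyperCTL.Holds, HyperLTLBody.Holds, PathAssignment.arithTraces,
      TransitionSystem.Path.arithTrace]
  | neg ψ ih => simp [toCTL, HyperLTLBody.Holds, ih]
  | or ψ₁ ψ₂ ih₁ ih₂ => simp [toCTL, HyperLTLBody.Holds, ih₁, ih₂]
  | next ψ ih => simp [toCTL, HyperLTLBody.Holds, ih, PathAssignment.arithTraces_drop]
  | _ ψ₁ ψ₂ ih₁ ih₂ =>
    simp [toCTL, HyperLTLBody.Holds, ih₁, ih₂, PathAssignment.arithTraces_drop]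

/-- No time passes between the quantifiers of the prefix, so each one ranges over paths from the
initial vertex; this is what the hypothesis on `rcnt` keeps track of. Time advances by one only at
the body, where the traces begin. -/
theorem HyperLTL.holds_toCTL (φ : HyperLTL ArithProp) {Γ : PathAssignment S}
    (hΓ : Γ.rcnt = S.init) :
    (φ.toCTL ι).Holds S Γ ↔ φ.Holds (S.markedTraces ι) ((Γ.drop 1).arithTraces ι) := by
  induction φ generalizing Γ with
  | body ψ => exact ψ.holds_toCTL ι _
  | ex v φ ih =>
    have key : ∀ ρ : S.Path, ρ.at 0 = S.init → ((φ.toCTL ι).Holds S (Γ.set v ρ) ↔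
        φ.Holds (S.markedTraces ι)
          (((Γ.drop 1).arithTraces ι).set v ((ρ.drop 1).arithTrace ι))) := by
      intro ρ hρ
      rw [ih (by simpa using hρ), PathAssignment.drop_set, PathAssignment.arithTraces_set]
    have mark : ∀ ρ : S.Path, (HyperCTL.atom (ι (.inr true)) v).Holds S ((Γ.set v ρ).drop 1) ↔
        ι (.inr true) ∈ S.label (ρ.at 1) := fun ρ =>
      HyperCTL.holds_atom (PathAssignment.drop_map PathAssignment.set_map_self 1)
    simp only [toCTL, HyperCTL.holds_ex, HyperCTL.holds_and, HyperCTL.holds_next, hΓ, mark,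
      HyperLTL.Holds]
    constructor
    · rintro ⟨ρ, h0, h1, h⟩
      exact ⟨_, ⟨ρ, h0, h1, rfl⟩, (key ρ h0).1 h⟩
    · rintro ⟨_, ⟨ρ, h0, h1, rfl⟩, h⟩
      exact ⟨ρ, h0, h1, (key ρ h0).2 h⟩
  | all v φ ih =>
    have key : ∀ ρ : S.Path, ρ.at 0 = S.init → ((φ.toCTL ι).Holds S (Γ.set v ρ) ↔
        φ.Holds (S.markedTraces ι)
          (((Γ.drop 1).arithTraces ι).set v ((ρ.drop 1).arithTrace ι))) := by
      intro ρ hρ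
      rw [ih (by simpa using hρ), PathAssignment.drop_set, PathAssignment.arithTraces_set]
    have mark : ∀ ρ : S.Path, (HyperCTL.atom (ι (.inr true)) v).Holds S ((Γ.set v ρ).drop 1) ↔
        ι (.inr true) ∈ S.label (ρ.at 1) := fun ρ =>
      HyperCTL.holds_atom (PathAssignment.drop_map PathAssignment.set_map_self 1)
    simp only [toCTL, HyperCTL.holds_all, HyperCTL.holds_imp, HyperCTL.holds_next, hΓ, mark,
      HyperLTL.Holds]
    constructor
    · rintro h _ ⟨ρ, h0, h1, rfl⟩
      exact (key ρ h0).1 (h ρ h0 h1)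
    · intro h ρ h0 h1
      exact (key ρ h0).2 (h _ ⟨ρ, h0, h1, rfl⟩)

theorem HyperLTLBody.freeVars_toCTL (ψ : HyperLTLBody ArithProp) :
    (ψ.toCTL ι).freeVars = ψ.freeVars := by
  induction ψ <;> simp_all [toCTL, HyperCTL.freeVars, HyperLTLBody.freeVars]

theorem HyperLTL.freeVars_toCTL (φ : HyperLTL ArithProp) : (φ.toCTL ι).freeVars = φ.freeVars := by
  induction φ with
  | body ψ => exact ψ.freeVars_toCTL ι
  | ex v φ ih => simp [toCTL, HyperCTL.freeVars, HyperLTL.freeVars, ih]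
  | all v φ ih => simp [toCTL, HyperCTL.freeVars, HyperLTL.freeVars, ih]

end

/-! ### Second-order arithmetic in HyperCTL* -/

section

variable {AP : Type} (ι : ArithProp ⊕ Bool → AP)

namespace HyperCTL

/-- The path `v` has the marker `ι (inr false)` at its current position. -/
def bit (v : PathVar) : HyperCTL AP := atom (ι (.inr false)) v

/-- The path `v` encodes a set of numbers. -/
def isSet (v : PathVar) : HyperCTL AP := next (neg (atom (ι (.inr true)) v))

/-- The path `v` encodes a number. -/
def isNum (v : PathVar) : HyperCTL AP :=
  and (isSet ι v)
    (next (.until (neg (bit ι v)) (and (bit ι v) (next (globally (neg (bit ι v)))))))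

/-- The sets encoded by `v` and `w` have a common element. -/
def meet (v w : PathVar) : HyperCTL AP := next (eventually (and (bit ι v) (bit ι w)))

/-- Every set of numbers is encoded by a path. -/
def allSets : HyperCTL AP :=
  and (ex 0 (and (isSet ι 0) (next (bit ι 0))))
    (and (ex 0 (and (isSet ι 0) (next (neg (bit ι 0)))))
      -- The inner quantifiers start at the current vertex of path `0`, so this asks for both values
      -- of the bit among the successors of each vertex on the path.
      (all 0 (imp (isSet ι 0) (next (globally
        (and (ex 1 (next (bit ι 1))) (ex 1 (next (neg (bit ι 1))))))))))

def numEx (v : PathVar) (φ : HyperCTL AP) : HyperCTL AP := ex v (and (isNum ι v) φ)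

def numAll (v : PathVar) (φ : HyperCTL AP) : HyperCTL AP := all v (imp (isNum ι v) φ)

def setEx (v : PathVar) (φ : HyperCTL AP) : HyperCTL AP := ex v (and (isSet ι v) φ)

def setAll (v : PathVar) (φ : HyperCTL AP) : HyperCTL AP := all v (imp (isSet ι v) φ)

/-- The number encoded by `0` satisfies `φ` and is the argument `p` of the operation trace `1`. -/
def operand (p : ArithProp) (φ : HyperCTL AP) : HyperCTL AP :=
  numEx ι 0 (and (next (eventually (and (atom (ι (.inl p)) 1) (bit ι 0)))) φ)

/-- The number encoded by `0` is the result of the operation `p`, for operands that satisfy `φ₁`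
and `φ₂`. -/
def operation (p : ArithProp) (φ₁ φ₂ : HyperCTL AP) : HyperCTL AP :=
  ex 1 (and (next (and (atom (ι (.inr true)) 1) (atom (ι (.inl p)) 1)))
    (and (next (eventually (and (atom (ι (.inl .res)) 1) (bit ι 0))))
      (and (operand ι .arg₁ φ₁) (operand ι .arg₂ φ₂))))

/-- For numbers that satisfy `φ₁` and `φ₂`, the first is smaller. -/
def less (φ₁ φ₂ : HyperCTL AP) : HyperCTL AP :=
  numEx ι 0 (and φ₁ (numEx ι 1 (and
    (next (eventually (and (bit ι 0) (next (eventually (bit ι 1))))))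
    (numEx ι 0 (and (meet ι 0 1) φ₂)))))

end HyperCTL

open HyperCTL

/-- The formula expressing that the number encoded by the path `0` is the value of the term. -/
def ArithTerm.toCTL : ArithTerm → HyperCTL AP
  | var y => meet ι 0 (2 * y + 2)
  | zero => .next (bit ι 0)
  | one => .next (.next (bit ι 0))
  | add s t => operation ι .add s.toCTL t.toCTL
  | mul s t => operation ι .mult s.toCTL t.toCTL

/-- Number variables occupy the even path variables from `2` on, set variables the odd ones from `3`
on. The variables `0` and `1` are scratch: `0` carries the number that a term formula speaks about,
`1` an operation trace or, in `less`, the larger number. -/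
def SOArith.toCTL : SOArith → HyperCTL AP
  | eq s t => numEx ι 0 (.and (s.toCTL ι) (t.toCTL ι))
  | lt s t => less ι (s.toCTL ι) (t.toCTL ι)
  | mem s X => numEx ι 0 (.and (meet ι 0 (2 * X + 3)) (s.toCTL ι))
  | neg φ => .neg φ.toCTL
  | or φ₁ φ₂ => .or φ₁.toCTL φ₂.toCTL
  | exNum y φ => numEx ι (2 * y + 2) φ.toCTL
  | allNum y φ => numAll ι (2 * y + 2) φ.toCTL
  | exSet X φ => setEx ι (2 * X + 3) φ.toCTL
  | allSet X φ => setAll ι (2 * X + 3) φ.toCTL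

/-- The sentence that is satisfiable if and only if `φ` is true. -/
def SOArith.reduction (φ : SOArith) : HyperCTL AP :=
  -- The outer quantifier only makes guardedness immediate; the path it binds is never consulted.
  .ex 0 (.and (OpFormula.sentence.toCTL ι) (.and (allSets ι) (φ.toCTL ι)))

/-! #### Free variables -/

/-- Knowing the free variables up to the scratch variable `0` is enough, because every formula that
contains a term formula binds `0` around it. -/
theorem ArithTerm.freeVars_toCTL (s : ArithTerm) :
    (s.toCTL ι).freeVars ⊆ {0} ∪ (fun y => 2 * y + 2) '' s.freeVars ∧
      (fun y => 2 * y + 2) '' s.freeVars ⊆ (s.toCTL ι).freeVars := by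
  induction s with
  | var y => simp [toCTL, meet, bit, HyperCTL.freeVars, freeVars]
  | zero => simp [toCTL, bit, HyperCTL.freeVars, freeVars]
  | one => simp [toCTL, bit, HyperCTL.freeVars, freeVars]
  | add s t ihs iht | mul s t ihs iht =>
    simp only [toCTL, operation, operand, numEx, isNum, isSet, bit, HyperCTL.freeVars, freeVars,
      freeVars_and, freeVars_eventually, freeVars_globally, Set.image_union]
    simp only [Set.subset_def, Set.mem_union, Set.mem_singleton_iff, Set.mem_sdiff] at *
    have h : ∀ s : Set ℕ, ∀ v ∈ (fun y => 2 * y + 2) '' s, v ≠ 0 ∧ v ≠ 1 := by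
      rintro s _ ⟨y, -, rfl⟩
      simp
    have h1 := h s.freeVars
    have h2 := h t.freeVars
    grind

theorem SOArith.freeVars_toCTL (φ : SOArith) : (φ.toCTL ι).freeVars =
    (fun y => 2 * y + 2) '' φ.freeNumVars ∪ (fun X => 2 * X + 3) '' φ.freeSetVars := by
  have h : ∀ s : ArithTerm, ∀ v ∈ (fun y => 2 * y + 2) '' s.freeVars, v ≠ 0 ∧ v ≠ 1 := by
    rintro s _ ⟨y, -, rfl⟩
    simp
  have hd : ∀ (k a : ℕ) (s : Set ℕ), (fun y => 2 * y + k) '' (s \ {a}) =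
      (fun y => 2 * y + k) '' s \ {2 * a + k} := fun k a s => by
    rw [Set.image_sdiff (fun x y => by simp), Set.image_singleton]
  have h2 : ∀ (a : ℕ) (s : Set ℕ), 2 * a + 3 ∉ (fun y => 2 * y + 2) '' s := by
    rintro a s ⟨y, -, h⟩
    simp only at h
    omega
  have h3 : ∀ (a : ℕ) (s : Set ℕ), 2 * a + 2 ∉ (fun y => 2 * y + 3) '' s := by
    rintro a s ⟨y, -, h⟩
    simp only at h
    omega
  induction φ with
  | eq s t | lt s t =>
    ext v
    have hs := s.freeVars_toCTL ι
    have ht := t.freeVars_toCTL ι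
    have h1 := h s
    have h2 := h t
    simp only [toCTL, less, numEx, isNum, isSet, bit, meet, HyperCTL.freeVars, freeNumVars,
      freeSetVars, freeVars_and, freeVars_eventually, freeVars_globally, Set.image_union,
      Set.image_empty, Set.union_empty]
    simp only [Set.subset_def, Set.mem_union, Set.mem_singleton_iff, Set.mem_sdiff] at *
    grind
  | mem s X =>
    ext v
    have hs := s.freeVars_toCTL ι
    have h1 := h s
    simp only [toCTL, numEx, isNum, isSet, bit, meet, HyperCTL.freeVars, freeNumVars,
      freeSetVars, freeVars_and, freeVars_eventually, freeVars_globally, Set.image_singleton]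
    simp only [Set.subset_def, Set.mem_union, Set.mem_singleton_iff, Set.mem_sdiff] at *
    grind
  | neg φ ih => exact ih
  | or φ₁ φ₂ ih₁ ih₂ =>
    simp only [toCTL, HyperCTL.freeVars, ih₁, ih₂, freeNumVars, freeSetVars, Set.image_union]
    exact Set.union_union_union_comm ..
  | exNum y φ ih | allNum y φ ih =>
    simp only [toCTL, numEx, numAll, isNum, isSet, bit, HyperCTL.freeVars, freeNumVars,
      freeSetVars, freeVars_and, freeVars_imp, freeVars_globally, hd, ih]
    ext v
    have := h3 y φ.freeSetVars
    simp only [Set.mem_union, Set.mem_singleton_iff, Set.mem_sdiff] at *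
    grind
  | exSet X φ ih | allSet X φ ih =>
    simp only [toCTL, setEx, setAll, isSet, HyperCTL.freeVars, freeNumVars,
      freeSetVars, freeVars_and, freeVars_imp, hd, ih]
    ext v
    have := h2 X φ.freeNumVars
    simp only [Set.mem_union, Set.mem_singleton_iff, Set.mem_sdiff] at *
    grind

/-- Both directions matter: a formula that is not a sentence is a negative instance and must be sent
to one. -/
theorem SOArith.isSentence_reduction (φ : SOArith) : (φ.reduction ι).IsSentence ↔ φ.IsSentence := by
  have h1 : (OpFormula.sentence.toCTL ι).freeVars = ∅ :=
    (HyperLTL.freeVars_toCTL ι _).trans OpFormula.isSentence_sentence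
  have h2 : (allSets ι).freeVars = ∅ := by
    simp [allSets, isSet, bit, HyperCTL.freeVars]
  have h0 : 0 ∉ (φ.toCTL ι).freeVars := by
    rw [freeVars_toCTL]
    simp
  simp only [reduction, HyperCTL.IsSentence, HyperCTL.TemporalGuarded, HyperCTL.freeVars,
    freeVars_and, h1, h2, Set.empty_union, true_and, Set.sdiff_singleton_eq_self h0, IsSentence]
  rw [freeVars_toCTL]
  simp

end

/-! #### Correctness -/

section

variable {AP V : Type} (ι : ArithProp ⊕ Bool → AP) {S : TransitionSystem AP V}

/-- The path starts in the initial vertex and encodes the set `A`. -/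
def TransitionSystem.Path.Encodes (ρ : S.Path) (A : Set ℕ) : Prop :=
  ρ.at 0 = S.init ∧ ι (.inr true) ∉ S.label (ρ.at 1) ∧
    ∀ n, ι (.inr false) ∈ S.label (ρ.at (n + 1)) ↔ n ∈ A

open HyperCTL

variable {Γ : PathAssignment S} {v w : PathVar} {ρ σ : S.Path} {A B : Set ℕ}

theorem holds_isSet (h : Γ.map v = some ρ) (h0 : ρ.at 0 = S.init) :
    (isSet ι v).Holds S Γ ↔ ∃ A, ρ.Encodes ι A := by
  simp only [isSet, holds_next, holds_neg, holds_atom (PathAssignment.drop_map h 1)]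
  exact ⟨fun h => ⟨{n | _}, h0, h, fun n => Iff.rfl⟩, fun ⟨_, _, h, _⟩ => h⟩

theorem holds_bit (h : Γ.map v = some ρ) (hρ : ρ.Encodes ι A) (n : ℕ) :
    (bit ι v).Holds S ((Γ.drop 1).drop n) ↔ n ∈ A := by
  rw [bit, holds_atom (PathAssignment.drop_map (PathAssignment.drop_map h 1) n), ← hρ.2.2]
  simp [add_comm]

theorem holds_bit' (h : Γ.map v = some ρ) (hρ : ρ.Encodes ι A) :
    (bit ι v).Holds S (Γ.drop 1) ↔ 0 ∈ A := by
  rw [bit, holds_atom (PathAssignment.drop_map h 1), ← hρ.2.2]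
  simp

theorem holds_bit_drop_drop (h : Γ.map v = some ρ) (hρ : ρ.Encodes ι A) (n k l : ℕ) :
    (bit ι v).Holds S ((((Γ.drop 1).drop n).drop k).drop l) ↔ n + k + l ∈ A := by
  rw [bit, holds_atom (PathAssignment.drop_map (PathAssignment.drop_map (PathAssignment.drop_map
    (PathAssignment.drop_map h 1) n) k) l), ← hρ.2.2]
  simp only [TransitionSystem.Path.at_drop]
  rw [show 1 + (n + (k + (l + 0))) = n + k + l + 1 by omega]

theorem holds_isNum (h : Γ.map v = some ρ) (h0 : ρ.at 0 = S.init) :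
    (isNum ι v).Holds S Γ ↔ ∃ n, ρ.Encodes ι {n} := by
  rw [isNum, holds_and, holds_isSet ι h h0]
  constructor
  · rintro ⟨⟨A, hA⟩, hn⟩
    simp only [holds_next, holds_until, holds_and, holds_neg, holds_globally, holds_bit ι h hA,
      holds_bit_drop_drop ι h hA] at hn
    obtain ⟨n, ⟨hn, hg⟩, hl⟩ := hn
    refine ⟨n, ?_⟩
    convert hA
    ext k
    simp only [Set.mem_singleton_iff]
    refine ⟨fun h => h ▸ hn, fun hk => ?_⟩
    rcases lt_trichotomy k n with h | h | h
    · exact absurd hk (hl k h)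
    · exact h
    · exact absurd (by convert hk using 1; omega) (hg (k - n - 1))
  · rintro ⟨n, hn⟩
    refine ⟨⟨_, hn⟩, ?_⟩
    simp only [holds_next, holds_until, holds_and, holds_neg, holds_globally, holds_bit ι h hn,
      holds_bit_drop_drop ι h hn, Set.mem_singleton_iff]
    exact ⟨n, ⟨rfl, fun j => by omega⟩, fun i hi => by omega⟩

theorem holds_meet (hv : Γ.map v = some ρ) (hw : Γ.map w = some σ) (hρ : ρ.Encodes ι A)
    (hσ : σ.Encodes ι B) : (meet ι v w).Holds S Γ ↔ (A ∩ B).Nonempty := by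
  simp only [meet, holds_next, holds_eventually, holds_and, holds_bit ι hv hρ, holds_bit ι hw hσ]
  rfl

/-- The paths of the system encode all sets of numbers, and the marked paths the arithmetic
operations. -/
structure Arithmetical (S : TransitionSystem AP V) : Prop where
  exists_path : ∀ A, ∃ ρ : S.Path, ρ.Encodes ι A
  markedTraces : S.markedTraces ι = Trace.closure opTraces

/-- Path quantifiers branch off the most recent path at the current time. The translation places
them only where no time has passed, so `rcnt` is the initial vertex and all encodings start there.
-/
theorem holds_numEx (hΓ : Γ.rcnt = S.init) {φ : HyperCTL AP} :
    (numEx ι v φ).Holds S Γ ↔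
      ∃ (n : ℕ) (ρ : S.Path), ρ.Encodes ι {n} ∧ φ.Holds S (Γ.set v ρ) := by
  simp only [numEx, holds_ex, holds_and, hΓ]
  constructor
  · rintro ⟨ρ, h0, h1, h2⟩
    obtain ⟨n, hn⟩ := (holds_isNum ι PathAssignment.set_map_self h0).1 h1
    exact ⟨n, ρ, hn, h2⟩
  · rintro ⟨n, ρ, hn, h2⟩
    exact ⟨ρ, hn.1, (holds_isNum ι PathAssignment.set_map_self hn.1).2 ⟨n, hn⟩, h2⟩

theorem holds_numAll (hΓ : Γ.rcnt = S.init) {φ : HyperCTL AP} :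
    (numAll ι v φ).Holds S Γ ↔
      ∀ (n : ℕ) (ρ : S.Path), ρ.Encodes ι {n} → φ.Holds S (Γ.set v ρ) := by
  simp only [numAll, holds_all, holds_imp, hΓ]
  constructor
  · intro h n ρ hn
    exact h ρ hn.1 ((holds_isNum ι PathAssignment.set_map_self hn.1).2 ⟨n, hn⟩)
  · intro h ρ h0 h1
    obtain ⟨n, hn⟩ := (holds_isNum ι PathAssignment.set_map_self h0).1 h1
    exact h n ρ hn

theorem holds_setEx (hΓ : Γ.rcnt = S.init) {φ : HyperCTL AP} :
    (setEx ι v φ).Holds S Γ ↔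
      ∃ (A : Set ℕ) (ρ : S.Path), ρ.Encodes ι A ∧ φ.Holds S (Γ.set v ρ) := by
  simp only [setEx, holds_ex, holds_and, hΓ]
  constructor
  · rintro ⟨ρ, h0, h1, h2⟩
    obtain ⟨n, hn⟩ := (holds_isSet ι PathAssignment.set_map_self h0).1 h1
    exact ⟨n, ρ, hn, h2⟩
  · rintro ⟨n, ρ, hn, h2⟩
    exact ⟨ρ, hn.1, (holds_isSet ι PathAssignment.set_map_self hn.1).2 ⟨n, hn⟩, h2⟩

theorem holds_setAll (hΓ : Γ.rcnt = S.init) {φ : HyperCTL AP} :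
    (setAll ι v φ).Holds S Γ ↔
      ∀ (A : Set ℕ) (ρ : S.Path), ρ.Encodes ι A → φ.Holds S (Γ.set v ρ) := by
  simp only [setAll, holds_all, holds_imp, hΓ]
  constructor
  · intro h n ρ hn
    exact h ρ hn.1 ((holds_isSet ι PathAssignment.set_map_self hn.1).2 ⟨n, hn⟩)
  · intro h ρ h0 h1
    obtain ⟨n, hn⟩ := (holds_isSet ι PathAssignment.set_map_self h0).1 h1
    exact h n ρ hn

/-- The values of the free variables are given by the paths assigned to them. -/
structure Interprets (Γ : PathAssignment S) (e : ℕ → ℕ) (E : ℕ → Set ℕ) (N M : Set ℕ) : Prop where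
  rcnt : Γ.rcnt = S.init
  num : ∀ y ∈ N, ∃ ρ, Γ.map (2 * y + 2) = some ρ ∧ ρ.Encodes ι {e y}
  set : ∀ X ∈ M, ∃ ρ, Γ.map (2 * X + 3) = some ρ ∧ ρ.Encodes ι (E X)

variable {ι} {e : ℕ → ℕ} {E : ℕ → Set ℕ} {N M N' M' : Set ℕ}

theorem Interprets.mono (h : Interprets ι Γ e E N M) (hN : N' ⊆ N) (hM : M' ⊆ M) :
    Interprets ι Γ e E N' M' := ⟨h.rcnt, fun y hy => h.num y (hN hy), fun X hX => h.set X (hM hX)⟩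

theorem Interprets.set_aux {v : ℕ} (h : Interprets ι Γ e E N M) (hv : v = 0 ∨ v = 1)
    (hρ : ρ.at 0 = S.init) : Interprets ι (Γ.set v ρ) e E N M := by
  refine ⟨by simpa using hρ, fun y hy => ?_, fun X hX => ?_⟩
  · rw [PathAssignment.set_map_of_ne (show 2 * y + 2 ≠ v by omega)]
    exact h.num y hy
  · rw [PathAssignment.set_map_of_ne (show 2 * X + 3 ≠ v by omega)]
    exact h.set X hX

theorem Interprets.set_num {v : ℕ} (h : Interprets ι Γ e E (N \ {v}) M) {n : ℕ}
    (hρ : ρ.Encodes ι {n}) :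
    Interprets ι (Γ.set (2 * v + 2) ρ) (Function.update e v n) E N M := by
  refine ⟨by simpa using hρ.1, fun y hy => ?_, fun X hX => ?_⟩
  · by_cases hyv : y = v
    · subst hyv
      exact ⟨ρ, by simp, by simpa using hρ⟩
    · rw [PathAssignment.set_map_of_ne (show 2 * y + 2 ≠ 2 * v + 2 by omega)]
      simpa [hyv] using h.num y ⟨hy, hyv⟩
  · rw [PathAssignment.set_map_of_ne (show 2 * X + 3 ≠ 2 * v + 2 by omega)]
    exact h.set X hX

theorem Interprets.set_set {v : ℕ} (h : Interprets ι Γ e E N (M \ {v})) (hρ : ρ.Encodes ι A) :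
    Interprets ι (Γ.set (2 * v + 3) ρ) e (Function.update E v A) N M := by
  refine ⟨by simpa using hρ.1, fun y hy => ?_, fun X hX => ?_⟩
  · rw [PathAssignment.set_map_of_ne (show 2 * y + 2 ≠ 2 * v + 3 by omega)]
    exact h.num y hy
  · by_cases hXv : X = v
    · subst hXv
      exact ⟨ρ, by simp, by simpa using hρ⟩
    · rw [PathAssignment.set_map_of_ne (show 2 * X + 3 ≠ 2 * v + 3 by omega)]
      simpa [hXv] using h.set X ⟨hX, hXv⟩

end

/-- The limit traces in the closure do no harm: the three marks are required at finite positions,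
and a valid code with finite entries is a genuine equation between natural numbers. -/
theorem exists_mem_closure_opTraces (m : Bool) (a b c : ℕ) :
    (∃ t ∈ Trace.closure opTraces, (if m then .mult else .add) ∈ t 0 ∧ .res ∈ t c ∧ .arg₁ ∈ t a ∧
      .arg₂ ∈ t b) ↔ OpCode.natValue m a b = c := by
  constructor
  · rintro ⟨t, ht, h0, hc, ha, hb⟩
    obtain ⟨⟨m', a', b', c'⟩, hq, rfl⟩ := OpCode.mem_closure_opTraces_iff.1 ht
    rw [OpCode.mem_trace_of_mark (by simp)] at ha hb hc
    simp only [OpCode.pos, OpCode.Valid] at ha hb hc hq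
    subst ha hb
    rw [OpCode.value_coe, ← hc] at hq
    have : m' = m := by cases m <;> simpa using h0
    subst this
    exact_mod_cast hq.symm
  · rintro rfl
    refine ⟨_, OpCode.mem_closure_opTraces_iff.2 ⟨⟨m, a, b, OpCode.natValue m a b⟩,
      (OpCode.value_coe m a b).symm, rfl⟩, ?_⟩
    simp only [OpCode.mem_trace_of_mark (p := .arg₁) (by simp),
      OpCode.mem_trace_of_mark (p := .arg₂) (by simp),
      OpCode.mem_trace_of_mark (p := .res) (by simp), OpCode.pos]
    cases m <;> simp

section

variable {AP V : Type} {ι : ArithProp ⊕ Bool → AP} {S : TransitionSystem AP V}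

open HyperCTL

variable {Γ : PathAssignment S} {v w : PathVar} {ρ σ τ : S.Path} {A B : Set ℕ}

theorem holds_mark_at (h1 : Γ.map 1 = some τ) (h0 : Γ.map 0 = some σ) {n : ℕ}
    (hσ : σ.Encodes ι {n}) {p : ArithProp} :
    (next (eventually (and (atom (ι (.inl p)) 1) (bit ι 0)))).Holds S Γ ↔
      p ∈ (τ.drop 1).arithTrace ι n := by
  simp only [holds_next, holds_eventually, holds_and, holds_bit ι h0 hσ, Set.mem_singleton_iff,
    exists_eq_right, holds_atom (PathAssignment.drop_map (PathAssignment.drop_map h1 1) _)]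
  simp [TransitionSystem.Path.arithTrace]

theorem holds_operand (hΓ : Γ.rcnt = S.init) (h1 : Γ.map 1 = some τ) {p : ArithProp}
    {φ : HyperCTL AP} (hι : Arithmetical ι S) {a : ℕ}
    (hφ : ∀ (n : ℕ) (σ : S.Path), σ.Encodes ι {n} → (φ.Holds S (Γ.set 0 σ) ↔ a = n)) :
    (operand ι p φ).Holds S Γ ↔ p ∈ (τ.drop 1).arithTrace ι a := by
  rw [operand, holds_numEx ι hΓ]
  have key : ∀ (n : ℕ) (σ : S.Path), σ.Encodes ι {n} →
      ((and (next (eventually (and (atom (ι (.inl p)) 1) (bit ι 0)))) φ).Holds S (Γ.set 0 σ) ↔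
        p ∈ (τ.drop 1).arithTrace ι n ∧ a = n) := by
    intro n σ hσ
    rw [holds_and, hφ n σ hσ, holds_mark_at
      ((PathAssignment.set_map_of_ne (show (1 : ℕ) ≠ 0 by simp)).trans h1)
      PathAssignment.set_map_self hσ]
  constructor
  · rintro ⟨n, σ, hσ, h⟩
    obtain ⟨h, rfl⟩ := (key n σ hσ).1 h
    exact h
  · intro h
    obtain ⟨σ, hσ⟩ := hι.exists_path {a}
    exact ⟨a, σ, hσ, (key a σ hσ).2 ⟨h, rfl⟩⟩

theorem holds_operation (hΓ : Γ.rcnt = S.init) (h0 : Γ.map 0 = some ρ) {m : ℕ}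
    (hρ : ρ.Encodes ι {m}) {mul : Bool} {φ₁ φ₂ : HyperCTL AP} (hι : Arithmetical ι S) {a b : ℕ}
    (h₁ : ∀ (τ : S.Path), τ.at 0 = S.init → ∀ (n : ℕ) (σ : S.Path), σ.Encodes ι {n} →
      (φ₁.Holds S ((Γ.set 1 τ).set 0 σ) ↔ a = n))
    (h₂ : ∀ (τ : S.Path), τ.at 0 = S.init → ∀ (n : ℕ) (σ : S.Path), σ.Encodes ι {n} →
      (φ₂.Holds S ((Γ.set 1 τ).set 0 σ) ↔ b = n)) :
    (operation ι (if mul then .mult else .add) φ₁ φ₂).Holds S Γ ↔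
      OpCode.natValue mul a b = m := by
  rw [← exists_mem_closure_opTraces, ← hι.markedTraces, operation, holds_ex, hΓ]
  have key : ∀ τ : S.Path, τ.at 0 = S.init →
      ((and (next (and (atom (ι (.inr true)) 1) (atom (ι (.inl (if mul then .mult else .add))) 1)))
        (and (next (eventually (and (atom (ι (.inl .res)) 1) (bit ι 0))))
          (and (operand ι .arg₁ φ₁) (operand ι .arg₂ φ₂)))).Holds S (Γ.set 1 τ) ↔
      (ι (.inr true) ∈ S.label (τ.at 1) ∧
        (if mul then .mult else .add) ∈ (τ.drop 1).arithTrace ι 0) ∧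
      .res ∈ (τ.drop 1).arithTrace ι m ∧ .arg₁ ∈ (τ.drop 1).arithTrace ι a ∧
      .arg₂ ∈ (τ.drop 1).arithTrace ι b) := by
    intro τ hτ
    have hΓτ : (Γ.set 1 τ).rcnt = S.init := by simpa using hτ
    have e1 : (Γ.set 1 τ).map 1 = some τ := PathAssignment.set_map_self
    have e0 : (Γ.set 1 τ).map 0 = some ρ :=
      (PathAssignment.set_map_of_ne (show (0 : ℕ) ≠ 1 by simp)).trans h0
    have h : ∀ a : AP, (atom a 1).Holds S ((Γ.set 1 τ).drop 1) ↔ a ∈ S.label (τ.at 1) := fun a =>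
      holds_atom (PathAssignment.drop_map e1 1)
    rw [holds_and, holds_and, holds_and, holds_next, holds_and, h, h, holds_mark_at e1 e0 hρ,
      holds_operand hΓτ e1 hι (h₁ τ hτ), holds_operand hΓτ e1 hι (h₂ τ hτ)]
    rfl
  constructor
  · rintro ⟨τ, hτ, h⟩
    obtain ⟨⟨h1, h2⟩, h3⟩ := (key τ hτ).1 h
    exact ⟨_, ⟨τ, hτ, h1, rfl⟩, h2, h3⟩
  · rintro ⟨_, ⟨τ, hτ, h1, rfl⟩, h2, h3⟩
    exact ⟨τ, hτ, (key τ hτ).2 ⟨⟨h1, h2⟩, h3⟩⟩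

variable {e : ℕ → ℕ} {E : ℕ → Set ℕ}

theorem ArithTerm.holds_toCTL (hι : Arithmetical ι S) (s : ArithTerm) {M : Set ℕ} {m : ℕ}
    (hΓ : Interprets ι Γ e E s.freeVars M) (h0 : Γ.map 0 = some ρ) (hρ : ρ.Encodes ι {m}) :
    (s.toCTL ι).Holds S Γ ↔ s.val e = m := by
  induction s generalizing Γ ρ m with
  | var y =>
    obtain ⟨σ, h1, h2⟩ := hΓ.num y rfl
    rw [toCTL, holds_meet ι h0 h1 hρ h2, val]
    simp [eq_comm]
  | zero =>
    rw [toCTL, holds_next, holds_bit' ι h0 hρ]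
    rfl
  | one =>
    rw [toCTL, holds_next, holds_next, holds_bit ι h0 hρ]
    rfl
  | add s t ihs iht =>
    refine holds_operation (mul := false) hΓ.rcnt h0 hρ hι (fun τ hτ n σ hσ => ?_)
      fun τ hτ n σ hσ => ?_
    · exact ihs (((hΓ.mono Set.subset_union_left subset_rfl).set_aux (.inr rfl) hτ).set_aux
        (.inl rfl) hσ.1) PathAssignment.set_map_self hσ
    · exact iht (((hΓ.mono Set.subset_union_right subset_rfl).set_aux (.inr rfl) hτ).set_aux
        (.inl rfl) hσ.1) PathAssignment.set_map_self hσ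
  | mul s t ihs iht =>
    refine holds_operation (mul := true) hΓ.rcnt h0 hρ hι (fun τ hτ n σ hσ => ?_)
      fun τ hτ n σ hσ => ?_
    · exact ihs (((hΓ.mono Set.subset_union_left subset_rfl).set_aux (.inr rfl) hτ).set_aux
        (.inl rfl) hσ.1) PathAssignment.set_map_self hσ
    · exact iht (((hΓ.mono Set.subset_union_right subset_rfl).set_aux (.inr rfl) hτ).set_aux
        (.inl rfl) hσ.1) PathAssignment.set_map_self hσ

theorem holds_numEx_eq (hι : Arithmetical ι S) (hΓ : Γ.rcnt = S.init) {φ : HyperCTL AP}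
    {v : PathVar} {P : ℕ → Prop}
    (h : ∀ n (ρ : S.Path), ρ.Encodes ι {n} → (φ.Holds S (Γ.set v ρ) ↔ P n)) :
    (numEx ι v φ).Holds S Γ ↔ ∃ n, P n := by
  rw [holds_numEx ι hΓ]
  constructor
  · rintro ⟨n, ρ, hρ, h'⟩
    exact ⟨n, (h n ρ hρ).1 h'⟩
  · rintro ⟨n, h'⟩
    obtain ⟨ρ, hρ⟩ := hι.exists_path {n}
    exact ⟨n, ρ, hρ, (h n ρ hρ).2 h'⟩

theorem SOArith.holds_toCTL (hι : Arithmetical ι S) (φ : SOArith)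
    (hΓ : Interprets ι Γ e E φ.freeNumVars φ.freeSetVars) :
    (φ.toCTL ι).Holds S Γ ↔ φ.Holds e E := by
  induction φ generalizing Γ e E with
  | eq s t =>
    rw [toCTL, holds_numEx_eq hι hΓ.rcnt (P := fun n => s.val e = n ∧ t.val e = n)]
    · simp [Holds, eq_comm]
    · intro n ρ hρ
      have := hΓ.set_aux (.inl rfl) hρ.1
      rw [holds_and, s.holds_toCTL hι (this.mono Set.subset_union_left subset_rfl)
        PathAssignment.set_map_self hρ, t.holds_toCTL hι
        (this.mono Set.subset_union_right subset_rfl) PathAssignment.set_map_self hρ]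
  | lt s t =>
    -- The second number `m` sits on path `1`, but term formulas speak about path `0`; `k` is its
    -- copy there.
    rw [toCTL, less, holds_numEx_eq hι hΓ.rcnt
      (P := fun n => s.val e = n ∧ ∃ m, n < m ∧ ∃ k, m = k ∧ t.val e = k)]
    · simp [Holds]
    · intro n ρ hρ
      have h1 := hΓ.set_aux (.inl rfl) hρ.1
      rw [holds_and, s.holds_toCTL hι (h1.mono Set.subset_union_left subset_rfl)
        PathAssignment.set_map_self hρ]
      refine and_congr_right fun _ => holds_numEx_eq hι h1.rcnt fun m σ hσ => ?_
      have h2 := h1.set_aux (.inr rfl) hσ.1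
      have e0 : ((Γ.set 0 ρ).set 1 σ).map 0 = some ρ :=
        (PathAssignment.set_map_of_ne (show (0 : ℕ) ≠ 1 by simp)).trans
          PathAssignment.set_map_self
      rw [holds_and]
      refine and_congr ?_ (holds_numEx_eq hι h2.rcnt fun k τ hτ => ?_)
      · simp only [holds_next, holds_eventually, holds_and, holds_bit ι e0 hρ,
          holds_bit_drop_drop ι PathAssignment.set_map_self hσ, Set.mem_singleton_iff,
          exists_eq_left]
        exact ⟨fun ⟨j, hj⟩ => by omega, fun h => ⟨m - n - 1, by omega⟩⟩
      · have h3 := h2.set_aux (.inl rfl) hτ.1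
        have e1 : (((Γ.set 0 ρ).set 1 σ).set 0 τ).map 1 = some σ :=
          (PathAssignment.set_map_of_ne (show (1 : ℕ) ≠ 0 by simp)).trans
            PathAssignment.set_map_self
        rw [holds_and, t.holds_toCTL hι (h3.mono Set.subset_union_right subset_rfl)
          PathAssignment.set_map_self hτ, holds_meet ι PathAssignment.set_map_self e1 hτ hσ]
        simp [eq_comm]
  | mem s X =>
    rw [toCTL, holds_numEx_eq hι hΓ.rcnt (P := fun n => n ∈ E X ∧ s.val e = n)]
    · simp [Holds]
    · intro n ρ hρ
      have h1 := hΓ.set_aux (.inl rfl) hρ.1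
      obtain ⟨σ, hσ, hσX⟩ := h1.set X rfl
      rw [holds_and, s.holds_toCTL hι h1 PathAssignment.set_map_self hρ,
        holds_meet ι PathAssignment.set_map_self hσ hρ hσX]
      simp
  | neg φ ih =>
    rw [toCTL, holds_neg, ih hΓ]
    rfl
  | or φ₁ φ₂ ih₁ ih₂ =>
    rw [toCTL, holds_or, ih₁ (hΓ.mono Set.subset_union_left Set.subset_union_left),
      ih₂ (hΓ.mono Set.subset_union_right Set.subset_union_right)]
    rfl
  | exNum y φ ih => exact holds_numEx_eq hι hΓ.rcnt fun n ρ hρ => ih (hΓ.set_num hρ)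
  | allNum y φ ih =>
    rw [toCTL, holds_numAll ι hΓ.rcnt]
    refine forall_congr' fun n => ⟨fun h => ?_, fun h ρ hρ => (ih (hΓ.set_num hρ)).2 h⟩
    obtain ⟨ρ, hρ⟩ := hι.exists_path {n}
    exact (ih (hΓ.set_num hρ)).1 (h ρ hρ)
  | exSet X φ ih =>
    rw [toCTL, holds_setEx ι hΓ.rcnt]
    refine exists_congr fun A => ⟨fun ⟨ρ, hρ, h⟩ => (ih (hΓ.set_set hρ)).1 h, fun h => ?_⟩
    obtain ⟨ρ, hρ⟩ := hι.exists_path A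
    exact ⟨ρ, hρ, (ih (hΓ.set_set hρ)).2 h⟩
  | allSet X φ ih =>
    rw [toCTL, holds_setAll ι hΓ.rcnt]
    refine forall_congr' fun A => ⟨fun h => ?_, fun h ρ hρ => (ih (hΓ.set_set hρ)).2 h⟩
    obtain ⟨ρ, hρ⟩ := hι.exists_path A
    exact (ih (hΓ.set_set hρ)).1 (h ρ hρ)

theorem holds_allSets (hΓ : Γ.rcnt = S.init) : (allSets ι).Holds S Γ ↔
    (∃ ρ : S.Path, ρ.at 0 = S.init ∧ ι (.inr true) ∉ S.label (ρ.at 1) ∧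
      ι (.inr false) ∈ S.label (ρ.at 1)) ∧
    (∃ ρ : S.Path, ρ.at 0 = S.init ∧ ι (.inr true) ∉ S.label (ρ.at 1) ∧
      ι (.inr false) ∉ S.label (ρ.at 1)) ∧
    ∀ ρ : S.Path, ρ.at 0 = S.init → ι (.inr true) ∉ S.label (ρ.at 1) → ∀ j,
      (∃ σ : S.Path, σ.at 0 = ρ.at (1 + j) ∧ ι (.inr false) ∈ S.label (σ.at 1)) ∧
      (∃ σ : S.Path, σ.at 0 = ρ.at (1 + j) ∧ ι (.inr false) ∉ S.label (σ.at 1)) := by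
  have hat : ∀ {Γ : PathAssignment S} {v : PathVar} {ρ : S.Path} (a : AP) (j : ℕ),
      (atom a v).Holds S ((Γ.set v ρ).drop j) ↔ a ∈ S.label (ρ.at j) := by
    intro Γ v ρ a j
    rw [holds_atom (PathAssignment.drop_map PathAssignment.set_map_self j)]
    simp
  have hrcnt : ∀ {Γ : PathAssignment S} {v : PathVar} {ρ : S.Path} (j k : ℕ),
      (((Γ.set v ρ).drop j).drop k).rcnt = ρ.at (j + k) := by
    intro Γ v ρ j k
    rw [PathAssignment.drop_set, PathAssignment.drop_set, PathAssignment.rcnt_set]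
    simp
  simp only [allSets, holds_and, holds_ex, holds_all, holds_imp, isSet, bit, holds_next, holds_neg,
    holds_globally, hat, hrcnt, hΓ]

/-- The condition is given for paths from the initial vertex only. It is turned into a property
`good` of vertices that holds after the first step and passes to successors; a path with prescribed
bits is then built by choosing a suitable successor at each step. -/
theorem exists_encodes_of_allSets (hΓ : Γ.rcnt = S.init) (h : (allSets ι).Holds S Γ) (A : Set ℕ) :
    ∃ ρ : S.Path, ρ.Encodes ι A := by
  rw [holds_allSets hΓ] at h
  obtain ⟨⟨ρ₁, h₁, h₁op, h₁b⟩, ⟨ρ₂, h₂, h₂op, h₂b⟩, hall⟩ := h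
  let good : V → Prop := fun u => ∀ σ : S.Path, σ.at 0 = u → ∀ j,
    (∃ w, S.edge (σ.at j) w ∧ ι (.inr false) ∈ S.label w) ∧
    (∃ w, S.edge (σ.at j) w ∧ ι (.inr false) ∉ S.label w)
  have good_one : ∀ ρ : S.Path, ρ.at 0 = S.init → ι (.inr true) ∉ S.label (ρ.at 1) →
      good (ρ.at 1) := by
    intro ρ h0 hop σ hσ j
    have hσ' : S.edge S.init (σ.at 0) := by
      rw [hσ, ← h0]
      exact ρ.edge_at 0
    -- Prepending the initial vertex turns a path from the second vertex into one to which the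
    -- hypothesis applies.
    obtain ⟨⟨τ, h1, h2⟩, τ', h1', h2'⟩ := hall (.cons S.init σ hσ') rfl (by simpa [hσ] using hop) j
    rw [add_comm, TransitionSystem.Path.cons_at_succ] at h1 h1'
    exact ⟨⟨_, h1 ▸ τ.edge_at 0, h2⟩, ⟨_, h1' ▸ τ'.edge_at 0, h2'⟩⟩
  have good_step : ∀ (n : ℕ) (v : V), good v →
      ∃ w, S.edge v w ∧ good w ∧ (ι (.inr false) ∈ S.label w ↔ n + 1 ∈ A) := by
    intro n v hv
    have hgood : ∀ w, S.edge v w → good w := by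
      intro w hw σ hσ j
      exact hv (.cons v σ (hσ ▸ hw)) rfl (j + 1)
    obtain ⟨σ, rfl⟩ := S.exists_path v
    obtain ⟨⟨w, hw, h⟩, w', hw', h'⟩ := hv σ rfl 0
    by_cases hA : n + 1 ∈ A
    · exact ⟨w, hw, hgood w hw, by simp [hA, h]⟩
    · exact ⟨w', hw', hgood w' hw', by simp [hA, h']⟩
  have start : ∃ ρ : S.Path, ρ.at 0 = S.init ∧ ι (.inr true) ∉ S.label (ρ.at 1) ∧
      (ι (.inr false) ∈ S.label (ρ.at 1) ↔ 0 ∈ A) := by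
    by_cases hA : 0 ∈ A
    · exact ⟨ρ₁, h₁, h₁op, by simp [hA, h₁b]⟩
    · exact ⟨ρ₂, h₂, h₂op, by simp [hA, h₂b]⟩
  obtain ⟨ρ, h0, hop, hb⟩ := start
  obtain ⟨σ, hσ, -, hσA⟩ := S.exists_path_of_step good_step (good_one ρ h0 hop)
  refine ⟨.cons S.init σ (by rw [hσ, ← h0]; exact ρ.edge_at 0), rfl, by simpa [hσ] using hop, ?_⟩
  intro n
  cases n with
  | zero => simpa [hσ] using hb
  | succ n => exact hσA n

theorem SOArith.isModel_reduction_iff {φ : SOArith} (hφ : φ.IsSentence) (e : ℕ → ℕ)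
    (E : ℕ → Set ℕ) : (φ.reduction ι).IsModel S ↔
      (∃ ρ : S.Path, ρ.at 0 = S.init ∧ (allSets ι).Holds S ((PathAssignment.empty S).set 0 ρ)) ∧
      S.markedTraces ι = Trace.closure opTraces ∧ φ.Holds e E := by
  have key : ∀ ρ : S.Path, ρ.at 0 = S.init →
      (allSets ι).Holds S ((PathAssignment.empty S).set 0 ρ) →
      S.markedTraces ι = Trace.closure opTraces →
      ((φ.toCTL ι).Holds S ((PathAssignment.empty S).set 0 ρ) ↔ φ.Holds e E) := by
    intro ρ h0 hall hm
    have hr : ((PathAssignment.empty S).set 0 ρ).rcnt = S.init := by simpa using h0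
    refine SOArith.holds_toCTL ⟨exists_encodes_of_allSets hr hall, hm⟩ φ ⟨hr, ?_, ?_⟩
    · simp [hφ.1]
    · simp [hφ.2]
  have hop : ∀ ρ : S.Path, ρ.at 0 = S.init →
      ((OpFormula.sentence.toCTL ι).Holds S ((PathAssignment.empty S).set 0 ρ) ↔
        S.markedTraces ι = Trace.closure opTraces) := by
    intro ρ h0
    rw [HyperLTL.holds_toCTL ι _ (by simpa using h0), ← OpFormula.isModel_iff, HyperLTL.IsModel,
      PathAssignment.drop_set, PathAssignment.arithTraces_set]
    -- The sentence begins by quantifying variable `0`, which overwrites the path chosen by the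
    -- outer quantifier of the reduction.
    refine exists_congr fun t => and_congr_right fun _ => ?_
    simp only [TraceAssignment.set, Function.update_idem]
    rfl
  simp only [IsModel, SOArith.reduction, holds_ex, holds_and, PathAssignment.rcnt_empty]
  constructor
  · rintro ⟨ρ, h0, h1, h2, h3⟩
    have h1 := (hop ρ h0).1 h1
    exact ⟨⟨ρ, h0, h2⟩, h1, (key ρ h0 h2 h1).1 h3⟩
  · rintro ⟨⟨ρ, h0, h2⟩, h1, h3⟩
    exact ⟨ρ, h0, (hop ρ h0).2 h1, h2, (key ρ h0 h2 h1).2 h3⟩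

end

/-! ### A countable, bounded-branching system for arithmetic -/

section

variable {AP : Type} (ι : ArithProp ⊕ Bool → AP)

/-- The prefix tree of the closure of the operation traces, together with two vertices from which
all sets of numbers can be generated. -/
def arithSystem : TransitionSystem AP (Trace.prefsOf (Trace.closure opTraces) ⊕ Bool) where
  edge
    | .inl w, .inl w' => (Trace.prefixTree _ closure_opTraces_nonempty).edge w w'
    -- Only the root leads to the set generators, so a path whose second vertex lies in the tree
    -- remains in the tree.
    | .inl w, .inr _ => w.1 = []
    | .inr _, .inl _ => False
    | .inr _, .inr _ => True
  init := .inl (Trace.prefixTree _ closure_opTraces_nonempty).init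
  label
    | .inl w => insert (ι (.inr true))
        ((fun p => ι (.inl p)) '' (Trace.prefixTree _ closure_opTraces_nonempty).label w)
    | .inr b => {a | b = true ∧ a = ι (.inr false)}
  total
    | .inl w => by
      obtain ⟨w', h⟩ := (Trace.prefixTree _ closure_opTraces_nonempty).total w
      exact ⟨.inl w', h⟩
    | .inr b => ⟨.inr b, trivial⟩

theorem arithSystem_boundedBranching : (arithSystem ι).BoundedBranching := by
  refine ⟨Nat.card (Set ArithProp) + 2, fun v => ?_⟩
  have h2 : (Set.range (Sum.inr : Bool → Trace.prefsOf (Trace.closure opTraces) ⊕ Bool)).encard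
      ≤ 2 := by
    rw [← Set.image_univ]
    refine (Set.encard_image_le _ _).trans ?_
    rw [Set.encard_univ, ENat.card_eq_coe_natCard, Nat.card_eq_fintype_card, Fintype.card_bool]
    rfl
  cases v with
  | inl w =>
    refine (Set.encard_le_encard (t := Sum.inl ''
      {w' | (Trace.prefixTree _ closure_opTraces_nonempty).edge w w'} ∪ Set.range Sum.inr)
      ?_).trans ((Set.encard_union_le _ _).trans ?_)
    · rintro (w' | b) h
      · exact .inl ⟨w', h, rfl⟩
      · exact .inr ⟨b, rfl⟩
    · push_cast
      refine add_le_add ?_ h2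
      rw [← ENat.card_eq_coe_natCard]
      exact (Set.encard_image_le _ _).trans (Trace.prefixTree_succ_encard_le _ _)
  | inr b =>
    refine (Set.encard_le_encard (t := Set.range Sum.inr) ?_).trans (h2.trans ?_)
    · rintro (w' | b') h
      · exact h.elim
      · exact ⟨b', rfl⟩
    · push_cast
      exact le_add_self

theorem TransitionSystem.BoundedBranching.finitelyBranching {V : Type} {S : TransitionSystem AP V}
    (h : S.BoundedBranching) : S.FinitelyBranching := by
  obtain ⟨k, hk⟩ := h
  exact fun v => Set.encard_lt_top_iff.1 ((hk v).trans_lt (ENat.natCast_lt_top k))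

variable {ι}

theorem marked_arithSystem_iff (hι : Function.Injective ι)
    {v : Trace.prefsOf (Trace.closure opTraces) ⊕ Bool} :
    ι (.inr true) ∈ (arithSystem ι).label v ↔ ∃ w, v = .inl w := by
  cases v <;> simp [arithSystem, hι.eq_iff]

/-- Exactly the tree vertices carry the marker. A path from the root whose second vertex is marked
can never leave the tree, hence the marked traces are those of the prefix tree, and the closure is
already closed. -/
theorem arithSystem_markedTraces (hι : Function.Injective ι) :
    (arithSystem ι).markedTraces ι = Trace.closure opTraces := by
  refine Eq.trans ?_ ((Trace.prefixTree_tracesFromSuccessors closure_opTraces_nonempty).trans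
    (Trace.closure_closure opTraces))
  have hl : ∀ w p, ι (.inl p) ∈ (arithSystem ι).label (.inl w) ↔
      p ∈ (Trace.prefixTree _ closure_opTraces_nonempty).label w := by
    intro w p
    simp [arithSystem, hι.eq_iff]
  ext t
  constructor
  · rintro ⟨ρ, h0, h1, rfl⟩
    rw [marked_arithSystem_iff hι] at h1
    -- The word being non-empty is the invariant that rules out edges into the other component.
    have key : ∀ n, ∃ w, ρ.at (n + 1) = .inl w ∧ w.1 ≠ [] := by
      intro n
      have e := ρ.edge_at n
      induction n with
      | zero =>
        obtain ⟨w, hw⟩ := h1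
        refine ⟨w, hw, ?_⟩
        rw [hw, h0] at e
        obtain ⟨a, ha⟩ := e
        simp [ha]
      | succ n ih =>
        obtain ⟨w, hw, hne⟩ := ih (ρ.edge_at n)
        rw [hw] at e
        cases hv : ρ.at (n + 1 + 1) with
        | inl w' =>
          rw [hv] at e
          obtain ⟨a, ha⟩ := e
          exact ⟨w', rfl, by simp [ha]⟩
        | inr b =>
          rw [hv] at e
          exact absurd e hne
    choose w hw _ using key
    have edge : ∀ n, (Trace.prefixTree _ closure_opTraces_nonempty).edge (w n) (w (n + 1)) := by
      intro n
      have e := ρ.edge_at (n + 1)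
      rw [hw, hw] at e
      exact e
    refine ⟨⟨w, edge⟩, ?_, ?_⟩
    · have e := ρ.edge_at 0
      rw [hw, h0] at e
      exact e
    · funext n
      ext p
      rw [TransitionSystem.Path.arithTrace, Set.mem_ofPred_eq, TransitionSystem.Path.at_drop,
        add_comm, hw, hl]
      rfl
  · rintro ⟨ρ, h0, rfl⟩
    refine ⟨.cons (arithSystem ι).init ⟨fun n => .inl (ρ.at n), fun n => ρ.edge_at n⟩ h0, rfl,
      (marked_arithSystem_iff hι).2 ⟨_, rfl⟩, ?_⟩
    funext n
    ext p
    rw [TransitionSystem.Path.arithTrace, Set.mem_ofPred_eq, TransitionSystem.Path.at_drop,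
      add_comm]
    exact hl _ _

theorem arithSystem_holds_allSets (hι : Function.Injective ι)
    {Γ : PathAssignment (arithSystem ι)}
    (hΓ : Γ.rcnt = (arithSystem ι).init) : (HyperCTL.allSets ι).Holds (arithSystem ι) Γ := by
  rw [holds_allSets hΓ]
  have hl : ∀ b, ι (.inr false) ∈ (arithSystem ι).label (.inr b) ↔ b = true := by
    intro b
    simp [arithSystem]
  have hstart : ∀ b, ∃ ρ : (arithSystem ι).Path, ρ.at 0 = (arithSystem ι).init ∧ ρ.at 1 = .inr b :=
    fun b => TransitionSystem.exists_path_edge rfl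
  have hstep : ∀ b b', ∃ ρ : (arithSystem ι).Path, ρ.at 0 = .inr b ∧ ρ.at 1 = .inr b' :=
    fun b b' => TransitionSystem.exists_path_edge trivial
  refine ⟨?_, ?_, fun ρ h0 h1 j => ?_⟩
  · obtain ⟨ρ, h0, h1⟩ := hstart true
    exact ⟨ρ, h0, by rw [h1, marked_arithSystem_iff hι]; simp, by rw [h1, hl]⟩
  · obtain ⟨ρ, h0, h1⟩ := hstart false
    exact ⟨ρ, h0, by rw [h1, marked_arithSystem_iff hι]; simp, by rw [h1, hl]; simp⟩
  · have key : ∃ b, ρ.at (1 + j) = .inr b := by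
      induction j with
      | zero =>
        cases h : ρ.at 1 with
        | inl w => exact absurd ((marked_arithSystem_iff hι).2 ⟨w, h⟩) h1
        | inr b => exact ⟨b, rfl⟩
      | succ j ih =>
        obtain ⟨b, hb⟩ := ih
        have e := ρ.edge_at (1 + j)
        rw [hb] at e
        cases h : ρ.at (1 + j + 1) with
        | inl w => rw [h] at e; exact e.elim
        | inr b => exact ⟨b, rfl⟩
    obtain ⟨b, hb⟩ := key
    rw [hb]
    constructor
    · obtain ⟨σ, h0, h1⟩ := hstep b true
      exact ⟨σ, h0, by rw [h1, hl]⟩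
    · obtain ⟨σ, h0, h1⟩ := hstep b false
      exact ⟨σ, h0, by rw [h1, hl]; simp⟩

theorem SOArith.arithSystem_isModel_reduction (hι : Function.Injective ι) {φ : SOArith}
    (hφ : φ.IsSentence) {e : ℕ → ℕ} {E : ℕ → Set ℕ} (h : φ.Holds e E) : (φ.reduction ι).IsModel (arithSystem ι) := by
  refine (isModel_reduction_iff hφ e E).2 ⟨?_, arithSystem_markedTraces hι, h⟩
  obtain ⟨ρ, hρ⟩ := (arithSystem ι).exists_path (arithSystem ι).init
  exact ⟨ρ, hρ, arithSystem_holds_allSets hι (by simpa using hρ)⟩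

end

/-! ### Computability of the reduction from second-order arithmetic -/

section

variable {α : Type} [Primcodable α] {f g h v : α → ℕ}

theorem Primrec.natPair (hf : Primrec f) (hg : Primrec g) : Primrec fun a => Nat.pair (f a) (g a) :=
  Primrec₂.natPair.comp hf hg

theorem Primrec.fst_unpair (hf : Primrec f) : Primrec fun a => (f a).unpair.1 :=
  Primrec.fst.comp (Primrec.unpair.comp hf)

theorem Primrec.snd_unpair (hf : Primrec f) : Primrec fun a => (f a).unpair.2 :=
  Primrec.snd.comp (Primrec.unpair.comp hf)

theorem Primrec.tag {σ : Type} [Primcodable σ] {p q : α → σ} (hf : Primrec f) (k : ℕ)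
    (hp : Primrec p) (hq : Primrec q) : Primrec fun a => if f a = k then p a else q a :=
  Primrec.ite (Primrec.eq.comp hf (Primrec.const k)) hp hq

theorem Primrec.linear (hf : Primrec f) (k l : ℕ) : Primrec fun a => k * f a + l :=
  Primrec.nat_add.comp (Primrec.nat_mul.comp (Primrec.const k) hf) (Primrec.const l)

end

/-- The code of `G p x y` is a primitive recursive function of `p` and of the codes of `x`, `y`. -/
def UniformCode {X : Type} (code : X → ℕ) (G : ℕ → X → X → X) : Prop :=
  ∃ F : ℕ × ℕ × ℕ → ℕ, Primrec F ∧ ∀ p x y, code (G p x y) = F (p, code x, code y)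

namespace UniformCode

variable {X : Type} {code : X → ℕ}

theorem left : UniformCode code fun _ x _ => x :=
  ⟨fun q => q.2.1, Primrec.fst.comp Primrec.snd, fun _ _ _ => rfl⟩

theorem right : UniformCode code fun _ _ y => y :=
  ⟨fun q => q.2.2, Primrec.snd.comp Primrec.snd, fun _ _ _ => rfl⟩

/-- In a template `G p x y` the parameter `p` supplies variable indices, and `x`, `y` stand for the
translated subformulas. Closure under the constructors gives each clause of a translation a
primitive recursive handler on codes. -/
theorem unary {G : ℕ → X → X → X} (h : UniformCode code G) {f : X → X} (k : ℕ)
    (hf : ∀ x, code (f x) = Nat.pair k (code x)) : UniformCode code fun p x y => f (G p x y) := by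
  obtain ⟨F, hF, h⟩ := h
  exact ⟨_, (Primrec.const k).natPair hF, fun p x y => by rw [hf, h]⟩

theorem binary {G G' : ℕ → X → X → X} (h : UniformCode code G) (h' : UniformCode code G')
    {f : X → X → X} (k : ℕ) (hf : ∀ x y, code (f x y) = Nat.pair k (Nat.pair (code x) (code y))) :
    UniformCode code fun p x y => f (G p x y) (G' p x y) := by
  obtain ⟨F, hF, h⟩ := h
  obtain ⟨F', hF', h'⟩ := h'
  exact ⟨_, (Primrec.const k).natPair (hF.natPair hF'), fun p x y => by rw [hf, h, h']⟩

theorem binder {G : ℕ → X → X → X} (h : UniformCode code G) {v : ℕ → ℕ} (hv : Primrec v)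
    {f : ℕ → X → X} (k : ℕ) (hf : ∀ v x, code (f v x) = Nat.pair k (Nat.pair v (code x))) :
    UniformCode code fun p x y => f (v p) (G p x y) := by
  obtain ⟨F, hF, h⟩ := h
  exact ⟨_, (Primrec.const k).natPair ((hv.comp Primrec.fst).natPair hF),
    fun p x y => by rw [hf, h]⟩

theorem leaf {x : ℕ → X} (hx : Primrec fun p => code (x p)) : UniformCode code fun p _ _ => x p :=
  ⟨fun q => code (x q.1), hx.comp Primrec.fst, fun _ _ _ => rfl⟩

end UniformCode

section

variable {AP : Type} [Encodable AP] {G G' : ℕ → HyperCTL AP → HyperCTL AP → HyperCTL AP} {v : ℕ → ℕ}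

namespace HyperCTL

theorem uniformCode_atom (a : AP) (hv : Primrec v) :
    UniformCode (code (AP := AP)) fun p _ _ => atom a (v p) :=
  .leaf ((Primrec.const 0).natPair ((Primrec.const _).natPair hv))

theorem uniformCode_neg (h : UniformCode code G) : UniformCode code fun p x y => neg (G p x y) :=
  h.unary 1 fun _ => rfl

theorem uniformCode_or (h : UniformCode code G) (h' : UniformCode code G') :
    UniformCode code fun p x y => or (G p x y) (G' p x y) := h.binary h' 2 fun _ _ => rfl

theorem uniformCode_next (h : UniformCode code G) : UniformCode code fun p x y => next (G p x y) :=
  h.unary 3 fun _ => rfl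

theorem uniformCode_until (h : UniformCode code G) (h' : UniformCode code G') :
    UniformCode code fun p x y => HyperCTL.until (G p x y) (G' p x y) :=
  h.binary h' 4 fun _ _ => rfl

theorem uniformCode_ex (hv : Primrec v) (h : UniformCode code G) :
    UniformCode code fun p x y => ex (v p) (G p x y) := h.binder hv 5 fun _ _ => rfl

theorem uniformCode_all (hv : Primrec v) (h : UniformCode code G) :
    UniformCode code fun p x y => all (v p) (G p x y) := h.binder hv 6 fun _ _ => rfl

theorem uniformCode_and (h : UniformCode code G) (h' : UniformCode code G') :
    UniformCode code fun p x y => and (G p x y) (G' p x y) :=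
  uniformCode_neg (uniformCode_or (uniformCode_neg h) (uniformCode_neg h'))

theorem uniformCode_imp (h : UniformCode code G) (h' : UniformCode code G') :
    UniformCode code fun p x y => imp (G p x y) (G' p x y) :=
  uniformCode_or (uniformCode_neg h) h'

theorem uniformCode_eventually (h : UniformCode code G) :
    UniformCode code fun p x y => eventually (G p x y) :=
  uniformCode_until (uniformCode_or h (uniformCode_neg h)) h

theorem uniformCode_globally (h : UniformCode code G) :
    UniformCode code fun p x y => globally (G p x y) :=
  uniformCode_neg (uniformCode_eventually (uniformCode_neg h))

variable (ι : ArithProp ⊕ Bool → AP)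

theorem uniformCode_bit (hv : Primrec v) : UniformCode code fun p _ _ => bit ι (v p) :=
  uniformCode_atom _ hv

theorem uniformCode_isSet (hv : Primrec v) : UniformCode code fun p _ _ => isSet ι (v p) :=
  uniformCode_next (uniformCode_neg (uniformCode_atom _ hv))

theorem uniformCode_isNum (hv : Primrec v) : UniformCode code fun p _ _ => isNum ι (v p) :=
  have hb := uniformCode_bit ι hv
  uniformCode_and (uniformCode_isSet ι hv) (uniformCode_next (uniformCode_until
    (uniformCode_neg hb) (uniformCode_and hb (uniformCode_next (uniformCode_globally
      (uniformCode_neg hb))))))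

theorem uniformCode_meet (k : ℕ) (hv : Primrec v) :
    UniformCode code fun p _ _ => meet ι k (v p) :=
  uniformCode_next (uniformCode_eventually (uniformCode_and
    (uniformCode_bit ι (Primrec.const k)) (uniformCode_bit ι hv)))

theorem uniformCode_numEx (hv : Primrec v) (h : UniformCode code G) :
    UniformCode code fun p x y => numEx ι (v p) (G p x y) :=
  uniformCode_ex hv (uniformCode_and (uniformCode_isNum ι hv) h)

theorem uniformCode_numAll (hv : Primrec v) (h : UniformCode code G) :
    UniformCode code fun p x y => numAll ι (v p) (G p x y) :=
  uniformCode_all hv (uniformCode_imp (uniformCode_isNum ι hv) h)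

theorem uniformCode_setEx (hv : Primrec v) (h : UniformCode code G) :
    UniformCode code fun p x y => setEx ι (v p) (G p x y) :=
  uniformCode_ex hv (uniformCode_and (uniformCode_isSet ι hv) h)

theorem uniformCode_setAll (hv : Primrec v) (h : UniformCode code G) :
    UniformCode code fun p x y => setAll ι (v p) (G p x y) :=
  uniformCode_all hv (uniformCode_imp (uniformCode_isSet ι hv) h)

theorem uniformCode_operand (q : ArithProp) (h : UniformCode code G) :
    UniformCode code fun p x y => operand ι q (G p x y) :=
  uniformCode_numEx ι (Primrec.const 0) (uniformCode_and (uniformCode_next (uniformCode_eventually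
    (uniformCode_and (uniformCode_atom _ (Primrec.const 1)) (uniformCode_bit ι (Primrec.const 0)))))
    h)

theorem uniformCode_operation (q : ArithProp) (h : UniformCode code G) (h' : UniformCode code G') :
    UniformCode code fun p x y => operation ι q (G p x y) (G' p x y) :=
  have hm := fun q => uniformCode_atom (ι q) (Primrec.const (α := ℕ) 1)
  uniformCode_ex (Primrec.const 1) (uniformCode_and (uniformCode_next (uniformCode_and
    (hm _) (hm _))) (uniformCode_and (uniformCode_next (uniformCode_eventually (uniformCode_and
      (hm _) (uniformCode_bit ι (Primrec.const 0))))) (uniformCode_and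
        (uniformCode_operand ι _ h) (uniformCode_operand ι _ h'))))

theorem uniformCode_less (h : UniformCode code G) (h' : UniformCode code G') :
    UniformCode code fun p x y => less ι (G p x y) (G' p x y) :=
  uniformCode_numEx ι (Primrec.const 0) (uniformCode_and h (uniformCode_numEx ι (Primrec.const 1)
    (uniformCode_and (uniformCode_next (uniformCode_eventually (uniformCode_and
      (uniformCode_bit ι (Primrec.const 0)) (uniformCode_next (uniformCode_eventually
        (uniformCode_bit ι (Primrec.const 1))))))) (uniformCode_numEx ι (Primrec.const 0)
          (uniformCode_and (uniformCode_meet ι 0 (Primrec.const 1)) h')))))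

end HyperCTL

open HyperCTL

variable (ι : ArithProp ⊕ Bool → AP)

theorem ArithTerm.exists_primrec_toCTL :
    ∃ T : ℕ → ℕ, Primrec T ∧ ∀ s : ArithTerm, (s.toCTL ι).code = T s.code := by
  obtain ⟨Fv, hFv, hv⟩ := uniformCode_meet ι 0 (Primrec.id.linear 2 2)
  obtain ⟨Fa, hFa, ha⟩ := uniformCode_operation ι .add .left .right
  obtain ⟨Fm, hFm, hm⟩ := uniformCode_operation ι .mult .left .right
  let H : Unit → ℕ × ℕ × ℕ × ℕ × ℕ → ℕ := fun _ q =>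
    -- The template for variables does not depend on its subformula arguments; some code is needed
    -- to fill their places.
    if q.1 = 0 then Fv (q.2.1, (ArithTerm.zero.toCTL ι).code, (ArithTerm.zero.toCTL ι).code) else
    if q.1 = 1 then (ArithTerm.zero.toCTL ι).code else
    if q.1 = 2 then (ArithTerm.one.toCTL ι).code else
    if q.1 = 3 then Fa (0, q.2.2.2) else Fm (0, q.2.2.2)
  have p1 : Primrec fun q : Unit × ℕ × ℕ × ℕ × ℕ × ℕ => q.2.1 := Primrec.fst.comp Primrec.snd
  have p2 : Primrec fun q : Unit × ℕ × ℕ × ℕ × ℕ × ℕ => q.2.2.1 :=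
    Primrec.fst.comp (Primrec.snd.comp Primrec.snd)
  have p3 : Primrec fun q : Unit × ℕ × ℕ × ℕ × ℕ × ℕ => q.2.2.2.2 :=
    Primrec.snd.comp (Primrec.snd.comp (Primrec.snd.comp Primrec.snd))
  have hH : Primrec₂ H :=
    p1.tag 0 (hFv.comp (p2.pair (Primrec.const _))) <| p1.tag 1 (Primrec.const _) <|
      p1.tag 2 (Primrec.const _) <|
      p1.tag 3 (hFa.comp ((Primrec.const 0).pair p3)) (hFm.comp ((Primrec.const 0).pair p3))
  refine ⟨codeFold H (), (Primrec.codeFold H hH).comp (Primrec.const ()) Primrec.id, fun s => ?_⟩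
  induction s with
  | var y =>
    rw [code, codeFold_pair_zero _ _ (by simp [H])]
    exact hv y (ArithTerm.zero.toCTL ι) (ArithTerm.zero.toCTL ι)
  | zero => rw [code, codeFold_pair _ _ (by simp)]; simp [H]
  | one => rw [code, codeFold_pair _ _ (by simp)]; simp [H]
  | add s t ihs iht =>
    rw [code, codeFold_pair _ _ (by simp)]
    simp only [Nat.unpair_pair, ← ihs, ← iht]
    exact ha 0 (s.toCTL ι) (t.toCTL ι)
  | mul s t ihs iht =>
    rw [code, codeFold_pair _ _ (by simp)]
    simp only [Nat.unpair_pair, ← ihs, ← iht]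
    exact hm 0 (s.toCTL ι) (t.toCTL ι)

theorem SOArith.exists_primrec_toCTL :
    ∃ T : ℕ → ℕ, Primrec T ∧ ∀ φ : SOArith, (φ.toCTL ι).code = T φ.code := by
  obtain ⟨T, hT, ht⟩ := ArithTerm.exists_primrec_toCTL ι
  have lin := fun k => Primrec.id.linear 2 k
  obtain ⟨F0, p0, h0⟩ := uniformCode_numEx ι (Primrec.const 0) (uniformCode_and .left .right)
  obtain ⟨F1, p1, h1⟩ := uniformCode_less ι .left .right
  obtain ⟨F2, p2, h2⟩ := uniformCode_numEx ι (Primrec.const 0)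
    (uniformCode_and (uniformCode_meet ι 0 (lin 3)) .left)
  obtain ⟨F3, p3, h3⟩ := uniformCode_neg (AP := AP) .left
  obtain ⟨F4, p4, h4⟩ := uniformCode_or (AP := AP) .left .right
  obtain ⟨F5, p5, h5⟩ := uniformCode_numEx ι (lin 2) .right
  obtain ⟨F6, p6, h6⟩ := uniformCode_numAll ι (lin 2) .right
  obtain ⟨F7, p7, h7⟩ := uniformCode_setEx ι (lin 3) .right
  obtain ⟨F8, p8, h8⟩ := uniformCode_setAll ι (lin 3) .right
  let H : Unit → ℕ × ℕ × ℕ × ℕ × ℕ → ℕ := fun _ q =>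
    if q.1 = 0 then F0 (0, T q.2.1.unpair.1, T q.2.1.unpair.2) else
    if q.1 = 1 then F1 (0, T q.2.1.unpair.1, T q.2.1.unpair.2) else
    if q.1 = 2 then F2 (q.2.1.unpair.2, T q.2.1.unpair.1, T q.2.1.unpair.1) else
    if q.1 = 3 then F3 (0, q.2.2.1, q.2.2.1) else
    if q.1 = 4 then F4 (0, q.2.2.2) else
    if q.1 = 5 then F5 (q.2.1.unpair.1, q.2.2.2.2, q.2.2.2.2) else
    if q.1 = 6 then F6 (q.2.1.unpair.1, q.2.2.2.2, q.2.2.2.2) else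
    if q.1 = 7 then F7 (q.2.1.unpair.1, q.2.2.2.2, q.2.2.2.2) else
    F8 (q.2.1.unpair.1, q.2.2.2.2, q.2.2.2.2)
  have t : Primrec fun q : Unit × ℕ × ℕ × ℕ × ℕ × ℕ => q.2.1 := Primrec.fst.comp Primrec.snd
  have b : Primrec fun q : Unit × ℕ × ℕ × ℕ × ℕ × ℕ => q.2.2.1 :=
    Primrec.fst.comp (Primrec.snd.comp Primrec.snd)
  have x : Primrec fun q : Unit × ℕ × ℕ × ℕ × ℕ × ℕ => q.2.2.2.1 :=
    Primrec.fst.comp (Primrec.snd.comp (Primrec.snd.comp Primrec.snd))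
  have yz : Primrec fun q : Unit × ℕ × ℕ × ℕ × ℕ × ℕ => q.2.2.2.2 :=
    Primrec.snd.comp (Primrec.snd.comp (Primrec.snd.comp Primrec.snd))
  have z := Primrec.snd.comp yz
  have b1 := b.fst_unpair
  have b2 := b.snd_unpair
  have c0 := Primrec.const (α := Unit × ℕ × ℕ × ℕ × ℕ × ℕ) (0 : ℕ)
  have Tb := (hT.comp b1).pair (hT.comp b2)
  have hH : Primrec₂ H :=
    t.tag 0 (p0.comp (c0.pair Tb)) <| t.tag 1 (p1.comp (c0.pair Tb)) <|
    t.tag 2 (p2.comp (b2.pair ((hT.comp b1).pair (hT.comp b1)))) <|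
    t.tag 3 (p3.comp (c0.pair (x.pair x))) <| t.tag 4 (p4.comp (c0.pair yz)) <|
    t.tag 5 (p5.comp (b1.pair (z.pair z))) <| t.tag 6 (p6.comp (b1.pair (z.pair z))) <|
    t.tag 7 (p7.comp (b1.pair (z.pair z))) (p8.comp (b1.pair (z.pair z)))
  refine ⟨codeFold H (), (Primrec.codeFold H hH).comp (Primrec.const ()) Primrec.id, fun φ => ?_⟩
  induction φ with
  | eq r s =>
    rw [code, codeFold_pair_zero _ _ (by simp [H])]
    simpa [H, ← ht, toCTL] using h0 0 (r.toCTL ι) (s.toCTL ι)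
  | lt r s =>
    rw [code, codeFold_pair _ _ (by simp)]
    simpa [H, ← ht, toCTL] using h1 0 (r.toCTL ι) (s.toCTL ι)
  | mem s X =>
    rw [code, codeFold_pair _ _ (by simp)]
    simpa [H, ← ht, toCTL] using h2 X (s.toCTL ι) (s.toCTL ι)
  | neg φ ih =>
    rw [code, codeFold_pair _ _ (by simp)]
    simp only [← ih]
    exact h3 0 (φ.toCTL ι) (φ.toCTL ι)
  | or φ₁ φ₂ ih₁ ih₂ =>
    rw [code, codeFold_pair _ _ (by simp)]
    simp only [Nat.unpair_pair, ← ih₁, ← ih₂]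
    exact h4 0 (φ₁.toCTL ι) (φ₂.toCTL ι)
  | exNum y φ ih =>
    rw [code, codeFold_pair _ _ (by simp)]
    simp only [Nat.unpair_pair, ← ih]
    refine Eq.trans ?_ (h5 (Nat.pair y φ.code).unpair.1 (φ.toCTL ι) (φ.toCTL ι))
    simp only [Nat.unpair_pair]
    rfl
  | allNum y φ ih =>
    rw [code, codeFold_pair _ _ (by simp)]
    simp only [Nat.unpair_pair, ← ih]
    refine Eq.trans ?_ (h6 (Nat.pair y φ.code).unpair.1 (φ.toCTL ι) (φ.toCTL ι))
    simp only [Nat.unpair_pair]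
    rfl
  | exSet X φ ih =>
    rw [code, codeFold_pair _ _ (by simp)]
    simp only [Nat.unpair_pair, ← ih]
    refine Eq.trans ?_ (h7 (Nat.pair X φ.code).unpair.1 (φ.toCTL ι) (φ.toCTL ι))
    simp only [Nat.unpair_pair]
    rfl
  | allSet X φ ih =>
    rw [code, codeFold_pair _ _ (by simp)]
    simp only [Nat.unpair_pair, ← ih]
    refine Eq.trans ?_ (h8 (Nat.pair X φ.code).unpair.1 (φ.toCTL ι) (φ.toCTL ι))
    simp only [Nat.unpair_pair]
    rfl

end

/-! ### Recognizing codes of formulas -/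

section

theorem Primrec.and' {α : Type} [Primcodable α] {f g : α → Bool} (hf : Primrec f)
    (hg : Primrec g) : Primrec fun a => f a && g a := Primrec.and.comp hf hg

theorem Nat.exists_eq_pair (c : ℕ) : ∃ t b, c = Nat.pair t b := ⟨_, _, (Nat.pair_unpair c).symm⟩

/-- Numbers that code nothing must be recognized, since the reductions have to send them to negative
instances. The constants are coded with body `0`, and no other body is accepted for them. -/
theorem ArithTerm.exists_primrec_isCode :
    ∃ T : ℕ → Bool, Primrec T ∧ ∀ c, T c = true ↔ ∃ s : ArithTerm, s.code = c := by
  let H : Unit → ℕ × ℕ × Bool × Bool × Bool → Bool := fun _ q =>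
    if q.1 = 0 then true else if q.1 = 1 then decide (q.2.1 = 0) else
    if q.1 = 2 then decide (q.2.1 = 0) else
    if q.1 = 3 then q.2.2.2.1 && q.2.2.2.2 else if q.1 = 4 then q.2.2.2.1 && q.2.2.2.2 else false
  have t : Primrec fun q : Unit × ℕ × ℕ × Bool × Bool × Bool => q.2.1 :=
    Primrec.fst.comp Primrec.snd
  have b : Primrec fun q : Unit × ℕ × ℕ × Bool × Bool × Bool => q.2.2.1 :=
    Primrec.fst.comp (Primrec.snd.comp Primrec.snd)
  have yz : Primrec fun q : Unit × ℕ × ℕ × Bool × Bool × Bool => q.2.2.2.2 :=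
    Primrec.snd.comp (Primrec.snd.comp (Primrec.snd.comp Primrec.snd))
  have yz' := (Primrec.fst.comp yz).and' (Primrec.snd.comp yz)
  have b0 := (Primrec.eq.comp b (Primrec.const 0)).decide
  have hH : Primrec₂ H :=
    t.tag 0 (Primrec.const true) <| t.tag 1 b0 <| t.tag 2 b0 <| t.tag 3 yz' <| t.tag 4 yz' <|
      Primrec.const false
  obtain ⟨F, hF, h0, hp⟩ := exists_codeFold H hH (by simp [H])
  replace h0 := h0 ()
  replace hp := hp ()
  refine ⟨F (), hF.comp (Primrec.const ()) Primrec.id, fun c => ?_⟩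
  constructor
  · induction c using Nat.strong_induction_on with
    | _ c ih =>
      obtain ⟨t, b, rfl⟩ := Nat.exists_eq_pair c
      rcases Nat.eq_zero_or_pos t with rfl | ht
      · exact fun _ => ⟨.var b, rfl⟩
      · obtain ⟨l, r, rfl⟩ := Nat.exists_eq_pair b
        have hlr := Nat.lt_pair_of_pos (b := Nat.pair l r) ht
        have il := ih l ((Nat.left_le_pair l r).trans_lt hlr)
        have ir := ih r ((Nat.right_le_pair l r).trans_lt hlr)
        rw [hp _ _ ht]
        simp only [Nat.unpair_pair]
        match t with
        | 1 => exact fun h => ⟨.zero, by rw [show Nat.pair l r = 0 by simpa [H] using h]; rfl⟩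
        | 2 => exact fun h => ⟨.one, by rw [show Nat.pair l r = 0 by simpa [H] using h]; rfl⟩
        | 3 =>
          intro h
          simp [H] at h
          obtain ⟨s, rfl⟩ := il h.1
          obtain ⟨s', rfl⟩ := ir h.2
          exact ⟨.add s s', rfl⟩
        | 4 =>
          intro h
          simp [H] at h
          obtain ⟨s, rfl⟩ := il h.1
          obtain ⟨s', rfl⟩ := ir h.2
          exact ⟨.mul s s', rfl⟩
        | t + 5 => simp [H]
  · rintro ⟨s, rfl⟩
    induction s with
    | var y => rw [code, h0]; rfl
    | zero => rw [code, hp _ _ (by simp)]; rfl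
    | one => rw [code, hp _ _ (by simp)]; rfl
    | add s t ihs iht => rw [code, hp _ _ (by simp)]; simp [H, ihs, iht]
    | mul s t ihs iht => rw [code, hp _ _ (by simp)]; simp [H, ihs, iht]

theorem SOArith.exists_primrec_isCode :
    ∃ T : ℕ → Bool, Primrec T ∧ ∀ c, T c = true ↔ ∃ φ : SOArith, φ.code = c := by
  obtain ⟨T, hT, hs⟩ := ArithTerm.exists_primrec_isCode
  let H : Unit → ℕ × ℕ × Bool × Bool × Bool → Bool := fun _ q =>
    if q.1 = 0 then T q.2.1.unpair.1 && T q.2.1.unpair.2 else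
    if q.1 = 1 then T q.2.1.unpair.1 && T q.2.1.unpair.2 else
    if q.1 = 2 then T q.2.1.unpair.1 else
    if q.1 = 3 then q.2.2.1 else if q.1 = 4 then q.2.2.2.1 && q.2.2.2.2 else
    if q.1 = 5 then q.2.2.2.2 else if q.1 = 6 then q.2.2.2.2 else
    if q.1 = 7 then q.2.2.2.2 else if q.1 = 8 then q.2.2.2.2 else false
  have t : Primrec fun q : Unit × ℕ × ℕ × Bool × Bool × Bool => q.2.1 :=
    Primrec.fst.comp Primrec.snd
  have b : Primrec fun q : Unit × ℕ × ℕ × Bool × Bool × Bool => q.2.2.1 :=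
    Primrec.fst.comp (Primrec.snd.comp Primrec.snd)
  have x : Primrec fun q : Unit × ℕ × ℕ × Bool × Bool × Bool => q.2.2.2.1 :=
    Primrec.fst.comp (Primrec.snd.comp (Primrec.snd.comp Primrec.snd))
  have yz : Primrec fun q : Unit × ℕ × ℕ × Bool × Bool × Bool => q.2.2.2.2 :=
    Primrec.snd.comp (Primrec.snd.comp (Primrec.snd.comp Primrec.snd))
  have z := Primrec.snd.comp yz
  have yz' := (Primrec.fst.comp yz).and' z
  have T1 := hT.comp b.fst_unpair
  have T2 := T1.and' (hT.comp b.snd_unpair)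
  have hH : Primrec₂ H :=
    t.tag 0 T2 <| t.tag 1 T2 <| t.tag 2 T1 <| t.tag 3 x <| t.tag 4 yz' <| t.tag 5 z <|
      t.tag 6 z <| t.tag 7 z <| t.tag 8 z <| Primrec.const false
  obtain ⟨F, hF, h0, hp⟩ := exists_codeFold H hH (by simp [H])
  replace h0 := h0 ()
  replace hp := hp ()
  refine ⟨F (), hF.comp (Primrec.const ()) Primrec.id, fun c => ?_⟩
  constructor
  · induction c using Nat.strong_induction_on with
    | _ c ih =>
      obtain ⟨t, b, rfl⟩ := Nat.exists_eq_pair c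
      obtain ⟨l, r, rfl⟩ := Nat.exists_eq_pair b
      rcases Nat.eq_zero_or_pos t with rfl | ht
      · rw [h0]
        simp only [H, if_true, Nat.unpair_pair, Bool.and_eq_true, hs]
        rintro ⟨⟨s, rfl⟩, s', rfl⟩
        exact ⟨.eq s s', rfl⟩
      · have hlr := Nat.lt_pair_of_pos (b := Nat.pair l r) ht
        have ib := ih _ hlr
        have il := ih l ((Nat.left_le_pair l r).trans_lt hlr)
        have ir := ih r ((Nat.right_le_pair l r).trans_lt hlr)
        rw [hp _ _ ht]
        simp only [Nat.unpair_pair]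
        match t with
        | 1 =>
          simp [H, hs]
          rintro s rfl s' rfl
          exact ⟨.lt s s', rfl⟩
        | 2 =>
          simp [H, hs]
          rintro s rfl
          exact ⟨.mem s r, rfl⟩
        | 3 =>
          intro h
          obtain ⟨φ, hφ⟩ := ib h
          exact ⟨.neg φ, by rw [code, hφ]⟩
        | 4 =>
          intro h
          simp [H] at h
          obtain ⟨s, rfl⟩ := il h.1
          obtain ⟨s', rfl⟩ := ir h.2
          exact ⟨.or s s', rfl⟩
        | 5 =>
          intro h
          obtain ⟨φ, rfl⟩ := ir h
          exact ⟨.exNum l φ, rfl⟩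
        | 6 =>
          intro h
          obtain ⟨φ, rfl⟩ := ir h
          exact ⟨.allNum l φ, rfl⟩
        | 7 =>
          intro h
          obtain ⟨φ, rfl⟩ := ir h
          exact ⟨.exSet l φ, rfl⟩
        | 8 =>
          intro h
          obtain ⟨φ, rfl⟩ := ir h
          exact ⟨.allSet l φ, rfl⟩
        | t + 9 => simp [H]
  · rintro ⟨φ, rfl⟩
    induction φ with
    | eq s s' => rw [code, h0]; simp [H, hs]
    | lt s s' => rw [code, hp _ _ (by simp)]; simp [H, hs]
    | mem s X => rw [code, hp _ _ (by simp)]; simp [H, hs]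
    | neg φ ih => rw [code, hp _ _ (by simp)]; simp [H, ih]
    | or φ₁ φ₂ ih₁ ih₂ => rw [code, hp _ _ (by simp)]; simp [H, ih₁, ih₂]
    | exNum y φ ih | allNum y φ ih => rw [code, hp _ _ (by simp)]; simp [H, ih]
    | exSet X φ ih | allSet X φ ih => rw [code, hp _ _ (by simp)]; simp [H, ih]

end

/-! ### Truth in second-order arithmetic reduces to satisfiability -/

section

variable {AP : Type} (ι : ArithProp ⊕ Bool → AP)

/-- The reduction of truth in second-order arithmetic to the satisfiability of HyperCTL* sentences
in a class of transition systems. -/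
theorem SOTruth_reducible [Encodable AP] {P : ℕ → Prop} {M : HyperCTL AP → Prop}
    (hP : ∀ c, P c ↔ ∃ φ : HyperCTL AP, φ.code = c ∧ φ.IsSentence ∧ M φ)
    (hM : ∀ φ : SOArith, φ.IsSentence → (M (φ.reduction ι) ↔ ∀ e E, φ.Holds e E)) :
    SOTruth ≤₀ P := by
  obtain ⟨T, hT, ht⟩ := SOArith.exists_primrec_toCTL ι
  obtain ⟨V, hV, hv⟩ := SOArith.exists_primrec_isCode
  obtain ⟨F, hF, hf⟩ := HyperCTL.uniformCode_ex (AP := AP) (Primrec.const 0)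
    (HyperCTL.uniformCode_and .right (HyperCTL.uniformCode_and (.leaf (x := fun _ =>
      HyperCTL.allSets ι) (Primrec.const _)) .left))
  -- The tags of HyperCTL* formulas end at `6`, so this number is a fixed negative instance for
  -- inputs that are not codes.
  have hbad : ∀ φ : HyperCTL AP, φ.code ≠ Nat.pair 7 0 := by
    intro φ
    cases φ <;> simp [HyperCTL.code, Nat.pair_eq_pair]
  have hred : ∀ φ : SOArith, (φ.reduction ι).code =
      F (0, T φ.code, (OpFormula.sentence.toCTL ι).code) := fun φ => by
    rw [← ht]
    exact hf 0 (φ.toCTL ι) (OpFormula.sentence.toCTL ι)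
  refine ⟨fun c => if V c = true then F (0, T c, (OpFormula.sentence.toCTL ι).code) else
    Nat.pair 7 0, ?_, fun c => ?_⟩
  · exact (Primrec.ite (Primrec.eq.comp hV (Primrec.const true))
      (hF.comp ((Primrec.const 0).pair (hT.pair (Primrec.const _)))) (Primrec.const _)).to_comp
  · rw [hP]
    beta_reduce
    constructor
    · rintro ⟨φ, rfl, hφ, h⟩
      rw [if_pos ((hv _).2 ⟨φ, rfl⟩)]
      exact ⟨φ.reduction ι, hred φ, (φ.isSentence_reduction ι).2 hφ, (hM φ hφ).2 h⟩
    · rintro ⟨ψ, hψ, hs, hm⟩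
      split_ifs at hψ with hc
      · obtain ⟨φ, rfl⟩ := (hv c).1 hc
        rw [← hred] at hψ
        obtain rfl := HyperCTL.code_injective hψ
        have hφ := (φ.isSentence_reduction ι).1 hs
        exact ⟨φ, rfl, hφ, (hM φ hφ).1 hm⟩
      · exact absurd hψ (hbad ψ)

/-- Every model of the reduction, in whatever class, evaluates `φ` in standard arithmetic. A class
therefore only has to contain `arithSystem`. -/
theorem SOArith.satisfiable_reduction_iff (hι : Function.Injective ι) {φ : SOArith}
    (hφ : φ.IsSentence) {C : ∀ V : Type, TransitionSystem AP V → Prop}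
    (hC : C _ (arithSystem ι)) :
    (∃ (V : Type) (S : TransitionSystem AP V), C V S ∧ (φ.reduction ι).IsModel S) ↔
      ∀ e E, φ.Holds e E := by
  constructor
  · rintro ⟨V, S, -, h⟩ e E
    exact ((isModel_reduction_iff hφ e E).1 h).2.2
  · intro h
    exact ⟨_, _, hC, arithSystem_isModel_reduction hι hφ (h (fun _ => 0) fun _ => ∅)⟩

end

theorem exists_injective_fin {n : ℕ} (hn : 8 ≤ n) :
    ∃ ι : ArithProp ⊕ Bool → Fin n, Function.Injective ι := by
  let f : ArithProp ⊕ Bool → ℕ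
    | .inl .arg₁ => 0 | .inl .arg₂ => 1 | .inl .res => 2 | .inl .add => 3 | .inl .mult => 4
    | .inr true => 5 | .inr false => 6
  have hf : ∀ p, f p < 7 := by rintro (p | b) <;> [cases p; cases b] <;> simp [f]
  refine ⟨fun p => ⟨f p, by have := hf p; omega⟩, fun p q h => ?_⟩
  have h : f p = f q := congrArg Fin.val h
  rcases p with (p | p) <;> rcases q with (q | q) <;> cases p <;> cases q <;> simp_all [f]

theorem SOTruth_reducible_sat {n : ℕ} (hn : 8 ≤ n) : SOTruth ≤₀ CountableSat n ∧
    SOTruth ≤₀ FinitelyBranchingSat n ∧ SOTruth ≤₀ BoundedBranchingSat n := by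
  obtain ⟨ι, hι⟩ := exists_injective_fin hn
  have h := fun (C : ∀ V : Type, TransitionSystem (Fin n) V → Prop) (hC : C _ (arithSystem ι)) =>
    SOTruth_reducible ι (P := fun c => ∃ φ : HyperCTL (Fin n), φ.code = c ∧ φ.IsSentence ∧
      ∃ (V : Type) (S : TransitionSystem (Fin n) V), C V S ∧ φ.IsModel S) (fun _ => Iff.rfl)
      fun φ hφ => SOArith.satisfiable_reduction_iff ι hι hφ (C := C) hC
  have hb := arithSystem_boundedBranching ι
  refine ⟨h (fun V _ => Countable V) ?_, h (fun _ S => S.FinitelyBranching)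
    hb.finitelyBranching, h (fun _ S => S.BoundedBranching) hb⟩
  infer_instance

/-! ### Bounded morphisms and models on the natural numbers -/

namespace TransitionSystem

variable {AP V V' : Type}

/-- Bounded morphisms of labelled transition systems. -/
structure IsBoundedMorphism (S' : TransitionSystem AP V') (S : TransitionSystem AP V)
    (f : V' → V) : Prop where
  forth : ∀ {v w}, S'.edge v w → S.edge (f v) (f w)
  back : ∀ {v w}, S.edge (f v) w → ∃ w', S'.edge v w' ∧ f w' = w
  init : f S'.init = S.init
  label : ∀ v, S'.label v = S.label (f v)

variable {S' : TransitionSystem AP V'} {S : TransitionSystem AP V} {f : V' → V}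

namespace IsBoundedMorphism

def mapPath (h : S'.IsBoundedMorphism S f) (ρ : S'.Path) : S.Path :=
  ⟨fun n => f (ρ.at n), fun n => h.forth (ρ.edge_at n)⟩

def mapAssignment (h : S'.IsBoundedMorphism S f) (Γ : PathAssignment S') : PathAssignment S :=
  ⟨fun v => (Γ.map v).map h.mapPath, Γ.recent⟩

theorem exists_lift (h : S'.IsBoundedMorphism S f) (ρ : S.Path) {v : V'} (hv : f v = ρ.at 0) :
    ∃ ρ' : S'.Path, ρ'.at 0 = v ∧ h.mapPath ρ' = ρ := by
  have step : ∀ n (u : {u // f u = ρ.at n}), ∃ w : {w // f w = ρ.at (n + 1)}, S'.edge u.1 w.1 := by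
    rintro n ⟨u, hu⟩
    obtain ⟨w, h1, h2⟩ := h.back (hu ▸ ρ.edge_at n)
    exact ⟨⟨w, h2⟩, h1⟩
  choose g hg using step
  let σ : ∀ n, {u // f u = ρ.at n} := fun n => Nat.rec ⟨v, hv⟩ (fun n u => g n u) n
  exact ⟨⟨fun n => (σ n).1, fun n => hg n (σ n)⟩, rfl, Subtype.ext (funext fun n => (σ n).2)⟩

theorem rcnt_mapAssignment (h : S'.IsBoundedMorphism S f)
    (Γ : PathAssignment S') :
    (h.mapAssignment Γ).rcnt = f Γ.rcnt := by
  obtain ⟨m, _ | r⟩ := Γ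
  · exact h.init.symm
  · simp only [PathAssignment.rcnt, mapAssignment, Option.bind_some]
    cases m r with
    | none => exact h.init.symm
    | some ρ => rfl

theorem mapAssignment_drop (h : S'.IsBoundedMorphism S f)
    (Γ : PathAssignment S') (j : ℕ) :
    h.mapAssignment (Γ.drop j) = (h.mapAssignment Γ).drop j := by
  simp only [mapAssignment, PathAssignment.drop, Option.map_map]
  rfl

theorem mapAssignment_set (h : S'.IsBoundedMorphism S f)
    (Γ : PathAssignment S') (v : PathVar) (ρ : S'.Path) :
    h.mapAssignment (Γ.set v ρ) = (h.mapAssignment Γ).set v (h.mapPath ρ) := by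
  simp only [mapAssignment, PathAssignment.set, PathAssignment.mk.injEq, and_true]
  funext w
  by_cases hw : w = v
  · subst hw; simp
  · simp [hw]

/-- Formulas see only labels and starting vertices. Paths are mapped forward, and each path of the
image lifts to a path from any prescribed preimage of its first vertex, so the path quantifiers on
both sides match. -/
theorem holds_iff (h : S'.IsBoundedMorphism S f)
    (φ : HyperCTL AP) (Γ : PathAssignment S') :
    φ.Holds S' Γ ↔ φ.Holds S (h.mapAssignment Γ) := by
  induction φ generalizing Γ with
  | atom a v =>
    simp only [HyperCTL.Holds, mapAssignment]
    cases Γ.map v with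
    | none => simp
    | some ρ =>
      simp only [Option.map_some, Option.some.injEq, exists_eq_left', h.label]
      rfl
  | neg φ ih => simp [ih]
  | or φ₁ φ₂ ih₁ ih₂ => simp [ih₁, ih₂]
  | next φ ih => simp [ih, h.mapAssignment_drop]
  | ex v φ ih =>
    simp only [HyperCTL.holds_ex, h.rcnt_mapAssignment, ih, h.mapAssignment_set]
    constructor
    · rintro ⟨ρ, h0, h1⟩
      exact ⟨h.mapPath ρ, congrArg f h0, h1⟩
    · rintro ⟨ρ, h0, h1⟩
      obtain ⟨ρ', h2, rfl⟩ := h.exists_lift ρ h0.symm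
      exact ⟨ρ', h2, h1⟩
  | all v φ ih =>
    simp only [HyperCTL.holds_all, h.rcnt_mapAssignment, ih, h.mapAssignment_set]
    constructor
    · intro H ρ h0
      obtain ⟨ρ', h2, rfl⟩ := h.exists_lift ρ h0.symm
      exact H ρ' h2
    · intro H ρ h0
      exact H (h.mapPath ρ) (congrArg f h0)
  | _ φ₁ φ₂ ih₁ ih₂ => simp [ih₁, ih₂, h.mapAssignment_drop]

theorem isModel_iff (h : S'.IsBoundedMorphism S f)
    (φ : HyperCTL AP) : φ.IsModel S' ↔ φ.IsModel S := h.holds_iff φ _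

end IsBoundedMorphism

/-- A system with countably many reachable vertices has a bounded morphism from a system on the
natural numbers whose successor sets are images of the original ones. -/
theorem exists_nat_system (S : TransitionSystem AP V)
    (hS : {v | Relation.ReflTransGen S.edge S.init v}.Countable) :
    ∃ (S' : TransitionSystem AP ℕ) (f : ℕ → V) (g : V → ℕ), S'.IsBoundedMorphism S f ∧
      ∀ n, {m | S'.edge n m} ⊆ g '' {w | S.edge (f n) w} := by
  obtain ⟨f, hf⟩ := hS.exists_eq_range ⟨S.init, .refl⟩
  have hR : ∀ n, Relation.ReflTransGen S.edge S.init (f n) := fun n => by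
    have : f n ∈ Set.range f := ⟨n, rfl⟩
    rwa [← hf] at this
  have hg : ∀ v, ∃ n, Relation.ReflTransGen S.edge S.init v → f n = v := by
    intro v
    by_cases h : Relation.ReflTransGen S.edge S.init v
    · have : v ∈ Set.range f := hf ▸ h
      obtain ⟨n, hn⟩ := this
      exact ⟨n, fun _ => hn⟩
    · exact ⟨0, fun h' => absurd h' h⟩
  choose g hg using hg
  have back : ∀ n w, S.edge (f n) w → f (g w) = w := fun n w h => hg w ((hR n).tail h)
  -- The enumeration `f` may repeat vertices. Only the representative selected by `g` is allowed as
  -- the target of an edge, so no vertex gains successors.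
  refine ⟨⟨fun n m => S.edge (f n) (f m) ∧ m = g (f m), g S.init, fun n => S.label (f n), fun n => ?_⟩,
    f, g, ⟨fun h => h.1, fun {n w} h => ⟨g w, ?_, back n w h⟩, hg _ .refl, fun _ => rfl⟩, ?_⟩
  · obtain ⟨w, hw⟩ := S.total (f n)
    exact ⟨g w, by rw [back n w hw]; exact ⟨hw, rfl⟩⟩
  · show S.edge (f n) (f (g w)) ∧ g w = g (f (g w))
    rw [back n w h]
    exact ⟨h, rfl⟩
  · rintro n m ⟨h, hm⟩
    exact ⟨f m, h, hm.symm⟩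

theorem FinitelyBranching.countable_reachable {S : TransitionSystem AP V}
    (h : S.FinitelyBranching) : {v | Relation.ReflTransGen S.edge S.init v}.Countable := by
  -- `L n` is the set of vertices reachable in exactly `n` steps.
  let L : ℕ → Set V := fun n => Nat.rec {S.init} (fun _ L => ⋃ v ∈ L, {w | S.edge v w}) n
  have hL : ∀ n, (L n).Countable := by
    intro n
    induction n with
    | zero => exact Set.countable_singleton _
    | succ n ih => exact ih.biUnion fun v _ => (h v).countable
  refine (Set.countable_iUnion hL).mono fun v hv => ?_
  induction hv with
  | refl => exact Set.mem_iUnion.2 ⟨0, rfl⟩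
  | tail _ hvw ih =>
    obtain ⟨n, hn⟩ := Set.mem_iUnion.1 ih
    exact Set.mem_iUnion.2 ⟨n + 1, Set.mem_biUnion hn hvw⟩

end TransitionSystem

section

variable {AP : Type} {φ : HyperCTL AP}

open TransitionSystem

/-- The conjunct `True` gives this the form `C n S ∧ φ.IsModel S` common to the three classes; on
`ℕ`, countability is automatic. -/
theorem countable_model_iff :
    (∃ (V : Type) (S : TransitionSystem AP V), Countable V ∧ φ.IsModel S) ↔
      ∃ S : TransitionSystem AP ℕ, True ∧ φ.IsModel S := by
  constructor
  · rintro ⟨V, S, hV, h⟩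
    obtain ⟨S', f, g, hf, -⟩ := S.exists_nat_system (Set.to_countable _)
    exact ⟨S', trivial, (hf.isModel_iff φ).2 h⟩
  · rintro ⟨S, -, h⟩
    exact ⟨ℕ, S, inferInstance, h⟩

theorem finitelyBranching_model_iff :
    (∃ (V : Type) (S : TransitionSystem AP V), S.FinitelyBranching ∧ φ.IsModel S) ↔
      ∃ S : TransitionSystem AP ℕ, S.FinitelyBranching ∧ φ.IsModel S := by
  constructor
  · rintro ⟨V, S, hS, h⟩
    obtain ⟨S', f, g, hf, hg⟩ := S.exists_nat_system hS.countable_reachable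
    exact ⟨S', fun n => ((hS (f n)).image g).subset (hg n), (hf.isModel_iff φ).2 h⟩
  · rintro ⟨S, hS, h⟩
    exact ⟨ℕ, S, hS, h⟩

theorem boundedBranching_model_iff :
    (∃ (V : Type) (S : TransitionSystem AP V), S.BoundedBranching ∧ φ.IsModel S) ↔
      ∃ S : TransitionSystem AP ℕ, S.BoundedBranching ∧ φ.IsModel S := by
  constructor
  · rintro ⟨V, S, hS, h⟩
    obtain ⟨S', f, g, hf, hg⟩ := S.exists_nat_system hS.finitelyBranching.countable_reachable
    obtain ⟨k, hk⟩ := hS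
    exact ⟨S', ⟨k, fun n => (Set.encard_le_encard (hg n)).trans
      ((Set.encard_image_le _ _).trans (hk (f n)))⟩, (hf.isModel_iff φ).2 h⟩
  · rintro ⟨S, hS, h⟩
    exact ⟨ℕ, S, hS, h⟩

end

/-! ### HyperCTL* in second-order arithmetic -/

/-- A pairing term. -/
def ArithTerm.pair (s t : ArithTerm) : ArithTerm := .add (.mul (.add s t) (.add s t)) s

/-- The value of the pairing term. -/
def pairNat (a b : ℕ) : ℕ := (a + b) * (a + b) + a

/-- The value lies between `(a + b) ^ 2` and `(a + b + 1) ^ 2`, the latter excluded, so it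
determines `a + b` and then `a`. Only injectivity is needed. -/
theorem pairNat_inj {a b c d : ℕ} : pairNat a b = pairNat c d ↔ a = c ∧ b = d := by
  constructor
  · intro h
    simp only [pairNat] at h
    rcases lt_trichotomy (a + b) (c + d) with h' | h' | h'
    · nlinarith
    · rw [h'] at h
      omega
    · nlinarith
  · rintro ⟨rfl, rfl⟩
    rfl

def ArithTerm.numeral : ℕ → ArithTerm
  | 0 => .zero
  | n + 1 => .add (numeral n) .one

namespace ArithTerm

variable {e : ℕ → ℕ} {s t : ArithTerm}

@[simp] theorem val_numeral (n : ℕ) : (numeral n).val e = n := by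
  induction n with
  | zero => rfl
  | succ n ih => simp [numeral, val, ih]

@[simp] theorem val_var (x : ℕ) : (var x).val e = e x := rfl

@[simp] theorem val_zero : zero.val e = 0 := rfl

@[simp] theorem val_add : (add s t).val e = s.val e + t.val e := rfl

@[simp] theorem val_one : one.val e = 1 := rfl

@[simp] theorem freeVars_pair : (pair s t).freeVars = s.freeVars ∪ t.freeVars := by
  ext x
  simp [pair, freeVars]
  tauto

@[simp] theorem freeVars_numeral (n : ℕ) : (numeral n).freeVars = ∅ := by
  induction n with
  | zero => rfl
  | succ n ih => simp [numeral, freeVars, ih]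

end ArithTerm

namespace SOArith

def and (φ₁ φ₂ : SOArith) : SOArith := neg (or (neg φ₁) (neg φ₂))

def imp (φ₁ φ₂ : SOArith) : SOArith := or (neg φ₁) φ₂

def iff (φ₁ φ₂ : SOArith) : SOArith := and (imp φ₁ φ₂) (imp φ₂ φ₁)

def le (s t : ArithTerm) : SOArith := neg (lt t s)

/-- The pair of `s` and `t` belongs to `X`. -/
def memPair (s t : ArithTerm) (X : ℕ) : SOArith := mem (.pair s t) X

variable {e : ℕ → ℕ} {E : ℕ → Set ℕ} {φ φ₁ φ₂ : SOArith} {s t : ArithTerm} {x X : ℕ}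

@[simp] theorem holds_eq : (eq s t).Holds e E ↔ s.val e = t.val e := Iff.rfl

@[simp] theorem holds_lt : (lt s t).Holds e E ↔ s.val e < t.val e := Iff.rfl

@[simp] theorem holds_mem : (mem s X).Holds e E ↔ s.val e ∈ E X := Iff.rfl

@[simp] theorem holds_neg : (neg φ).Holds e E ↔ ¬ φ.Holds e E := Iff.rfl

@[simp] theorem holds_or : (or φ₁ φ₂).Holds e E ↔ φ₁.Holds e E ∨ φ₂.Holds e E := Iff.rfl

@[simp] theorem holds_exNum :
    (exNum x φ).Holds e E ↔ ∃ n, φ.Holds (Function.update e x n) E := Iff.rfl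

@[simp] theorem holds_allNum :
    (allNum x φ).Holds e E ↔ ∀ n, φ.Holds (Function.update e x n) E := Iff.rfl

@[simp] theorem holds_exSet :
    (exSet X φ).Holds e E ↔ ∃ A, φ.Holds e (Function.update E X A) := Iff.rfl

@[simp] theorem holds_and : (and φ₁ φ₂).Holds e E ↔ φ₁.Holds e E ∧ φ₂.Holds e E := by
  simp [and]

@[simp] theorem holds_imp : (imp φ₁ φ₂).Holds e E ↔ (φ₁.Holds e E → φ₂.Holds e E) := by
  simp [imp, imp_iff_not_or]

@[simp] theorem holds_iff : (iff φ₁ φ₂).Holds e E ↔ (φ₁.Holds e E ↔ φ₂.Holds e E) := by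
  simp [iff, iff_def]

@[simp] theorem holds_le : (le s t).Holds e E ↔ s.val e ≤ t.val e := by simp [le]

@[simp] theorem holds_memPair :
    (memPair s t X).Holds e E ↔ pairNat (s.val e) (t.val e) ∈ E X := Iff.rfl

/-- The formula `φ`, read at the time given by the number variable `k`. -/
def atTime (k : ℕ) (φ : SOArith) : SOArith := exNum 0 (and (eq (.var 0) (.var k)) φ)

/-- `φ` holds at the next time. -/
def nextTime (φ : SOArith) : SOArith :=
  exNum 1 (and (eq (.var 1) (.add (.var 0) .one)) (atTime 1 φ))

/-- `φ₁` holds until `φ₂` does. -/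
def untilTime (φ₁ φ₂ : SOArith) : SOArith :=
  exNum 1 (and (le (.var 0) (.var 1)) (and (atTime 1 φ₂)
    (allNum 2 (imp (and (le (.var 0) (.var 2)) (lt (.var 2) (.var 1))) (atTime 2 φ₁)))))

/-- The set `X` encodes a path of the system with edge set `1`, from the current time `0` on. -/
def isPath (X : ℕ) : SOArith :=
  allNum 3 (imp (le (.var 0) (.var 3)) (exNum 4 (and (memPair (.var 3) (.var 4) X)
    (and (allNum 5 (imp (memPair (.var 3) (.var 5) X) (eq (.var 5) (.var 4))))
      (exNum 5 (and (memPair (.add (.var 3) .one) (.var 5) X) (memPair (.var 4) (.var 5) 1)))))))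

/-- The paths `X` and `Y` meet at the current time. -/
def meetNow (X Y : ℕ) : SOArith :=
  exNum 3 (and (memPair (.var 0) (.var 3) X) (memPair (.var 0) (.var 3) Y))

def sameSet (X Y : ℕ) : SOArith := allNum 3 (iff (mem (.var 3) X) (mem (.var 3) Y))

/-- There is a path `X` starting where the most recent path `0` is now, such that `φ` holds when
`X` is the most recent path. -/
def exPath (X : ℕ) (φ : SOArith) : SOArith :=
  exSet X (and (isPath X) (and (meetNow X 0) (exSet 0 (and (sameSet 0 X) φ))))

/-- The current vertex of the path `X` has the label `a`. -/
def hasLabel (a X : ℕ) : SOArith :=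
  exNum 3 (and (memPair (.var 0) (.var 3) X) (memPair (.var 3) (.numeral a) 2))

end SOArith

open SOArith in
/-- The formula expressing the satisfaction of a HyperCTL* formula at the time given by the number
variable `0`, in the system with edge set `1` and labels `2`, where `0` is the most recent path and
`v + 3` the path assigned to `v`. -/
def HyperCTL.toSO {AP : Type} [Encodable AP] : HyperCTL AP → SOArith
  | atom a v => hasLabel (Encodable.encode a) (v + 3)
  | neg φ => .neg φ.toSO
  | or φ₁ φ₂ => .or φ₁.toSO φ₂.toSO
  | next φ => nextTime φ.toSO
  | .until φ₁ φ₂ => untilTime φ₁.toSO φ₂.toSO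
  | ex v φ => exPath (v + 3) φ.toSO
  | all v φ => .neg (exPath (v + 3) (.neg φ.toSO))

namespace SOArith

/-- Every vertex has a successor. -/
def total : SOArith := allNum 3 (exNum 4 (memPair (.var 3) (.var 4) 1))

/-- Every vertex has finitely many successors. -/
def finitelyBranching : SOArith :=
  allNum 3 (exNum 5 (allNum 4 (imp (memPair (.var 3) (.var 4) 1) (lt (.var 4) (.var 5)))))

/-- The numbers of successors are bounded. -/
def boundedBranching : SOArith :=
  -- Set variable `3` colours the successors of a vertex with fewer colours than the number variable
  -- `6`, no two vertices sharing a colour.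
  exNum 6 (allNum 3 (exSet 3 (and
    (allNum 4 (imp (memPair (.var 3) (.var 4) 1)
      (exNum 5 (and (lt (.var 5) (.var 6)) (memPair (.var 4) (.var 5) 3)))))
    (allNum 4 (allNum 7 (allNum 5 (imp (and (memPair (.var 4) (.var 5) 3)
      (memPair (.var 7) (.var 5) 3)) (eq (.var 4) (.var 7)))))))))

/-- The set `0` encodes the constant sequence with value `6`. -/
def constant : SOArith :=
  allNum 3 (allNum 4 (iff (memPair (.var 3) (.var 4) 0) (eq (.var 4) (.var 6))))

/-- There is a system with the property `χ` that satisfies `φ`. -/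
def satisfiable (χ φ : SOArith) : SOArith :=
  -- Number variable `6` is the initial vertex. The empty assignment has it as its `rcnt` at all
  -- times, hence the constant sequence in set `0`.
  exSet 1 (exSet 2 (and total (and χ (exNum 6 (exSet 0 (and constant
    (exNum 0 (and (eq (.var 0) .zero) φ))))))))

end SOArith

section

variable {AP : Type} [Encodable AP]

/-! #### Free variables -/

open SOArith in
theorem HyperCTL.freeNumVars_toSO (φ : HyperCTL AP) : φ.toSO.freeNumVars ⊆ {0} := by
  intro x hx
  rw [Set.mem_singleton_iff]
  induction φ with
  | neg φ ih => exact ih hx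
  | or φ₁ φ₂ ih₁ ih₂ => exact hx.elim ih₁ ih₂
  | _ =>
    simp [toSO, hasLabel, exPath, isPath, meetNow, sameSet, nextTime, untilTime, atTime,
      SOArith.and, SOArith.imp, SOArith.iff, le, memPair, SOArith.freeNumVars,
      ArithTerm.freeVars] at hx
    grind

open SOArith in
theorem HyperCTL.freeSetVars_toSO (φ : HyperCTL AP) (v : ℕ) :
    v + 3 ∈ φ.toSO.freeSetVars ↔ v ∈ φ.freeVars := by
  induction φ with
  | neg φ ih => exact ih
  | or φ₁ φ₂ ih₁ ih₂ => exact or_congr ih₁ ih₂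
  | _ =>
    simp_all [toSO, hasLabel, exPath, isPath, meetNow, sameSet, nextTime, untilTime, atTime,
      SOArith.and, SOArith.imp, SOArith.iff, le, memPair, SOArith.freeSetVars, HyperCTL.freeVars]
    try grind

open SOArith in
theorem SOArith.isSentence_satisfiable (χ : SOArith) (h1 : χ.freeNumVars = ∅)
    (h2 : χ.freeSetVars ⊆ {1}) (φ : HyperCTL AP) :
    (satisfiable χ φ.toSO).IsSentence ↔ φ.freeVars = ∅ := by
  have hn := φ.freeNumVars_toSO
  have hs := φ.freeSetVars_toSO
  have e1 : (satisfiable χ φ.toSO).freeNumVars = ∅ := by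
    ext x
    have := @hn x
    simp only [Set.mem_singleton_iff] at this
    simp [satisfiable, total, constant, SOArith.and, SOArith.imp, SOArith.iff, memPair,
      SOArith.freeNumVars, ArithTerm.freeVars, h1]
    grind
  have e2 : (satisfiable χ φ.toSO).freeSetVars = φ.toSO.freeSetVars \ {0, 1, 2} := by
    ext x
    have := @h2 x
    simp only [Set.mem_singleton_iff] at this
    simp [satisfiable, total, constant, SOArith.and, SOArith.imp, SOArith.iff, memPair,
      SOArith.freeSetVars]
    grind
  rw [IsSentence, e1, e2]
  simp only [true_and, Set.eq_empty_iff_forall_notMem, ← hs]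
  constructor
  · intro h v hv
    exact h (v + 3) ⟨hv, by simp⟩
  · rintro h x ⟨hx, hx'⟩
    obtain ⟨v, rfl⟩ : ∃ v, x = v + 3 := ⟨x - 3, by simp at hx'; omega⟩
    exact h v hx

end

/-! #### Correctness of the translation to second-order arithmetic -/

theorem PathAssignment.drop_drop {AP V : Type} {S : TransitionSystem AP V} (Γ : PathAssignment S)
    (i j : ℕ) : (Γ.drop i).drop j = Γ.drop (i + j) := by
  simp only [drop, Option.map_map, mk.injEq, and_true]
  funext v
  congr 1
  funext ρ
  simp

theorem PathAssignment.drop_zero {AP V : Type} {S : TransitionSystem AP V}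
    (Γ : PathAssignment S) : Γ.drop 0 = Γ := by
  obtain ⟨m, r⟩ := Γ
  simp only [drop, mk.injEq, and_true]
  funext v
  cases m v <;> simp

section

variable {AP : Type} [Encodable AP] {S : TransitionSystem AP ℕ}

/-- The set `Z` encodes the sequence `f`, from time `t` on. -/
def EncodesFrom (Z : Set ℕ) (t : ℕ) (f : ℕ → ℕ) : Prop := ∀ j u, pairNat (t + j) u ∈ Z ↔ u = f j

/-- Times are absolute: when time advances, the same set keeps encoding the path, and a path
quantified at time `t` need not be specified before `t`. -/
theorem EncodesFrom.drop {Z : Set ℕ} {t : ℕ} {f : ℕ → ℕ} (h : EncodesFrom Z t f) (i : ℕ) :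
    EncodesFrom Z (t + i) fun j => f (i + j) := fun j u => by
  rw [add_assoc, h]

/-- The sets `E 1` and `E 2` encode the edges and the labels of `S`. -/
structure EncodesSystem (S : TransitionSystem AP ℕ) (E : ℕ → Set ℕ) : Prop where
  edge : ∀ v w, pairNat v w ∈ E 1 ↔ S.edge v w
  label : ∀ v a, pairNat v (Encodable.encode a) ∈ E 2 ↔ a ∈ S.label v

/-- The sets `E` encode the system `S` and the assignment `Γ` (on the variables in `N`) at
time `t`. -/
structure EncodesAssignment (Γ : PathAssignment S) (t : ℕ) (E : ℕ → Set ℕ) (N : Set PathVar) :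
    Prop where
  system : EncodesSystem S E
  map : ∀ v ∈ N, ∃ ρ, Γ.map v = some ρ ∧ EncodesFrom (E (v + 3)) t ρ.at
  -- This is a sequence of vertices rather than a path: while no path is assigned it is constantly
  -- the initial vertex, which need not have a loop.
  recent : EncodesFrom (E 0) t fun j => (Γ.drop j).rcnt

variable {Γ : PathAssignment S} {t : ℕ} {e : ℕ → ℕ} {E : ℕ → Set ℕ} {N N' : Set PathVar}
  {φ : SOArith}

theorem EncodesAssignment.mono (h : EncodesAssignment Γ t E N) (hN : N' ⊆ N) :
    EncodesAssignment Γ t E N' := ⟨h.system, fun v hv => h.map v (hN hv), h.recent⟩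

theorem EncodesAssignment.drop (h : EncodesAssignment Γ t E N) (i : ℕ) :
    EncodesAssignment (Γ.drop i) (t + i) E N := by
  refine ⟨h.system, fun v hv => ?_, ?_⟩
  · obtain ⟨ρ, h1, h2⟩ := h.map v hv
    exact ⟨_, PathAssignment.drop_map h1 i, h2.drop i⟩
  · simpa only [PathAssignment.drop_drop] using h.recent.drop i

theorem EncodesAssignment.set {v : PathVar} {Z : Set ℕ} {ρ : S.Path}
    (h : EncodesAssignment Γ t E (N \ {v})) (hZ : EncodesFrom Z t ρ.at) :
    EncodesAssignment (Γ.set v ρ) t (Function.update (Function.update E (v + 3) Z) 0 Z) N := by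
  refine ⟨⟨fun u w => ?_, fun u a => ?_⟩, fun w hw => ?_, ?_⟩
  · simpa using h.system.edge u w
  · simpa using h.system.label u a
  · by_cases hwv : w = v
    · subst hwv
      exact ⟨ρ, by simp, by simpa using hZ⟩
    · rw [PathAssignment.set_map_of_ne hwv]
      have : (w + 3 : ℕ) ≠ v + 3 := fun h => hwv (Nat.add_right_cancel h)
      rw [Function.update_of_ne (by simp), Function.update_of_ne this]
      exact h.map w ⟨hw, hwv⟩
  · intro j u
    beta_reduce
    rw [PathAssignment.drop_set, PathAssignment.rcnt_set, Function.update_self, hZ]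
    simp

namespace SOArith

/-- The formula rebinds variable `0` before comparing it with variable `k`, so for `k = 0` the
comparison would say nothing. -/
theorem holds_atTime {k : ℕ} (hk : k ≠ 0) :
    (atTime k φ).Holds e E ↔ φ.Holds (Function.update e 0 (e k)) E := by
  simp [atTime, hk]

theorem holds_nextTime : (nextTime φ).Holds e E ↔
    φ.Holds (Function.update (Function.update e 1 (e 0 + 1)) 0 (e 0 + 1)) E := by
  simp [nextTime, holds_atTime]

theorem holds_untilTime {φ₁ φ₂ : SOArith} : (untilTime φ₁ φ₂).Holds e E ↔
    ∃ j, φ₂.Holds (Function.update (Function.update e 1 (e 0 + j)) 0 (e 0 + j)) E ∧ ∀ i < j,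
      φ₁.Holds (Function.update (Function.update (Function.update e 1 (e 0 + j)) 2 (e 0 + i)) 0
        (e 0 + i)) E := by
  simp only [untilTime, holds_exNum, holds_and, holds_le, holds_allNum, holds_imp, holds_lt,
    holds_atTime (show 1 ≠ 0 by simp), holds_atTime (show 2 ≠ 0 by simp)]
  simp
  constructor
  · rintro ⟨n, hn, h2, h1⟩
    obtain ⟨j, rfl⟩ := Nat.exists_eq_add_of_le hn
    exact ⟨j, h2, fun i hi => h1 _ (by omega) (by omega)⟩
  · rintro ⟨j, h2, h1⟩
    refine ⟨e 0 + j, by omega, h2, fun n hn hn' => ?_⟩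
    obtain ⟨i, rfl⟩ := Nat.exists_eq_add_of_le hn
    exact h1 i (by omega)

theorem holds_isPath (hE : EncodesSystem S E) {X : ℕ} :
    (isPath X).Holds e E ↔ ∃ ρ : S.Path, EncodesFrom (E X) (e 0) ρ.at := by
  simp [isPath]
  constructor
  · intro h
    have h' : ∀ j, ∃ u, pairNat (e 0 + j) u ∈ E X ∧ (∀ w, pairNat (e 0 + j) w ∈ E X → w = u) ∧
        ∃ w, pairNat (e 0 + j + 1) w ∈ E X ∧ S.edge u w := fun j => by
      simpa only [hE.edge] using h (e 0 + j) (by omega)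
    choose f h1 h2 h3 using h'
    refine ⟨⟨f, fun n => ?_⟩, fun j u => ⟨h2 j u, ?_⟩⟩
    · obtain ⟨w, hw, he⟩ := h3 n
      rwa [← h2 (n + 1) w hw]
    · rintro rfl
      exact h1 j
  · rintro ⟨ρ, hρ⟩ n hn
    obtain ⟨j, rfl⟩ := Nat.exists_eq_add_of_le hn
    refine ⟨ρ.at j, (hρ _ _).2 rfl, fun w hw => (hρ _ _).1 hw, ρ.at (j + 1), ?_,
      (hE.edge _ _).2 (ρ.edge_at j)⟩
    rw [add_assoc]
    exact (hρ _ _).2 rfl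

theorem holds_meetNow {X Y : ℕ} {f g : ℕ → ℕ} (hX : EncodesFrom (E X) (e 0) f)
    (hY : EncodesFrom (E Y) (e 0) g) : (meetNow X Y).Holds e E ↔ f 0 = g 0 := by
  have hX := hX 0
  have hY := hY 0
  rw [add_zero] at hX hY
  simp [meetNow, hX, hY]

theorem holds_sameSet {X Y : ℕ} : (sameSet X Y).Holds e E ↔ E X = E Y := by
  simp [sameSet, Set.ext_iff]

end SOArith

open SOArith

theorem exists_encodesFrom (t : ℕ) (f : ℕ → ℕ) : ∃ Z, EncodesFrom Z t f :=
  ⟨{x | ∃ j, x = pairNat (t + j) (f j)}, fun j u => by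
    simp only [Set.mem_ofPred_eq, pairNat_inj, Nat.add_left_cancel_iff]
    exact ⟨fun ⟨_, h, h'⟩ => h ▸ h', fun h => ⟨j, rfl, h⟩⟩⟩

/-- The predicate `P` is left abstract so that the universal quantifier, translated through
negations, is covered as well. -/
theorem holds_exPath {v : PathVar} (h : EncodesAssignment Γ (e 0) E N) {P : S.Path → Prop}
    (hφ : ∀ Z (ρ : S.Path), EncodesFrom Z (e 0) ρ.at → ρ.at 0 = Γ.rcnt →
      (φ.Holds e (Function.update (Function.update E (v + 3) Z) 0 Z) ↔ P ρ)) :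
    (exPath (v + 3) φ).Holds e E ↔ ∃ ρ : S.Path, ρ.at 0 = Γ.rcnt ∧ P ρ := by
  have hsys : ∀ Z, EncodesSystem S (Function.update E (v + 3) Z) := fun Z =>
    ⟨by simpa using h.system.edge, by simpa using h.system.label⟩
  have hself : ∀ Z, Function.update E (v + 3) Z (v + 3) = Z := fun Z => by simp
  have h0 : ∀ Z, EncodesFrom (Function.update E (v + 3) Z 0) (e 0) fun j => (Γ.drop j).rcnt :=
    fun Z => by simpa using h.recent
  simp only [exPath, holds_exSet, holds_and, holds_isPath (hsys _), hself, holds_sameSet]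
  constructor
  · rintro ⟨Z, ⟨ρ, hρ⟩, hm, Z', hZ, hP⟩
    have h1 : ρ.at 0 = Γ.rcnt := by
      simpa only [PathAssignment.drop_zero] using (holds_meetNow (by rwa [hself]) (h0 Z)).1 hm
    obtain rfl : Z' = Z := by simpa using hZ
    exact ⟨ρ, h1, (hφ _ ρ hρ h1).1 hP⟩
  · rintro ⟨ρ, hm, hP⟩
    obtain ⟨Z, hZ⟩ := exists_encodesFrom (e 0) ρ.at
    refine ⟨Z, ⟨ρ, hZ⟩, (holds_meetNow (by rwa [hself]) (h0 Z)).2 ?_, Z, by simp,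
      (hφ _ ρ hZ hm).2 hP⟩
    rw [PathAssignment.drop_zero]
    exact hm

/-- Number variable `0` holds the time, and temporal operators only change it; the sets encoding the
paths stay fixed. Path quantifiers add a set and also copy it to set `0`, which is where the next
quantifier branches off. -/
theorem HyperCTL.holds_toSO (φ : HyperCTL AP) (h : EncodesAssignment Γ (e 0) E φ.freeVars) :
    φ.toSO.Holds e E ↔ φ.Holds S Γ := by
  induction φ generalizing Γ e E with
  | atom a v =>
    obtain ⟨ρ, h1, h2⟩ := h.map v rfl
    rw [holds_atom h1]
    have h2 := h2 0
    rw [add_zero] at h2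
    simp [toSO, hasLabel, h2, h.system.label]
  | neg φ ih => exact not_congr (ih h)
  | or φ₁ φ₂ ih₁ ih₂ =>
    exact or_congr (ih₁ (h.mono Set.subset_union_left)) (ih₂ (h.mono Set.subset_union_right))
  | next φ ih =>
    rw [toSO, holds_nextTime, holds_next]
    have h1 := (h.mono (N' := φ.freeVars) subset_rfl).drop 1
    exact ih (by simpa using h1)
  | ex v φ ih =>
    rw [toSO, holds_ex]
    exact holds_exPath h fun Z ρ hZ h0 => ih (h.set hZ)
  | all v φ ih =>
    rw [toSO, holds_all, SOArith.holds_neg, holds_exPath (φ := .neg φ.toSO) h (P := fun ρ => ¬ φ.Holds S (Γ.set v ρ))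
      fun Z ρ hZ h0 => not_congr (ih (h.set hZ))]
    push Not
    rfl
  | _ φ₁ φ₂ ih₁ ih₂ =>
    rw [toSO, holds_untilTime, holds_until]
    refine exists_congr fun j => and_congr (ih₂ ?_) (forall₂_congr fun i hi => ih₁ ?_)
    · simpa using (h.mono Set.subset_union_right).drop j
    · simpa using (h.mono Set.subset_union_left).drop i

namespace SOArith

theorem holds_total : total.Holds e E ↔ ∀ v, ∃ w, pairNat v w ∈ E 1 := by
  simp [total]

theorem holds_constant : constant.Holds e E ↔ EncodesFrom (E 0) 0 fun _ => e 6 := by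
  simp [constant, EncodesFrom]

/-- The vertices are natural numbers, so finite means bounded. -/
theorem holds_finitelyBranching (hE : EncodesSystem S E) :
    finitelyBranching.Holds e E ↔ S.FinitelyBranching := by
  simp [finitelyBranching, hE.edge, TransitionSystem.FinitelyBranching]
  refine forall_congr' fun v => ?_
  rw [Set.finite_iff_bddAbove]
  exact ⟨fun ⟨n, h⟩ => ⟨n, fun w hw => (h w hw).le⟩,
    fun ⟨n, h⟩ => ⟨n + 1, fun w hw => Nat.lt_succ_of_le (h hw)⟩⟩

theorem encard_Iio (k : ℕ) : (Set.Iio k).encard = k := by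
  rw [← Finset.coe_range, Set.encard_coe_eq_coe_finsetCard, Finset.card_range]

/-- The relation coded by `Z` may give several colours to an element, but no colour to two elements;
choosing a colour for each element of `s` yields an injection into the numbers below `k`. -/
theorem encard_le_iff (s : Set ℕ) (k : ℕ) : s.encard ≤ k ↔ ∃ Z : Set ℕ,
    (∀ w ∈ s, ∃ c < k, pairNat w c ∈ Z) ∧
      ∀ w w' c, pairNat w c ∈ Z → pairNat w' c ∈ Z → w = w' := by
  constructor
  · intro h
    have hfin : s.Finite := Set.encard_lt_top_iff.1 (h.trans_lt (ENat.natCast_lt_top k))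
    obtain ⟨f, hf, hinj⟩ := hfin.exists_injOn_of_encard_le (t := Set.Iio k) (by rwa [encard_Iio])
    refine ⟨{x | ∃ w ∈ s, x = pairNat w (f w)}, fun w hw => ⟨f w, hf hw, w, hw, rfl⟩, ?_⟩
    rintro w w' c ⟨u, hu, h⟩ ⟨u', hu', h'⟩
    rw [pairNat_inj] at h h'
    rw [h.1, h'.1]
    exact hinj hu hu' (h.2.symm.trans h'.2)
  · rintro ⟨Z, h1, h2⟩
    have h1' : ∀ w, ∃ c, w ∈ s → c < k ∧ pairNat w c ∈ Z := fun w => by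
      by_cases hw : w ∈ s
      · obtain ⟨c, hc⟩ := h1 w hw
        exact ⟨c, fun _ => hc⟩
      · exact ⟨0, fun h => absurd h hw⟩
    choose f hf using h1'
    have := Set.encard_le_encard_of_injOn (s := s) (t := Set.Iio k) (f := f)
      (fun w hw => (hf w hw).1) fun w hw w' hw' h => h2 w w' (f w) (hf w hw).2 (h ▸ (hf w' hw').2)
    rwa [encard_Iio] at this

theorem holds_boundedBranching (hE : EncodesSystem S E) :
    boundedBranching.Holds e E ↔ S.BoundedBranching := by
  simp [boundedBranching, hE.edge, TransitionSystem.BoundedBranching, encard_le_iff]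

/-- The formula `χ` expresses the property `C` of systems on the natural numbers. -/
def Expresses (AP : Type) [Encodable AP] (χ : SOArith) (C : TransitionSystem AP ℕ → Prop) : Prop :=
  ∀ (S : TransitionSystem AP ℕ) (e : ℕ → ℕ) (E : ℕ → Set ℕ), EncodesSystem S E →
    (χ.Holds e E ↔ C S)

/-- The sets quantified first are read as edges and labels of a system on `ℕ`, where `total`
supplies the successors that a transition system must have; conversely, each such system is coded by
two sets of pairs. -/
theorem holds_satisfiable {χ : SOArith} {C : TransitionSystem AP ℕ → Prop}
    (hχ : Expresses AP χ C) {φ : HyperCTL AP} (hφ : φ.freeVars = ∅) :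
    (satisfiable χ φ.toSO).Holds e E ↔ ∃ S : TransitionSystem AP ℕ, C S ∧ φ.IsModel S := by
  have key : ∀ (S : TransitionSystem AP ℕ) (e : ℕ → ℕ) (E : ℕ → Set ℕ), EncodesSystem S E →
      EncodesFrom (E 0) 0 (fun _ => S.init) → e 0 = 0 → (φ.toSO.Holds e E ↔ φ.IsModel S) := by
    intro S e E hE h0 he
    exact φ.holds_toSO ⟨hE, by simp [hφ], fun j u => by rw [he]; exact h0 j u⟩
  simp only [satisfiable, holds_exSet, holds_and, holds_total, holds_exNum, holds_constant]
  constructor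
  · rintro ⟨A, B, ht, hC, i, Z, hZ, n, hn, hm⟩
    let S : TransitionSystem AP ℕ := ⟨fun v w => pairNat v w ∈ A, i,
      fun v => {a | pairNat v (Encodable.encode a) ∈ B}, by simpa using ht⟩
    have hE : EncodesSystem S (Function.update (Function.update E 1 A) 2 B) :=
      ⟨fun v w => by simp [S], fun v a => by simp [S]⟩
    refine ⟨S, (hχ S _ _ hE).1 hC, (key S _ _ ⟨fun v w => by simp [S], fun v a => by simp [S]⟩ ?_
      ?_).1 hm⟩
    · simpa using hZ
    · simpa using hn
  · rintro ⟨S, hC, hm⟩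
    let A : Set ℕ := {x | ∃ v w, S.edge v w ∧ x = pairNat v w}
    let B : Set ℕ := {x | ∃ v a, a ∈ S.label v ∧ x = pairNat v (Encodable.encode a)}
    have hA : ∀ v w, pairNat v w ∈ A ↔ S.edge v w := fun v w => by
      simp [A, pairNat_inj]
    have hB : ∀ v a, pairNat v (Encodable.encode a) ∈ B ↔ a ∈ S.label v := fun v a => by
      simp [B, pairNat_inj]
    have hE : EncodesSystem S (Function.update (Function.update E 1 A) 2 B) :=
      ⟨fun v w => by simp [hA], fun v a => by simp [hB]⟩
    obtain ⟨Z, hZ⟩ := exists_encodesFrom 0 fun _ => S.init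
    refine ⟨A, B, ?_, (hχ S _ _ hE).2 hC, S.init, Z, by simpa using hZ, 0, by simp,
      (key S _ _ ⟨fun v w => by simp [hA], fun v a => by simp [hB]⟩ (by simpa using hZ)
        (by simp)).2 hm⟩
    simpa [hA] using S.total

end SOArith

end

/-! ### Computability of the reduction to second-order arithmetic -/

/-- The numeral of an atomic proposition depends on the input, so the template `hasLabel` is not
built from fixed terms alone. -/
theorem ArithTerm.primrec_code_numeral : Primrec fun n => (numeral n).code := by
  have h : Primrec₂ fun (_ : ℕ) (c : ℕ) => Nat.pair 3 (Nat.pair c one.code) :=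
    (Primrec.const 3).natPair (Primrec.snd.natPair (Primrec.const _))
  refine (Primrec.nat_rec₁ zero.code h).of_eq fun n => ?_
  induction n with
  | zero => rfl
  | succ n ih => exact congrArg (fun c => Nat.pair 3 (Nat.pair c one.code)) ih

namespace SOArith

variable {G G' : ℕ → SOArith → SOArith → SOArith} {v w : ℕ → ℕ}

theorem uniformCode_const (φ : SOArith) : UniformCode code fun _ _ _ => φ :=
  .leaf (Primrec.const _)

theorem uniformCode_mem (s : ArithTerm) (hv : Primrec v) :
    UniformCode code fun p _ _ => mem s (v p) :=
  .leaf ((Primrec.const 2).natPair ((Primrec.const _).natPair hv))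

theorem uniformCode_neg (h : UniformCode code G) : UniformCode code fun p x y => neg (G p x y) :=
  h.unary 3 fun _ => rfl

theorem uniformCode_or (h : UniformCode code G) (h' : UniformCode code G') :
    UniformCode code fun p x y => or (G p x y) (G' p x y) := h.binary h' 4 fun _ _ => rfl

theorem uniformCode_exNum (n : ℕ) (h : UniformCode code G) :
    UniformCode code fun p x y => exNum n (G p x y) :=
  h.binder (Primrec.const n) 5 fun _ _ => rfl

theorem uniformCode_allNum (n : ℕ) (h : UniformCode code G) :
    UniformCode code fun p x y => allNum n (G p x y) :=
  h.binder (Primrec.const n) 6 fun _ _ => rfl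

theorem uniformCode_exSet (hv : Primrec v) (h : UniformCode code G) :
    UniformCode code fun p x y => exSet (v p) (G p x y) := h.binder hv 7 fun _ _ => rfl

theorem uniformCode_and (h : UniformCode code G) (h' : UniformCode code G') :
    UniformCode code fun p x y => and (G p x y) (G' p x y) :=
  uniformCode_neg (uniformCode_or (uniformCode_neg h) (uniformCode_neg h'))

theorem uniformCode_imp (h : UniformCode code G) (h' : UniformCode code G') :
    UniformCode code fun p x y => imp (G p x y) (G' p x y) :=
  uniformCode_or (uniformCode_neg h) h'

theorem uniformCode_atTime (k : ℕ) (h : UniformCode code G) :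
    UniformCode code fun p x y => atTime k (G p x y) :=
  uniformCode_exNum 0 (uniformCode_and (uniformCode_const _) h)

theorem uniformCode_nextTime (h : UniformCode code G) :
    UniformCode code fun p x y => nextTime (G p x y) :=
  uniformCode_exNum 1 (uniformCode_and (uniformCode_const _) (uniformCode_atTime 1 h))

theorem uniformCode_untilTime (h : UniformCode code G) (h' : UniformCode code G') :
    UniformCode code fun p x y => untilTime (G p x y) (G' p x y) :=
  uniformCode_exNum 1 (uniformCode_and (uniformCode_const _) (uniformCode_and
    (uniformCode_atTime 1 h') (uniformCode_allNum 2 (uniformCode_imp (uniformCode_const _)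
      (uniformCode_atTime 2 h)))))

theorem uniformCode_isPath (hv : Primrec v) : UniformCode code fun p _ _ => isPath (v p) :=
  uniformCode_allNum 3 (uniformCode_imp (uniformCode_const _) (uniformCode_exNum 4
    (uniformCode_and (uniformCode_mem _ hv) (uniformCode_and (uniformCode_allNum 5
      (uniformCode_imp (uniformCode_mem _ hv) (uniformCode_const _))) (uniformCode_exNum 5
        (uniformCode_and (uniformCode_mem _ hv) (uniformCode_const _)))))))

theorem uniformCode_meetNow (hv : Primrec v) (hw : Primrec w) :
    UniformCode code fun p _ _ => meetNow (v p) (w p) :=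
  uniformCode_exNum 3 (uniformCode_and (uniformCode_mem _ hv) (uniformCode_mem _ hw))

theorem uniformCode_sameSet (hv : Primrec v) (hw : Primrec w) :
    UniformCode code fun p _ _ => sameSet (v p) (w p) :=
  have h := uniformCode_mem (.var 3) hv
  have h' := uniformCode_mem (.var 3) hw
  uniformCode_allNum 3 (uniformCode_and (uniformCode_imp h h') (uniformCode_imp h' h))

theorem uniformCode_exPath (hv : Primrec v) (h : UniformCode code G) :
    UniformCode code fun p x y => exPath (v p) (G p x y) :=
  uniformCode_exSet hv (uniformCode_and (uniformCode_isPath hv) (uniformCode_and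
    (uniformCode_meetNow hv (Primrec.const 0)) (uniformCode_exSet (Primrec.const 0)
      (uniformCode_and (uniformCode_sameSet (Primrec.const 0) hv) h))))

theorem uniformCode_hasLabel (hv : Primrec v) (hw : Primrec w) :
    UniformCode code fun p _ _ => hasLabel (v p) (w p) := by
  refine uniformCode_exNum 3 (uniformCode_and (uniformCode_mem _ hw) (.leaf ?_))
  have h := ArithTerm.primrec_code_numeral.comp hv
  have h3 : Primrec fun _ : ℕ => (ArithTerm.var 3).code := Primrec.const _
  have hs := (Primrec.const 3).natPair (h3.natPair h)
  exact (Primrec.const 2).natPair (((Primrec.const 3).natPair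
    (((Primrec.const 4).natPair (hs.natPair hs)).natPair h3)).natPair (Primrec.const 2))

theorem uniformCode_satisfiable (χ : SOArith) (h : UniformCode code G) :
    UniformCode code fun p x y => satisfiable χ (G p x y) :=
  uniformCode_exSet (Primrec.const 1) (uniformCode_exSet (Primrec.const 2)
    (uniformCode_and (uniformCode_const _) (uniformCode_and (uniformCode_const _)
      (uniformCode_exNum 6 (uniformCode_exSet (Primrec.const 0) (uniformCode_and
        (uniformCode_const _) (uniformCode_exNum 0 (uniformCode_and (uniformCode_const _) h))))))))

end SOArith

open SOArith in
-- One function serves all `n`: both the code of an atom and its translation contain only the number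
-- that encodes the proposition. The version with `n` as part of the input relies on this.
theorem HyperCTL.exists_primrec_toSO :
    ∃ T : ℕ → ℕ, Primrec T ∧ ∀ (n : ℕ) (φ : HyperCTL (Fin n)), φ.toSO.code = T φ.code := by
  have lin := Primrec.id.linear 1 3
  simp only [id, one_mul] at lin
  have p1 := Primrec.id.fst_unpair
  have p2 := Primrec.nat_add.comp Primrec.id.snd_unpair (Primrec.const 3)
  obtain ⟨F0, p0, h0⟩ := uniformCode_hasLabel p1 p2
  obtain ⟨F1, p1, h1⟩ := SOArith.uniformCode_neg .left
  obtain ⟨F2, p2, h2⟩ := SOArith.uniformCode_or .left .right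
  obtain ⟨F3, p3, h3⟩ := uniformCode_nextTime .left
  obtain ⟨F4, p4, h4⟩ := uniformCode_untilTime .left .right
  obtain ⟨F5, p5, h5⟩ := uniformCode_exPath lin .right
  obtain ⟨F6, p6, h6⟩ := SOArith.uniformCode_neg (uniformCode_exPath lin (SOArith.uniformCode_neg .right))
  let H : Unit → ℕ × ℕ × ℕ × ℕ × ℕ → ℕ := fun _ q =>
    if q.1 = 0 then F0 (q.2.1, total.code, total.code) else
    if q.1 = 1 then F1 (0, q.2.2.1, q.2.2.1) else
    if q.1 = 2 then F2 (0, q.2.2.2) else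
    if q.1 = 3 then F3 (0, q.2.2.1, q.2.2.1) else
    if q.1 = 4 then F4 (0, q.2.2.2) else
    if q.1 = 5 then F5 (q.2.1.unpair.1, q.2.2.2.2, q.2.2.2.2) else
    F6 (q.2.1.unpair.1, q.2.2.2.2, q.2.2.2.2)
  have t : Primrec fun q : Unit × ℕ × ℕ × ℕ × ℕ × ℕ => q.2.1 := Primrec.fst.comp Primrec.snd
  have b : Primrec fun q : Unit × ℕ × ℕ × ℕ × ℕ × ℕ => q.2.2.1 :=
    Primrec.fst.comp (Primrec.snd.comp Primrec.snd)
  have x : Primrec fun q : Unit × ℕ × ℕ × ℕ × ℕ × ℕ => q.2.2.2.1 :=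
    Primrec.fst.comp (Primrec.snd.comp (Primrec.snd.comp Primrec.snd))
  have yz : Primrec fun q : Unit × ℕ × ℕ × ℕ × ℕ × ℕ => q.2.2.2.2 :=
    Primrec.snd.comp (Primrec.snd.comp (Primrec.snd.comp Primrec.snd))
  have z := Primrec.snd.comp yz
  have b1 := b.fst_unpair
  have c0 := Primrec.const (α := Unit × ℕ × ℕ × ℕ × ℕ × ℕ) (0 : ℕ)
  have hH : Primrec₂ H :=
    t.tag 0 (p0.comp (b.pair (Primrec.const _))) <| t.tag 1 (p1.comp (c0.pair (x.pair x))) <|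
    t.tag 2 (p2.comp (c0.pair yz)) <| t.tag 3 (p3.comp (c0.pair (x.pair x))) <|
    t.tag 4 (p4.comp (c0.pair yz)) <|
    t.tag 5 (p5.comp (b1.pair (z.pair z))) (p6.comp (b1.pair (z.pair z)))
  refine ⟨codeFold H (), (Primrec.codeFold H hH).comp (Primrec.const ()) Primrec.id,
    fun n φ => ?_⟩
  induction φ with
  | atom a v =>
    rw [code, codeFold_pair_zero _ _ (by simp [H])]
    refine Eq.trans ?_ (h0 (Nat.pair (Encodable.encode a) v) total total)
    simp only [id, Nat.unpair_pair]
    rfl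
  | neg φ ih =>
    rw [code, codeFold_pair _ _ (by simp)]
    simp only [← ih]
    exact h1 0 φ.toSO φ.toSO
  | or φ₁ φ₂ ih₁ ih₂ =>
    rw [code, codeFold_pair _ _ (by simp)]
    simp only [Nat.unpair_pair, ← ih₁, ← ih₂]
    exact h2 0 φ₁.toSO φ₂.toSO
  | next φ ih =>
    rw [code, codeFold_pair _ _ (by simp)]
    simp only [← ih]
    exact h3 0 φ.toSO φ.toSO
  | ex v φ ih =>
    rw [code, codeFold_pair _ _ (by simp)]
    simp only [Nat.unpair_pair, ← ih]
    refine Eq.trans ?_ (h5 (Nat.pair v φ.code).unpair.1 φ.toSO φ.toSO)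
    simp only [Nat.unpair_pair]
    rfl
  | all v φ ih =>
    rw [code, codeFold_pair _ _ (by simp)]
    simp only [Nat.unpair_pair, ← ih]
    refine Eq.trans ?_ (h6 (Nat.pair v φ.code).unpair.1 φ.toSO φ.toSO)
    simp only [Nat.unpair_pair]
    rfl
  | _ φ₁ φ₂ ih₁ ih₂ =>
    rw [code, codeFold_pair _ _ (by simp)]
    simp only [Nat.unpair_pair, ← ih₁, ← ih₂]
    exact h4 0 φ₁.toSO φ₂.toSO

theorem HyperCTL.exists_primrec_isCode : ∃ V : ℕ → ℕ → Bool, Primrec₂ V ∧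
    ∀ n c, V n c = true ↔ ∃ φ : HyperCTL (Fin n), φ.code = c := by
  let H : ℕ → ℕ × ℕ × Bool × Bool × Bool → Bool := fun n q =>
    if q.1 = 0 then decide (q.2.1.unpair.1 < n) else
    if q.1 = 1 then q.2.2.1 else if q.1 = 2 then q.2.2.2.1 && q.2.2.2.2 else
    if q.1 = 3 then q.2.2.1 else if q.1 = 4 then q.2.2.2.1 && q.2.2.2.2 else
    if q.1 = 5 then q.2.2.2.2 else if q.1 = 6 then q.2.2.2.2 else false
  have t : Primrec fun q : ℕ × ℕ × ℕ × Bool × Bool × Bool => q.2.1 :=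
    Primrec.fst.comp Primrec.snd
  have b : Primrec fun q : ℕ × ℕ × ℕ × Bool × Bool × Bool => q.2.2.1 :=
    Primrec.fst.comp (Primrec.snd.comp Primrec.snd)
  have x : Primrec fun q : ℕ × ℕ × ℕ × Bool × Bool × Bool => q.2.2.2.1 :=
    Primrec.fst.comp (Primrec.snd.comp (Primrec.snd.comp Primrec.snd))
  have yz : Primrec fun q : ℕ × ℕ × ℕ × Bool × Bool × Bool => q.2.2.2.2 :=
    Primrec.snd.comp (Primrec.snd.comp (Primrec.snd.comp Primrec.snd))
  have z := Primrec.snd.comp yz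
  have yz' := (Primrec.fst.comp yz).and' z
  have lt := (Primrec.nat_lt.comp b.fst_unpair Primrec.fst).decide
  have hH : Primrec₂ H :=
    t.tag 0 lt <| t.tag 1 x <| t.tag 2 yz' <| t.tag 3 x <| t.tag 4 yz' <| t.tag 5 z <|
      t.tag 6 z <| Primrec.const false
  obtain ⟨F, hF, h0, hp⟩ := exists_codeFold H hH (by simp [H])
  refine ⟨F, hF, fun n c => ?_⟩
  replace h0 := h0 n
  replace hp := hp n
  constructor
  · induction c using Nat.strong_induction_on with
    | _ c ih =>
      obtain ⟨t, b, rfl⟩ := Nat.exists_eq_pair c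
      obtain ⟨l, r, rfl⟩ := Nat.exists_eq_pair b
      rcases Nat.eq_zero_or_pos t with rfl | ht
      · rw [h0]
        simp only [H, if_true, Nat.unpair_pair, decide_eq_true_eq]
        exact fun h => ⟨.atom ⟨l, h⟩ r, rfl⟩
      · have hlr := Nat.lt_pair_of_pos (b := Nat.pair l r) ht
        have ib := ih _ hlr
        have il := ih l ((Nat.left_le_pair l r).trans_lt hlr)
        have ir := ih r ((Nat.right_le_pair l r).trans_lt hlr)
        rw [hp _ _ ht]
        simp only [Nat.unpair_pair]
        match t with
        | 1 =>
          intro h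
          obtain ⟨φ, hφ⟩ := ib h
          exact ⟨.neg φ, by rw [code, hφ]⟩
        | 2 =>
          intro h
          simp [H] at h
          obtain ⟨s, rfl⟩ := il h.1
          obtain ⟨s', rfl⟩ := ir h.2
          exact ⟨.or s s', rfl⟩
        | 3 =>
          intro h
          obtain ⟨φ, hφ⟩ := ib h
          exact ⟨.next φ, by rw [code, hφ]⟩
        | 4 =>
          intro h
          simp [H] at h
          obtain ⟨s, rfl⟩ := il h.1
          obtain ⟨s', rfl⟩ := ir h.2
          exact ⟨.until s s', rfl⟩
        | 5 =>
          intro h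
          obtain ⟨φ, rfl⟩ := ir h
          exact ⟨.ex l φ, rfl⟩
        | 6 =>
          intro h
          obtain ⟨φ, rfl⟩ := ir h
          exact ⟨.all l φ, rfl⟩
        | t + 7 => simp [H]
  · rintro ⟨φ, rfl⟩
    induction φ with
    | atom a v =>
      rw [code, h0]
      have ha : Encodable.encode a < n := a.isLt
      simpa [H] using ha
    | neg φ ih => rw [code, hp _ _ (by simp)]; exact ih
    | next φ ih => rw [code, hp _ _ (by simp)]; exact ih
    | ex v φ ih => rw [code, hp _ _ (by simp)]; simp [H, ih]
    | all v φ ih => rw [code, hp _ _ (by simp)]; simp [H, ih]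
    | _ φ₁ φ₂ ih₁ ih₂ => rw [code, hp _ _ (by simp)]; simp [H, ih₁, ih₂]

/-- Guardedness leaves no trace in the translated formula and must be tested on the input. The other
half of being a sentence needs no test, since the translation is a sentence exactly if the input has
no free variables. -/
theorem HyperCTL.exists_primrec_temporalGuarded : ∃ V : ℕ → Bool, Primrec V ∧
    ∀ (n : ℕ) (φ : HyperCTL (Fin n)), V φ.code = true ↔ φ.TemporalGuarded := by
  let H : Unit → ℕ × ℕ × Bool × Bool × Bool → Bool := fun _ q =>
    if q.1 = 0 then true else if q.1 = 1 then q.2.2.1 else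
    if q.1 = 2 then q.2.2.2.1 && q.2.2.2.2 else
    if q.1 = 3 then false else if q.1 = 4 then false else true
  have t : Primrec fun q : Unit × ℕ × ℕ × Bool × Bool × Bool => q.2.1 :=
    Primrec.fst.comp Primrec.snd
  have x : Primrec fun q : Unit × ℕ × ℕ × Bool × Bool × Bool => q.2.2.2.1 :=
    Primrec.fst.comp (Primrec.snd.comp (Primrec.snd.comp Primrec.snd))
  have yz : Primrec fun q : Unit × ℕ × ℕ × Bool × Bool × Bool => q.2.2.2.2 :=
    Primrec.snd.comp (Primrec.snd.comp (Primrec.snd.comp Primrec.snd))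
  have hH : Primrec₂ H :=
    t.tag 0 (Primrec.const true) <| t.tag 1 x <|
      t.tag 2 ((Primrec.fst.comp yz).and' (Primrec.snd.comp yz)) <|
      t.tag 3 (Primrec.const false) <| t.tag 4 (Primrec.const false) <| Primrec.const true
  obtain ⟨F, hF, h0, hp⟩ := exists_codeFold H hH (by simp [H])
  replace h0 := h0 ()
  replace hp := hp ()
  refine ⟨F (), hF.comp (Primrec.const ()) Primrec.id, fun n φ => ?_⟩
  induction φ with
  | atom a v => rw [code, h0]; simp [H, TemporalGuarded]
  | neg φ ih => rw [code, hp _ _ (by simp)]; exact ih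
  | or φ₁ φ₂ ih₁ ih₂ => rw [code, hp _ _ (by simp)]; simp [H, ih₁, ih₂, TemporalGuarded]
  | next φ ih => rw [code, hp _ _ (by simp)]; simp [H, TemporalGuarded]
  | ex v φ ih => rw [code, hp _ _ (by simp)]; simp [H, TemporalGuarded]
  | all v φ ih => rw [code, hp _ _ (by simp)]; simp [H, TemporalGuarded]
  | _ φ₁ φ₂ ih₁ ih₂ => rw [code, hp _ _ (by simp)]; simp [H, TemporalGuarded]

/-! ### The equivalence of the problems -/

open SOArith in
/-- Satisfiability in systems with a property `C` that is expressible in second-order arithmetic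
reduces to truth in second-order arithmetic. -/
theorem uniform_reducible_SOTruth {P : ℕ → ℕ → Prop} (χ : SOArith) (h1 : χ.freeNumVars = ∅)
    (h2 : χ.freeSetVars ⊆ {1}) (C : ∀ n, TransitionSystem (Fin n) ℕ → Prop)
    (hχ : ∀ n, Expresses (Fin n) χ (C n)) (hP : ∀ n c, P n c ↔ ∃ φ : HyperCTL (Fin n),
      φ.code = c ∧ φ.IsSentence ∧ ∃ S : TransitionSystem (Fin n) ℕ, C n S ∧ φ.IsModel S) :
    Uniform P ≤₀ SOTruth := by
  obtain ⟨T, hT, ht⟩ := HyperCTL.exists_primrec_toSO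
  obtain ⟨V, hV, hv⟩ := HyperCTL.exists_primrec_isCode
  obtain ⟨W, hW, hw⟩ := HyperCTL.exists_primrec_temporalGuarded
  obtain ⟨F, hF, hf⟩ := uniformCode_satisfiable χ .left
  -- The tags of arithmetical formulas end at `8`, which leaves this number as a negative instance.
  have hbad : ∀ φ : SOArith, φ.code ≠ Nat.pair 9 0 := by
    intro φ
    cases φ <;> simp [SOArith.code, Nat.pair_eq_pair]
  have hred : ∀ {n : ℕ} (φ : HyperCTL (Fin n)),
      (satisfiable χ φ.toSO).code = F (0, T φ.code, total.code) := fun φ => by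
    rw [← ht]
    exact hf 0 φ.toSO total
  have p1 := Primrec.id.fst_unpair
  have p2 := Primrec.id.snd_unpair
  refine ⟨fun m => if (V m.unpair.1 m.unpair.2 && W m.unpair.2) = true then
    F (0, T m.unpair.2, total.code) else Nat.pair 9 0, ?_, fun m => ?_⟩
  · exact (Primrec.ite (Primrec.eq.comp ((hV.comp p1 p2).and' (hW.comp p2)) (Primrec.const true))
      (hF.comp ((Primrec.const 0).pair ((hT.comp p2).pair (Primrec.const _))))
      (Primrec.const _)).to_comp
  · rw [Uniform, hP]
    beta_reduce
    generalize m.unpair.1 = n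
    generalize m.unpair.2 = c
    constructor
    · rintro ⟨φ, rfl, hφ, h⟩
      rw [if_pos (by rw [Bool.and_eq_true, hv, hw]; exact ⟨⟨φ, rfl⟩, hφ.1⟩)]
      exact ⟨_, hred φ, (isSentence_satisfiable χ h1 h2 φ).2 hφ.2,
        fun e E => (holds_satisfiable (hχ n) hφ.2).2 h⟩
    · rintro ⟨ψ, hψ, hs, hm⟩
      split_ifs at hψ with hc
      · rw [Bool.and_eq_true, hv] at hc
        obtain ⟨⟨φ, rfl⟩, hg⟩ := hc
        rw [← hred] at hψ
        obtain rfl := SOArith.code_injective hψ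
        have hφ := (isSentence_satisfiable χ h1 h2 φ).1 hs
        exact ⟨φ, rfl, ⟨(hw n φ).1 hg, hφ⟩,
          (holds_satisfiable (hχ n) hφ).1 (hm (fun _ => 0) fun _ => ∅)⟩
      · exact absurd hψ (hbad ψ)

open SOArith in
theorem uniform_sat_reducible_SOTruth : Uniform CountableSat ≤₀ SOTruth ∧
    Uniform FinitelyBranchingSat ≤₀ SOTruth ∧ Uniform BoundedBranchingSat ≤₀ SOTruth := by
  -- Countability imposes nothing on systems on `ℕ`, so `total`, which every system satisfies,
  -- serves as the defining formula.
  refine ⟨uniform_reducible_SOTruth total ?_ ?_ (fun _ _ => True)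
      (fun n S e E h => ?_) (fun n c => ?_),
    uniform_reducible_SOTruth finitelyBranching ?_ ?_ (fun _ S => S.FinitelyBranching)
      (fun n S e E h => holds_finitelyBranching h) (fun n c => ?_),
    uniform_reducible_SOTruth boundedBranching ?_ ?_ (fun _ S => S.BoundedBranching)
      (fun n S e E h => holds_boundedBranching h) (fun n c => ?_)⟩
  any_goals
    ext x
    simp [total, finitelyBranching, boundedBranching, SOArith.and, SOArith.imp, memPair,
      SOArith.freeNumVars, ArithTerm.freeVars]
    try grind
  any_goals
    intro x
    simp [total, finitelyBranching, boundedBranching, SOArith.and, SOArith.imp, memPair,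
      SOArith.freeSetVars]
  · simpa [holds_total, h.edge] using S.total
  · simp only [CountableSat, countable_model_iff]
  · simp only [FinitelyBranchingSat, finitelyBranching_model_iff]
  · simp only [BoundedBranchingSat, boundedBranching_model_iff]

/-- Fixing the number of atomic propositions. -/
theorem reducible_uniform (P : ℕ → ℕ → Prop) (n : ℕ) : P n ≤₀ Uniform P :=
  ⟨fun c => Nat.pair n c, ((Primrec.const n).natPair Primrec.id).to_comp,
    fun c => by simp [Uniform]⟩

/-- Problems that are interreducible with a problem `R` are interreducible. -/
theorem effectivelyInterreducible_of_common {A B C R : ℕ → Prop} (hA : A ≤₀ R) (hB : B ≤₀ R)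
    (hC : C ≤₀ R) (hA' : R ≤₀ A) (hB' : R ≤₀ B) (hC' : R ≤₀ C) :
    EffectivelyInterreducible {A, B, C, R} := by
  have h : ∀ P ∈ ({A, B, C, R} : Set (ℕ → Prop)), P ≤₀ R ∧ R ≤₀ P := by
    rintro P (rfl | rfl | rfl | rfl)
    exacts [⟨hA, hA'⟩, ⟨hB, hB'⟩, ⟨hC, hC'⟩, ⟨manyOneReducible_refl _, manyOneReducible_refl _⟩]
  exact fun P hP Q hQ => (h P hP).1.trans (h Q hQ).2

theorem mainTheorem5 :
    -- the set of atomic propositions is part of the input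
    EffectivelyInterreducible {Uniform CountableSat, Uniform FinitelyBranchingSat,
      Uniform BoundedBranchingSat, SOTruth} ∧
    -- the set of atomic propositions is fixed (and has at least eight elements)
    (∀ n : ℕ, 8 ≤ n →
      EffectivelyInterreducible {CountableSat n, FinitelyBranchingSat n,
        BoundedBranchingSat n, SOTruth}) ∧
    -- a HyperLTL sentence with the closure as its unique model
    (∃ φ : HyperLTL ArithProp, φ.IsSentence ∧
      ∀ T : Set (Trace ArithProp), φ.IsModel T ↔ T = Trace.closure opTraces) ∧
    -- the closure is realised by a countable, finitely-branching transition system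
    (Countable (Trace.prefsOf (Trace.closure opTraces)) ∧
      (Trace.prefixTree (Trace.closure opTraces) closure_opTraces_nonempty).FinitelyBranching ∧
      (Trace.prefixTree (Trace.closure opTraces) closure_opTraces_nonempty).tracesFromSuccessors =
        Trace.closure opTraces) := by
  obtain ⟨uc, uf, ub⟩ := uniform_sat_reducible_SOTruth
  refine ⟨?_, fun n hn => ?_, ⟨OpFormula.sentence, OpFormula.isSentence_sentence,
    fun T => OpFormula.isModel_iff⟩, inferInstance, Trace.prefixTree_finitelyBranching _,
    (Trace.prefixTree_tracesFromSuccessors _).trans (Trace.closure_closure _)⟩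
  -- Hardness of the uniform problems is inherited from their restrictions to eight propositions; in
  -- the other case, membership of the restrictions comes from the uniform problems.
  · obtain ⟨hc, hf, hb⟩ := SOTruth_reducible_sat le_rfl
    exact effectivelyInterreducible_of_common uc uf ub (hc.trans (reducible_uniform _ 8))
      (hf.trans (reducible_uniform _ 8)) (hb.trans (reducible_uniform _ 8))
  · obtain ⟨hc, hf, hb⟩ := SOTruth_reducible_sat hn
    exact effectivelyInterreducible_of_common ((reducible_uniform _ n).trans uc)
      ((reducible_uniform _ n).trans uf) ((reducible_uniform _ n).trans ub) hc hf hb
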